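/- Let $d\ge 1$, $\beta>0$. Let $\phi:\mathbb{R}^d\to[0,\infty)$ be differentiable on $\mathbb{R}^d\setminus\{0\}$ (its value at $0$ is an arbitrary nonnegative number), and suppose that there is a twice differentiable convex function $\psi$ on $(0,\infty)$, with $x\mapsto\psi(|x|)$ locally integrable on $\mathbb{R}^d$, such that $|\phi(x)|\le\psi(|x|)$ and $|\nabla\phi(x)|\le|\psi'(|x|)|$ for all $x\ne0$. Suppose also that $\phi(x)\neq 0$ for some $x\in[-1/2,1/2]^d\setminus\{0\}$. (Examples: $\phi(x)=e^{-|x|}$, and $\phi(x)=|x|^{-\alpha}$ for $x\neq 0$, with $0\le\alpha<d$.) For an integer $L\ge1$ let $\Lambda_L$ be the hypercube of side $L$ in $\mathbb{Z}^d$ with periodic boundary conditions; for $i,j\in\Lambda_L$ let $\mathbf r_{i,j}$ be their relative position, with coordinates reduced modulo $L$ to $(-L/2,L/2]$, and let $\mathbf r_i$ be the position of $i$ with its coordinates reduced in the same way. For $\gamma>0$ let $$K(\mathbf r,\gamma)=\frac{\gamma^d\phi(\gamma\mathbf r)}{\sum_{i\in\Lambda_L}\gamma^d\phi(\gamma\mathbf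 r_i)},$$ so that $\sum_{i\in\Lambda_L}K(\mathbf r_i,\gamma)=1$ whenever the denominator does not vanish (it is positive for $\gamma L=1$ and all large $L$). For Ising spins $\sigma\in\{\pm1\}^{\Lambda_L}$ let $$\mathcal H_L^{(\gamma)}(\sigma)=-\sum_{i,j\in\Lambda_L}\sqrt{\tfrac{K(\mathbf r_{i,j},\gamma)}{2}}\,J^{(\gamma)}_{i,j}\sigma_i\sigma_j ,$$ the sum being over all ordered pairs, where the $J^{(\gamma)}_{i,j}$ are independent Gaussian random variables with variance $1$ and means $\beta\sqrt{K(\mathbf r_{i,j},\gamma)/2}$ (the Nishimori line), and let $Z_L^{(\gamma)}=\sum_\sigma e^{-\beta\mathcal H_L^{(\gamma)}(\sigma)}$. Likewise, for the Sherrington--Kirkpatrick model with $N$ spins on the Nishimori line, let $$\mathcal H_N^{\mathrm{SK}}(\sigma)=-\frac1{\sqrt{2N}}\sum_{i\ne j}J_{i,j}\sigma_i\sigma_j,\qquad Z_N^{\mathrm{SK}}=\sum_\sigma e^{-\beta\mathcal H_N^{\mathrm{SK}}(\sigma)},$$ the sum in $\mathcal H_N^{\mathrm{SK}}$ being over ordered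 pairs, with independent Gaussian $J_{i,j}$ of variance $1$ and mean $\beta/\sqrt{2N}$. Then the limits $$f^{\mathrm{SK}}(\beta)=-\lim_{N\to\infty}\frac1{\beta N}\mathbb E[\log Z_N^{\mathrm{SK}}],\qquad f(\beta)=-\lim_{L\to\infty,\ \gamma L=1}\frac1{\beta L^d}\mathbb E[\log Z_L^{(\gamma)}]$$ exist (in $\mathbb R$), and $f(\beta)=f^{\mathrm{SK}}(\beta)$. -/

import Mathlib

open MeasureTheory ProbabilityTheory Filter Topology

noncomputable section

namespace KacGlass

/-! ### Ising spin glasses with Gaussian pair couplings on a finite set of sites -/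

/-- Configurations of Ising spins `σ i = ±1` on the set of sites `ι`. -/
abbrev SpinConfig (ι : Type*) := ι → ℤˣ

/-- The real value `±1` of an Ising spin. -/
def spinVal (s : ℤˣ) : ℝ := ((s : ℤ) : ℝ)

/-- The Hamiltonian `H(σ) = - ∑_{i,j} a i j * J (i, j) * σ i * σ j`, summed over all ordered
pairs of sites, where `a` is deterministic and `J` is the family of random couplings. -/
def hamiltonian {ι : Type*} [Fintype ι] (a : ι → ι → ℝ) (J : ι × ι → ℝ)
    (σ : SpinConfig ι) : ℝ :=
  -∑ i, ∑ j, a i j * J (i, j) * spinVal (σ i) * spinVal (σ j)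

/-- The partition function `Z = ∑_σ exp (-β H(σ))`. -/
def partitionFunction {ι : Type*} [Fintype ι] [DecidableEq ι] (β : ℝ) (a : ι → ι → ℝ)
    (J : ι × ι → ℝ) : ℝ :=
  ∑ σ : SpinConfig ι, Real.exp (-β * hamiltonian a J σ)

/-- The law of the couplings: the `J (i, j)`, over ordered pairs, are independent Gaussian
variables with mean `J₀ i j` and variance `1`. -/
def couplingLaw {ι : Type*} [Fintype ι] (J₀ : ι → ι → ℝ) : Measure (ι × ι → ℝ) :=
  Measure.pi fun p : ι × ι => gaussianReal (J₀ p.1 p.2) 1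

/-- The quenched free energy per site, `-(1 / (β |ι|)) * E[log Z]`. -/
def quenchedFreeEnergy {ι : Type*} [Fintype ι] [DecidableEq ι] (β : ℝ) (a J₀ : ι → ι → ℝ) : ℝ :=
  -(1 / (β * (Fintype.card ι : ℝ))) *
    ∫ J, Real.log (partitionFunction β a J) ∂(couplingLaw J₀)

/-- The expectation in `quenchedFreeEnergy` is that of an integrable random variable. -/
theorem integrable_log_partitionFunction {ι : Type*} [Fintype ι] [DecidableEq ι] (β : ℝ)
    (a J₀ : ι → ι → ℝ) :
    Integrable (fun J => Real.log (partitionFunction β a J)) (couplingLaw J₀) := by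
  have hs : ∀ s : ℤˣ, |spinVal s| = 1 := by
    intro s; rcases Int.units_eq_one_or s with h | h <;> simp [spinVal, h]
  set B : (ι × ι → ℝ) → ℝ := fun J => ∑ i, ∑ j, |β| * (|a i j| * |J (i,j)|) with hB
  have hH : ∀ J (σ : SpinConfig ι), |(-β) * hamiltonian a J σ| ≤ B J := by
    intro J σ
    rw [hamiltonian, neg_mul_neg, abs_mul, hB]
    simp only [← Finset.mul_sum]
    refine mul_le_mul_of_nonneg_left ?_ (abs_nonneg _)
    refine (Finset.abs_sum_le_sum_abs _ _).trans (Finset.sum_le_sum fun i _ => ?_)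
    refine (Finset.abs_sum_le_sum_abs _ _).trans (Finset.sum_le_sum fun j _ => ?_)
    simp [abs_mul, hs]
  have hpi : IsProbabilityMeasure (couplingLaw J₀) := by unfold couplingLaw; infer_instance
  have hBi : Integrable B (couplingLaw J₀) := by
    refine integrable_finsetSum _ fun i _ => integrable_finsetSum _ fun j _ => ?_
    refine ((Integrable.abs ?_).const_mul _).const_mul _
    have : Integrable (fun x : ℝ => x) (gaussianReal (J₀ i j) 1) := by
      have := memLp_id_gaussianReal (μ := J₀ i j) (v := 1) 1
      exact memLp_one_iff_integrable.1 this
    exact integrable_comp_eval (μ := fun p : ι × ι => gaussianReal (J₀ p.1 p.2) 1) (i := (i,j)) (f := fun x => x) this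
  refine Integrable.mono' (g := fun J => Real.log (Fintype.card (SpinConfig ι)) + B J) ((integrable_const _).add hBi) ?_ ?_
  · apply Measurable.aestronglyMeasurable
    unfold partitionFunction hamiltonian; fun_prop
  · refine Filter.Eventually.of_forall fun J => ?_
    have hc : (1:ℝ) ≤ Fintype.card (SpinConfig ι) := by exact_mod_cast Fintype.card_pos
    have hl : Real.exp (-B J) ≤ partitionFunction β a J := by
      refine le_trans ?_ (Finset.single_le_sum (fun σ _ => (Real.exp_pos _).le) (Finset.mem_univ (fun _ => 1)))
      exact Real.exp_le_exp.2 (abs_le.1 (hH J _)).1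
    have hu : partitionFunction β a J ≤ Fintype.card (SpinConfig ι) * Real.exp (B J) := by
      unfold partitionFunction
      refine (Finset.sum_le_card_nsmul _ _ (Real.exp (B J)) fun σ _ => Real.exp_le_exp.2 (abs_le.1 (hH J σ)).2).trans (by simp)
    have h1 := Real.log_le_log (Real.exp_pos _) hl
    have h2 := Real.log_le_log ((Real.exp_pos _).trans_le hl) hu
    rw [Real.log_mul (by positivity) (Real.exp_ne_zero _), Real.log_exp] at h2
    rw [Real.log_exp] at h1
    rw [Real.norm_eq_abs, abs_le]
    have := Real.log_nonneg hc
    constructor <;> linarith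

/-! ### The Kac potential on a periodic hypercube -/

/-- The hypercube of side `L` in `ℤ^d` with periodic boundary conditions. -/
abbrev Torus (d L : ℕ) := Fin d → ZMod L

/-- The representative of a site (or of a difference of two sites) of the periodic hypercube
whose coordinates lie in `(-L/2, L/2]`. The relative position of the sites `i` and `j` is
`position (i - j)`. -/
def position {d L : ℕ} (i : Torus d L) : EuclideanSpace ℝ (Fin d) :=
  WithLp.toLp 2 fun k => (((i k).valMinAbs : ℤ) : ℝ)

/-- The Kac potential `K(r, γ)`, proportional to `γ^d φ(γ r)` and normalized so that its sum over
the `L^d` sites of the periodic hypercube is `1`. -/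
def kacPotential {d : ℕ} (L : ℕ) [NeZero L] (φ : EuclideanSpace ℝ (Fin d) → ℝ) (γ : ℝ)
    (r : EuclideanSpace ℝ (Fin d)) : ℝ :=
  γ ^ d * φ (γ • r) / ∑ i : Torus d L, γ ^ d * φ (γ • position i)

/-- The coefficient `√(K(r_{ij}, γ) / 2)` of the Hamiltonian with Kac potential. -/
def kacCoeff {d : ℕ} (L : ℕ) [NeZero L] (φ : EuclideanSpace ℝ (Fin d) → ℝ) (γ : ℝ)
    (i j : Torus d L) : ℝ :=
  Real.sqrt (kacPotential L φ γ (position (i - j)) / 2)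

/-- The finite-volume quenched free energy of the model with Kac potential on the Nishimori line,
where the mean of `J (i, j)` is `β √(K(r_{ij}, γ) / 2)`. -/
def kacFreeEnergy {d : ℕ} (L : ℕ) [NeZero L] (φ : EuclideanSpace ℝ (Fin d) → ℝ) (γ β : ℝ) : ℝ :=
  quenchedFreeEnergy β (kacCoeff L φ γ) fun i j => β * kacCoeff L φ γ i j

/-- `φ` is an admissible profile with majorant `ψ`. Only the values of `ψ` on `(0, ∞)` matter, and
`φ` may be singular at the origin, where its value is an arbitrary nonnegative number (the value
`0` removes the self-interaction). Integrability of `ψ` is local integrability of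
`x ↦ ψ |x|` on `ℝ^d`, which covers `ψ r = exp (-r)` and `ψ r = r ^ (-α)` for `0 ≤ α < d`. -/
structure IsKacProfile {d : ℕ} (φ : EuclideanSpace ℝ (Fin d) → ℝ) (ψ : ℝ → ℝ) : Prop where
  nonneg : ∀ x, 0 ≤ φ x
  differentiableAt : ∀ x, x ≠ 0 → DifferentiableAt ℝ φ x
  abs_le : ∀ x, x ≠ 0 → |φ x| ≤ ψ ‖x‖
  norm_gradient_le : ∀ x, x ≠ 0 → ‖gradient φ x‖ ≤ |deriv ψ ‖x‖|
  majorant_differentiable : DifferentiableOn ℝ ψ (Set.Ioi 0)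
  majorant_twice_differentiable : DifferentiableOn ℝ (deriv ψ) (Set.Ioi 0)
  majorant_convex : ConvexOn ℝ (Set.Ioi 0) ψ
  majorant_integrable : LocallyIntegrable fun x : EuclideanSpace ℝ (Fin d) => ψ ‖x‖

/-! ### The Sherrington-Kirkpatrick model -/

/-- The coefficient `1 / √(2N)` of the Sherrington-Kirkpatrick Hamiltonian, for `i ≠ j`. -/
def skCoeff (N : ℕ) (i j : Fin N) : ℝ :=
  if i = j then 0 else 1 / Real.sqrt (2 * N)

/-- The quenched free energy of the Sherrington-Kirkpatrick model with `N` spins on the Nishimori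
line, where the mean of `J (i, j)` is `β / √(2N)`. -/
def skFreeEnergy (N : ℕ) (β : ℝ) : ℝ :=
  quenchedFreeEnergy β (skCoeff N) fun _ _ => β / Real.sqrt (2 * N)

end KacGlass

end

/-! On the Nishimori line the law of the couplings is the centred Gaussian law tilted by the Gibbs
weight of one configuration. Cameron-Martin and gauge symmetry therefore turn the mean of `log Z`
into `(∑ l) / 2 + H(l)`, where `l e = (β a e)²` are the signal-to-noise ratios, `W` is the sum over
configurations of the weights `exp (∑ (√l u g - l / 2))`, and `H(l) = E[W log W] / |S|`
(`gaussEntropy`) under centred Gaussians. The first term is explicit, so the theorem is a statement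
about `H`.

Gaussian integration by parts shows that expectations of functions of the weights obey a heat
equation in `l`; the derivative of `H` in direction `v` is `E[∑ v e (∑ u e s p s)² / W] / (2|S|)`.
Two facts follow, at every temperature. Comparison (`gaussEntropy_le_add`): if `∑ (l₁ - l₀) u(r)
u(s) ≤ D` for all `r, s`, then `H(l₁) ≤ H(l₀) + D / 2`; for pair couplings the condition bounds a
quadratic form on sign vectors. Convexity (`convexOn_gaussEntropy`): the second derivative is a
positive average of `∑ v e v f Cov(u e, u f)²`, which is nonnegative by a Schur product argument.

Let `c = β² / 2`. For the mean-field model with all couplings `c / n`, comparison with independent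
blocks gives subadditivity, and Fekete's lemma gives a limit `p` of the entropy per site. The
Sherrington-Kirkpatrick model differs from it only on the diagonal, at bounded cost.

For the Kac model the lower bound is convexity: averaging the couplings over all permutations of the
sites decreases `H` and produces the mean-field model up to a bounded error
(`meanFieldEntropy_le_pairEntropy_add`). The upper bound is comparison: the normalized Kac matrix is
doubly stochastic and nearly constant on small cubes, so its quadratic form is almost dominated by
the projection onto cube averages, which is the form of independent mean-field models on the cubes
(`pairEntropy_le_sum_blocks_of_slowly_varying`). The number of cubes stays fixed while their sizes
grow, so both bounds give `p`.

The analytic input at `γ L = 1` is that the Riemann sums of `φ` are bounded below and vary little in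
`L¹` under small translations; the singularity at the origin is controlled by the integrable
majorant `ψ`. -/

noncomputable section

namespace KacGlass

/-! ### Gaussian tools -/

/-- The standard Gaussian measure on `E → ℝ`. -/
def stdGaussian (E : Type*) [Fintype E] : Measure (E → ℝ) :=
  Measure.pi fun _ : E => gaussianReal 0 1

instance {E : Type*} [Fintype E] : IsProbabilityMeasure (stdGaussian E) := by
  unfold stdGaussian; infer_instance

theorem integrable_exp_mul_abs_gaussianReal (A : ℝ) :
    Integrable (fun x : ℝ => Real.exp (A * |x|)) (gaussianReal 0 1) := by
  refine ((integrable_exp_mul_gaussianReal (μ := 0) (v := 1) A).add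
    (integrable_exp_mul_gaussianReal (μ := 0) (v := 1) (-A))).mono' (by fun_prop)
    (Eventually.of_forall fun x => ?_)
  rw [Real.norm_eq_abs, Real.abs_exp, Pi.add_apply]
  rcases abs_cases x with ⟨h, _⟩ | ⟨h, _⟩ <;> rw [h]
  · linarith [Real.exp_pos (-A * x)]
  · rw [show A * -x = -A * x by ring]; linarith [Real.exp_pos (A * x)]

/-- The common dominating function: weights, their inverses and their derivatives grow at most
exponentially in `∑ |g e|`. -/
theorem integrable_exp_mul_sum_abs {E : Type*} [Fintype E] (A : ℝ) :
    Integrable (fun g : E → ℝ => Real.exp (A * ∑ e, |g e|)) (stdGaussian E) := by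
  have h := Integrable.fintype_prod (𝕜 := ℝ) (μ := fun _ : E => gaussianReal 0 1)
    (f := fun _ x => Real.exp (A * |x|)) fun _ => integrable_exp_mul_abs_gaussianReal A
  simp only [← Real.exp_sum, ← Finset.mul_sum] at h
  exact h

theorem hasDerivAt_gaussianPDFReal (x : ℝ) :
    HasDerivAt (gaussianPDFReal 0 1) (-x * gaussianPDFReal 0 1 x) x := by
  have h : HasDerivAt (fun y : ℝ => -(y - 0) ^ 2 / (2 * ((1 : NNReal) : ℝ))) (-x) x := by
    have := (((hasDerivAt_id x).sub_const 0).pow 2).neg.div_const (2 * ((1 : NNReal) : ℝ))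
    refine this.congr_deriv ?_
    simp
    ring
  have h2 := h.exp.const_mul (Real.sqrt (2 * Real.pi * ((1 : NNReal) : ℝ)))⁻¹
  unfold gaussianPDFReal
  refine h2.congr_deriv ?_
  ring

theorem integrable_gaussianReal_iff (f : ℝ → ℝ) :
    Integrable f (gaussianReal 0 1) ↔ Integrable (fun x => gaussianPDFReal 0 1 x * f x) := by
  rw [gaussianReal_of_var_ne_zero 0 one_ne_zero,
    integrable_withDensity_iff_integrable_smul' (measurable_gaussianPDF 0 1)
      (Eventually.of_forall fun x => gaussianPDF_lt_top)]
  simp only [toReal_gaussianPDF, smul_eq_mul]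

/-- Gaussian integration by parts on the real line. -/
theorem integral_mul_gaussianReal_eq_integral_deriv {R R' : ℝ → ℝ}
    (hR : ∀ x, HasDerivAt R (R' x) x) (h0 : Integrable R (gaussianReal 0 1))
    (h1 : Integrable (fun x => x * R x) (gaussianReal 0 1))
    (h2 : Integrable R' (gaussianReal 0 1)) :
    ∫ x, x * R x ∂(gaussianReal 0 1) = ∫ x, R' x ∂(gaussianReal 0 1) := by
  rw [integrable_gaussianReal_iff] at h0 h1 h2
  rw [integral_gaussianReal_eq_integral_smul one_ne_zero,
    integral_gaussianReal_eq_integral_smul one_ne_zero]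
  have h := integral_mul_deriv_eq_deriv_mul_of_integrable (u := gaussianPDFReal 0 1)
    (u' := fun x => -x * gaussianPDFReal 0 1 x) (v := R) (v' := R')
    (fun x _ => hasDerivAt_gaussianPDFReal x) (fun x _ => hR x) h2
    (h1.neg.congr (Eventually.of_forall fun x => by
      simp only [Pi.neg_apply, Pi.mul_apply]; ring)) h0
  simp only [smul_eq_mul]
  rw [h, ← integral_neg]
  refine integral_congr_ae (Eventually.of_forall fun x => ?_)
  simp only; ring

theorem measurable_update_prod {E : Type*} [DecidableEq E] (e : E) :
    Measurable fun q : (E → ℝ) × ℝ => Function.update q.1 e q.2 := by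
  refine measurable_pi_lambda _ fun i => ?_
  by_cases h : i = e
  · subst h; simpa using measurable_snd
  · simp only [Function.update_of_ne h]; fun_prop

/-- Resampling one coordinate preserves the standard Gaussian measure. -/
theorem measurePreserving_update {E : Type*} [Fintype E] [DecidableEq E] (e : E) :
    MeasurePreserving (fun q : (E → ℝ) × ℝ => Function.update q.1 e q.2)
      ((stdGaussian E).prod (gaussianReal 0 1)) (stdGaussian E) := by
  have hm := measurable_update_prod e
  refine ⟨hm, ?_⟩
  unfold stdGaussian
  refine (Measure.pi_eq fun s hs => ?_).symm
  rw [Measure.map_apply hm (MeasurableSet.univ_pi hs)]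
  have : (fun q : (E → ℝ) × ℝ => Function.update q.1 e q.2) ⁻¹' (Set.univ.pi s) =
      (Set.univ.pi (Function.update s e Set.univ)) ×ˢ s e := by
    ext q
    simp only [Set.mem_preimage, Set.mem_pi, Set.mem_univ, true_imp_iff, Set.mem_prod]
    constructor
    · intro h
      refine ⟨fun i => ?_, by simpa using h e⟩
      by_cases hi : i = e
      · subst hi; simp
      · simpa [Function.update_of_ne hi] using h i
    · rintro ⟨h, h'⟩ i
      by_cases hi : i = e
      · subst hi; simpa using h'
      · simpa [Function.update_of_ne hi] using h i
  rw [this, Measure.prod_prod, Measure.pi_pi,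
    ← Finset.mul_prod_erase Finset.univ (fun i => gaussianReal 0 1 (s i)) (Finset.mem_univ e),
    ← Finset.mul_prod_erase Finset.univ _ (Finset.mem_univ e), mul_comm]
  congr 1
  simp only [Function.update_self, measure_univ, one_mul]
  refine Finset.prod_congr rfl fun i hi => ?_
  rw [Function.update_of_ne (Finset.ne_of_mem_erase hi)]

theorem abs_le_exp_abs (x : ℝ) : |x| ≤ Real.exp |x| := by linarith [Real.add_one_le_exp |x|]

/-- A linear factor in the field is absorbed by raising the exponential rate by one, so integration
by parts stays within the class of dominated functions. -/
theorem abs_coord_mul_exp_le {E : Type*} [Fintype E] (A : ℝ) (g : E → ℝ) (e : E) :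
    |g e| * Real.exp (A * ∑ i, |g i|) ≤ Real.exp ((A + 1) * ∑ i, |g i|) := by
  rw [add_mul, one_mul, add_comm, Real.exp_add]
  refine mul_le_mul_of_nonneg_right ((abs_le_exp_abs _).trans (Real.exp_le_exp.2 ?_))
    (Real.exp_pos _).le
  exact Finset.single_le_sum (f := fun i => |g i|) (fun i _ => abs_nonneg _) (Finset.mem_univ e)

/-- Gaussian integration by parts in one coordinate. -/
theorem integral_coord_mul_eq_integral_deriv {E : Type*} [Fintype E] [DecidableEq E] (e : E)
    {R R' : (E → ℝ) → ℝ} (hR : ∀ g x, HasDerivAt (fun y => R (Function.update g e y))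
      (R' (Function.update g e x)) x) (mR : Measurable R) (mR' : Measurable R') {A C : ℝ}
    (bR : ∀ g, |R g| ≤ C * Real.exp (A * ∑ i, |g i|))
    (bR' : ∀ g, |R' g| ≤ C * Real.exp (A * ∑ i, |g i|)) :
    ∫ g, g e * R g ∂(stdGaussian E) = ∫ g, R' g ∂(stdGaussian E) := by
  have hp := measurePreserving_update e
  have iR : Integrable R (stdGaussian E) :=
    ((integrable_exp_mul_sum_abs A).const_mul C).mono' mR.aestronglyMeasurable
      (Eventually.of_forall bR)
  have iR' : Integrable R' (stdGaussian E) :=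
    ((integrable_exp_mul_sum_abs A).const_mul C).mono' mR'.aestronglyMeasurable
      (Eventually.of_forall bR')
  have igR : Integrable (fun g => g e * R g) (stdGaussian E) := by
    refine ((integrable_exp_mul_sum_abs (A + 1)).const_mul C).mono'
      ((measurable_pi_apply e).mul mR).aestronglyMeasurable (Eventually.of_forall fun g => ?_)
    have hC : 0 ≤ C := by
      by_contra h
      have := (abs_nonneg _).trans (bR g)
      nlinarith [Real.exp_pos (A * ∑ i, |g i|)]
    rw [Real.norm_eq_abs, abs_mul]
    calc |g e| * |R g| ≤ |g e| * (C * Real.exp (A * ∑ i, |g i|)) :=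
          mul_le_mul_of_nonneg_left (bR g) (abs_nonneg _)
      _ = C * (|g e| * Real.exp (A * ∑ i, |g i|)) := by ring
      _ ≤ _ := mul_le_mul_of_nonneg_left (abs_coord_mul_exp_le A g e) hC
  have key : ∀ f : (E → ℝ) → ℝ, Integrable f (stdGaussian E) →
      (∫ g, f g ∂(stdGaussian E)) = ∫ g, ∫ x, f (Function.update g e x) ∂(gaussianReal 0 1)
        ∂(stdGaussian E) := by
    intro f hf
    rw [← integral_prod (f := fun q : (E → ℝ) × ℝ => f (Function.update q.1 e q.2))
      (hp.integrable_comp_of_integrable hf)]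
    conv_lhs => rw [← hp.map_eq]
    exact integral_map hp.measurable.aemeasurable (by rw [hp.map_eq]; exact hf.1)
  have sec : ∀ f : (E → ℝ) → ℝ, Integrable f (stdGaussian E) →
      ∀ᵐ g ∂(stdGaussian E), Integrable (fun x => f (Function.update g e x)) (gaussianReal 0 1) :=
    fun f hf => (hp.integrable_comp_of_integrable hf).prod_right_ae
  -- Resampling the coordinate `e` and Fubini reduce the identity to the one-dimensional one on
  -- almost every line.
  rw [key _ igR, key _ iR']
  refine integral_congr_ae ?_
  filter_upwards [sec _ iR, sec _ iR', sec _ igR] with g h0 h2 h1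
  simp only [Function.update_self] at h1 ⊢
  exact integral_mul_gaussianReal_eq_integral_deriv (hR g) h0 h1 h2

/-- The Cameron-Martin formula for a product of unit Gaussians. -/
theorem pi_gaussianReal_eq_withDensity {E : Type*} [Fintype E] (m : E → ℝ) :
    (Measure.pi fun e => gaussianReal (m e) 1) = (stdGaussian E).withDensity
      fun g => ENNReal.ofReal (Real.exp (∑ e, (m e * g e - m e ^ 2 / 2))) := by
  refine Measure.pi_eq fun s hs => ?_
  have h1 : ∀ e, gaussianReal (m e) 1 (s e) = ENNReal.ofReal
      (∫ x, (s e).indicator (fun x => Real.exp (m e * x - m e ^ 2 / 2)) x ∂(gaussianReal 0 1)) := by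
    intro e
    rw [gaussianReal_apply_eq_integral _ one_ne_zero, integral_indicator (hs e),
      ← integral_indicator (hs e), ← integral_indicator (hs e),
      integral_gaussianReal_eq_integral_smul one_ne_zero]
    congr 2
    ext x
    by_cases hx : x ∈ s e
    · simp only [hx, Set.indicator_of_mem, gaussianPDFReal, smul_eq_mul]
      conv_rhs => rw [mul_assoc, ← Real.exp_add]
      congr 2
      push_cast
      ring
    · simp [hx]
  have hint : ∀ e, Integrable ((s e).indicator (fun x => Real.exp (m e * x - m e ^ 2 / 2)))
      (gaussianReal 0 1) := by
    intro e
    refine Integrable.indicator ?_ (hs e)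
    simp only [sub_eq_add_neg, Real.exp_add]
    exact (integrable_exp_mul_gaussianReal (m e)).mul_const _
  have hnn : ∀ e x, 0 ≤ (s e).indicator (fun x => Real.exp (m e * x - m e ^ 2 / 2)) x :=
    fun e x => Set.indicator_nonneg (fun _ _ => (Real.exp_pos _).le) x
  simp only [h1]
  rw [withDensity_apply _ (MeasurableSet.univ_pi hs), ← lintegral_indicator (MeasurableSet.univ_pi hs),
    ← ENNReal.ofReal_prod_of_nonneg fun e _ => integral_nonneg (hnn e),
    ← integral_fintype_prod_eq_prod (μ := fun _ : E => gaussianReal 0 1) (𝕜 := ℝ)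
      (f := fun e => (s e).indicator (fun x => Real.exp (m e * x - m e ^ 2 / 2))),
    ofReal_integral_eq_lintegral_ofReal]
  · unfold stdGaussian
    congr 1
    ext g
    by_cases hg : g ∈ Set.univ.pi s
    · rw [Set.indicator_of_mem hg, Real.exp_sum]
      congr 1
      refine Finset.prod_congr rfl fun e _ => ?_
      rw [Set.indicator_of_mem (hg e (Set.mem_univ e))]
    · rw [Set.indicator_of_notMem hg]
      simp only [Set.mem_pi, Set.mem_univ, true_imp_iff, not_forall] at hg
      obtain ⟨e, he⟩ := hg
      rw [Finset.prod_eq_zero (Finset.mem_univ e) (Set.indicator_of_notMem he _),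
        ENNReal.ofReal_zero]
  · exact Integrable.fintype_prod (μ := fun _ : E => gaussianReal 0 1) hint
  · exact Eventually.of_forall fun g => Finset.prod_nonneg fun e _ => hnn e _

theorem integral_pi_gaussianReal_eq {E : Type*} [Fintype E] (m : E → ℝ) (f : (E → ℝ) → ℝ) :
    ∫ g, f g ∂(Measure.pi fun e => gaussianReal (m e) 1) =
      ∫ g, Real.exp (∑ e, (m e * g e - m e ^ 2 / 2)) * f g ∂(stdGaussian E) := by
  rw [pi_gaussianReal_eq_withDensity, integral_withDensity_eq_integral_toReal_smul (by fun_prop)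
    (Eventually.of_forall fun _ => ENNReal.ofReal_lt_top)]
  simp [ENNReal.toReal_ofReal (Real.exp_pos _).le]

/-- Sign changes of the coordinates preserve the standard Gaussian measure. -/
theorem measurePreserving_sign_mul {E : Type*} [Fintype E] (u : E → ℝ)
    (hu : ∀ e, u e = 1 ∨ u e = -1) :
    MeasurePreserving (fun (g : E → ℝ) e => u e * g e) (stdGaussian E) (stdGaussian E) := by
  refine measurePreserving_pi _ _ fun e => ⟨by fun_prop, ?_⟩
  rw [gaussianReal_map_const_mul]
  rcases hu e with h | h <;> simp [h]

/-- Restricting a product measure along an injection of the index set. -/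
theorem measurePreserving_pi_comp {E E' : Type*} [Fintype E] [Fintype E'] (m : E → ℝ)
    {j : E' → E} (hj : Function.Injective j) :
    MeasurePreserving (fun (g : E → ℝ) e' => g (j e'))
      (Measure.pi fun e => gaussianReal (m e) 1)
      (Measure.pi fun e' => gaussianReal (m (j e')) 1) := by
  refine ⟨by fun_prop, ?_⟩
  have h : iIndepFun (fun e (g : E → ℝ) => g e) (Measure.pi fun e => gaussianReal (m e) 1) :=
    iIndepFun_pi (X := fun _ x => x) fun _ => aemeasurable_id
  have h' := h.precomp hj
  rw [iIndepFun_iff_map_fun_eq_pi_map (fun i => (measurable_pi_apply (j i)).aemeasurable)] at h'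
  rw [h']
  congr
  ext1 e'
  exact (measurePreserving_eval (fun e => gaussianReal (m e) 1) (j e')).map_eq

/-! ### Exponential martingales and the heat equation -/

/-- The normalized exponential weight of the configuration `s`, for the Gaussian field
`∑ e, √(l e) * u e s * g e`, when `u e s = ±1`. -/
def expWeight {S E : Type*} [Fintype E] (u : E → S → ℝ) (l g : E → ℝ) (s : S) : ℝ :=
  Real.exp (∑ e, (Real.sqrt (l e) * u e s * g e - l e / 2))

section

variable {S E : Type*} [Fintype E] {u : E → S → ℝ}

theorem expWeight_pos (u : E → S → ℝ) (l g : E → ℝ) (s : S) : 0 < expWeight u l g s :=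
  Real.exp_pos _

theorem measurable_expWeight (u : E → S → ℝ) (l : E → ℝ) : Measurable (expWeight u l) := by
  unfold expWeight
  fun_prop

theorem abs_eq_one_of_sq {x : ℝ} (h : x ^ 2 = 1) : |x| = 1 :=
  (abs_eq zero_le_one).2 (sq_eq_one_iff.1 h)

/-- Because `|u e s| = 1`, the bound is the same for all configurations. It controls the weights
from above and from below, hence also `1 / W` and `log W`. -/
theorem abs_exponent_le (hu : ∀ e s, u e s ^ 2 = 1) {l : E → ℝ} {Λ : ℝ} (hl : ∀ e, |l e| ≤ Λ)
    (g : E → ℝ) (s : S) :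
    |∑ e, (Real.sqrt (l e) * u e s * g e - l e / 2)| ≤
      Real.sqrt Λ * ∑ e, |g e| + Fintype.card E * Λ := by
  have h1 : ∀ e, |Real.sqrt (l e) * u e s * g e - l e / 2| ≤ Real.sqrt Λ * |g e| + Λ := by
    intro e
    have hu1 : |u e s| = 1 := abs_eq_one_of_sq (hu e s)
    refine (abs_sub _ _).trans (add_le_add ?_ ?_)
    · rw [abs_mul, abs_mul, hu1, mul_one, abs_of_nonneg (Real.sqrt_nonneg _)]
      exact mul_le_mul_of_nonneg_right (Real.sqrt_le_sqrt ((le_abs_self _).trans (hl e)))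
        (abs_nonneg _)
    · rw [abs_div, abs_two]
      linarith [hl e, abs_nonneg (l e)]
  refine (Finset.abs_sum_le_sum_abs _ _).trans ((Finset.sum_le_sum fun e _ => h1 e).trans ?_)
  rw [Finset.sum_add_distrib, ← Finset.mul_sum]
  simp

/-- A uniform upper bound on the weights and their inverses. -/
def weightBound (E : Type*) [Fintype E] (Λ : ℝ) (g : E → ℝ) : ℝ :=
  Real.exp (Real.sqrt Λ * ∑ e, |g e| + Fintype.card E * Λ)

theorem one_le_weightBound {Λ : ℝ} (hΛ : 0 ≤ Λ) (g : E → ℝ) : 1 ≤ weightBound E Λ g :=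
  Real.one_le_exp (add_nonneg (mul_nonneg (Real.sqrt_nonneg _)
    (Finset.sum_nonneg fun _ _ => abs_nonneg _)) (by positivity))

theorem expWeight_le_weightBound (hu : ∀ e s, u e s ^ 2 = 1) {l : E → ℝ} {Λ : ℝ}
    (hl : ∀ e, |l e| ≤ Λ) (g : E → ℝ) (s : S) : expWeight u l g s ≤ weightBound E Λ g :=
  Real.exp_le_exp.2 ((le_abs_self _).trans (abs_exponent_le hu hl g s))

theorem inv_weightBound_le_expWeight (hu : ∀ e s, u e s ^ 2 = 1) {l : E → ℝ} {Λ : ℝ}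
    (hl : ∀ e, |l e| ≤ Λ) (g : E → ℝ) (s : S) : (weightBound E Λ g)⁻¹ ≤ expWeight u l g s := by
  rw [weightBound, ← Real.exp_neg]
  exact Real.exp_le_exp.2 (abs_le.1 (abs_exponent_le hu hl g s)).1

theorem weightBound_pow (Λ : ℝ) (g : E → ℝ) (k : ℕ) : weightBound E Λ g ^ k =
    Real.exp (k * (Fintype.card E * Λ)) * Real.exp (k * Real.sqrt Λ * ∑ e, |g e|) := by
  rw [weightBound, ← Real.exp_nat_mul, ← Real.exp_add]
  congr 1; ring

/-- Variation of the weights in one coordinate of the field. -/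
theorem hasDerivAt_expWeight_update [DecidableEq E] (u : E → S → ℝ) (l g : E → ℝ) (e : E) (s : S)
    (x : ℝ) :
    HasDerivAt (fun y => expWeight u l (Function.update g e y) s)
      (Real.sqrt (l e) * u e s * expWeight u l (Function.update g e x) s) x := by
  have h : HasDerivAt (fun y => ∑ i, (Real.sqrt (l i) * u i s * Function.update g e y i - l i / 2))
      (∑ i, if i = e then Real.sqrt (l e) * u e s else 0) x := by
    refine HasDerivAt.fun_sum fun i _ => ?_
    by_cases hi : i = e
    · subst hi
      simp only [Function.update_self, if_true]
      simpa using ((hasDerivAt_id x).const_mul (Real.sqrt (l i) * u i s)).sub_const (l i / 2)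
    · simp only [Function.update_of_ne hi, if_neg hi]
      exact hasDerivAt_const _ _
  rw [Finset.sum_ite_eq' Finset.univ e, if_pos (Finset.mem_univ e)] at h
  unfold expWeight
  simpa [mul_comm] using h.exp

variable [Fintype S]

/-- A function of positive weights with two derivatives, all of polynomial growth in the weights
and their inverses. -/
structure TwiceDiffGrowth (Ψ : (S → ℝ) → ℝ) (Ψ₁ : S → (S → ℝ) → ℝ) (Ψ₂ : S → S → (S → ℝ) → ℝ)
    (C : ℝ) (k : ℕ) : Prop where
  deriv₁ : ∀ (c : ℝ → S → ℝ) (c' : S → ℝ) (x : ℝ), (∀ s, HasDerivAt (fun y => c y s) (c' s) x) →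
    (∀ s, 0 < c x s) → HasDerivAt (fun y => Ψ (c y)) (∑ s, Ψ₁ s (c x) * c' s) x
  deriv₂ : ∀ (c : ℝ → S → ℝ) (c' : S → ℝ) (x : ℝ), (∀ s, HasDerivAt (fun y => c y s) (c' s) x) →
    (∀ s, 0 < c x s) → ∀ r, HasDerivAt (fun y => Ψ₁ r (c y)) (∑ s, Ψ₂ r s (c x) * c' s) x
  bound : ∀ (p : S → ℝ) (M : ℝ), 1 ≤ M → (∀ s, M⁻¹ ≤ p s) → (∀ s, p s ≤ M) → |Ψ p| ≤ C * M ^ k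
  bound₁ : ∀ (p : S → ℝ) (M : ℝ), 1 ≤ M → (∀ s, M⁻¹ ≤ p s) → (∀ s, p s ≤ M) →
    ∀ r, |Ψ₁ r p| ≤ C * M ^ k
  bound₂ : ∀ (p : S → ℝ) (M : ℝ), 1 ≤ M → (∀ s, M⁻¹ ≤ p s) → (∀ s, p s ≤ M) →
    ∀ r s, |Ψ₂ r s p| ≤ C * M ^ k
  meas : Measurable Ψ
  meas₁ : ∀ r, Measurable (Ψ₁ r)
  meas₂ : ∀ r s, Measurable (Ψ₂ r s)

theorem integrable_of_le_weightBound_pow {f : (E → ℝ) → ℝ} (mf : Measurable f) {C Λ : ℝ} {k : ℕ}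
    (hf : ∀ g, |f g| ≤ C * weightBound E Λ g ^ k) : Integrable f (stdGaussian E) := by
  refine Integrable.mono' (((integrable_exp_mul_sum_abs (E := E) (k * Real.sqrt Λ)).const_mul
    (Real.exp (k * (Fintype.card E * Λ)))).const_mul C) mf.aestronglyMeasurable
    (Eventually.of_forall fun g => ?_)
  rw [Real.norm_eq_abs, ← weightBound_pow]
  exact hf g

theorem abs_sum_le_card_mul {ι : Type*} [Fintype ι] {f : ι → ℝ} {B : ℝ} (h : ∀ i, |f i| ≤ B) :
    |∑ i, f i| ≤ Fintype.card ι * B := by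
  refine (Finset.abs_sum_le_sum_abs _ _).trans ((Finset.sum_le_sum fun i _ => h i).trans ?_)
  simp

/-- Gaussian integration by parts for a function of the weights. -/
theorem integral_coord_mul_weights (hu : ∀ e s, u e s ^ 2 = 1)
    {Ψ : (S → ℝ) → ℝ} {Ψ₁ : S → (S → ℝ) → ℝ} {Ψ₂ : S → S → (S → ℝ) → ℝ} {C : ℝ} {k : ℕ}
    (hΨ : TwiceDiffGrowth Ψ Ψ₁ Ψ₂ C k) (l : E → ℝ) (e : E) :
    ∫ g, g e * ∑ s, Ψ₁ s (expWeight u l g) * (u e s * expWeight u l g s) ∂(stdGaussian E) =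
      ∫ g, Real.sqrt (l e) * (∑ r, ∑ s, Ψ₂ r s (expWeight u l g) * (u e r * expWeight u l g r) *
        (u e s * expWeight u l g s) + ∑ s, Ψ₁ s (expWeight u l g) * expWeight u l g s)
        ∂(stdGaussian E) := by
  classical
  obtain ⟨Λ, hΛ0, hΛ⟩ : ∃ Λ : ℝ, 0 ≤ Λ ∧ ∀ e, |l e| ≤ Λ :=
    ⟨∑ e, |l e|, Finset.sum_nonneg fun _ _ => abs_nonneg _, fun e =>
      Finset.single_le_sum (f := fun e => |l e|) (fun _ _ => abs_nonneg _) (Finset.mem_univ e)⟩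
  have mp := measurable_expWeight u l
  have mps : ∀ s, Measurable fun g => expWeight u l g s := fun s => (measurable_pi_apply s).comp mp
  have m1 : ∀ s, Measurable fun g => Ψ₁ s (expWeight u l g) := fun s => (hΨ.meas₁ s).comp mp
  have m2 : ∀ r s, Measurable fun g => Ψ₂ r s (expWeight u l g) := fun r s => (hΨ.meas₂ r s).comp mp
  have hC : 0 ≤ C ∨ IsEmpty S := by
    rcases isEmpty_or_nonempty S with h | ⟨⟨s⟩⟩
    · exact Or.inr h
    · left
      have := (abs_nonneg _).trans (hΨ.bound (fun _ => 1) 1 le_rfl (by simp) (by simp))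
      simpa using this
  rcases hC with hC | hS
  swap
  · simp
  have hbd : ∀ g, (1 ≤ weightBound E Λ g) ∧ (∀ s, |expWeight u l g s| ≤ weightBound E Λ g) ∧
      (∀ e s, |u e s * expWeight u l g s| ≤ weightBound E Λ g) := by
    intro g
    have : ∀ s, |expWeight u l g s| ≤ weightBound E Λ g := fun s => by
      rw [abs_of_pos (expWeight_pos u l g s)]; exact expWeight_le_weightBound hu hΛ g s
    exact ⟨one_le_weightBound hΛ0 g, this, fun e s => by
      rw [abs_mul, abs_eq_one_of_sq (hu e s), one_mul]; exact this s⟩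
  have b1 : ∀ g r, |Ψ₁ r (expWeight u l g)| ≤ C * weightBound E Λ g ^ k := fun g r =>
    hΨ.bound₁ _ _ (hbd g).1 (inv_weightBound_le_expWeight hu hΛ g)
      (expWeight_le_weightBound hu hΛ g) r
  have b2 : ∀ g r s, |Ψ₂ r s (expWeight u l g)| ≤ C * weightBound E Λ g ^ k := fun g r s =>
    hΨ.bound₂ _ _ (hbd g).1 (inv_weightBound_le_expWeight hu hΛ g)
      (expWeight_le_weightBound hu hΛ g) r s
  have prod2 : ∀ {a b : ℝ} {M : ℝ} {j : ℕ}, 1 ≤ M → |a| ≤ C * M ^ j → |b| ≤ M →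
      |a * b| ≤ C * M ^ (j + 1) := by
    intro a b M j hM ha hb
    rw [abs_mul, pow_succ, ← mul_assoc]
    exact mul_le_mul ha hb (abs_nonneg _) ((abs_nonneg _).trans ha)
  set n : ℝ := (Fintype.card S : ℝ) with hn
  have hn0 : 0 ≤ n := Nat.cast_nonneg _
  have bA : ∀ g, |∑ s, Ψ₁ s (expWeight u l g) * (u e s * expWeight u l g s)| ≤
      n * (C * weightBound E Λ g ^ (k + 1)) := fun g =>
    abs_sum_le_card_mul fun s => prod2 (hbd g).1 (b1 g s) ((hbd g).2.2 e s)
  have bA' : ∀ g, |∑ s, Ψ₁ s (expWeight u l g) * expWeight u l g s| ≤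
      n * (C * weightBound E Λ g ^ (k + 1)) := fun g =>
    abs_sum_le_card_mul fun s => prod2 (hbd g).1 (b1 g s) ((hbd g).2.1 s)
  have bB : ∀ g, |∑ r, ∑ s, Ψ₂ r s (expWeight u l g) * (u e r * expWeight u l g r) *
        (u e s * expWeight u l g s)| ≤ n * (n * (C * weightBound E Λ g ^ (k + 2))) := fun g =>
    abs_sum_le_card_mul fun r => abs_sum_le_card_mul fun s =>
      prod2 (hbd g).1 (prod2 (hbd g).1 (b2 g r s) ((hbd g).2.2 e r)) ((hbd g).2.2 e s)
  have mono : ∀ g, weightBound E Λ g ^ (k + 1) ≤ weightBound E Λ g ^ (k + 2) := fun g =>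
    pow_le_pow_right₀ (hbd g).1 (by omega)
  set q : ℝ := Real.sqrt (l e) with hq
  have hq0 : 0 ≤ q := Real.sqrt_nonneg _
  set K : ℝ := (n * C + q * (n * n * C + n * C)) * Real.exp ((k + 2 : ℕ) * (Fintype.card E * Λ))
  refine integral_coord_mul_eq_integral_deriv e (A := (k + 2 : ℕ) * Real.sqrt Λ) (C := K)
    (R := fun g => ∑ s, Ψ₁ s (expWeight u l g) * (u e s * expWeight u l g s)) ?_ ?_ ?_ ?_ ?_
  · intro g x
    have hp := fun s => hasDerivAt_expWeight_update u l g e s x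
    have h1 := hΨ.deriv₂ (fun y => expWeight u l (Function.update g e y)) _ x hp
      fun s => expWeight_pos _ _ _ _
    have h2 := HasDerivAt.fun_sum (u := Finset.univ) fun s (_ : s ∈ Finset.univ) =>
      (h1 s).mul ((hp s).const_mul (u e s))
    refine h2.congr_deriv ?_
    rw [mul_add, Finset.mul_sum, Finset.mul_sum, ← Finset.sum_add_distrib]
    refine Finset.sum_congr rfl fun r _ => ?_
    rw [Finset.mul_sum, Finset.sum_mul]
    congr 1
    · refine Finset.sum_congr rfl fun s _ => ?_
      ring
    -- Differentiating the explicit factor `u e r * p r` gives `(u e r)² * p r`, and the square is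
    -- one: this is the first-order term on the right-hand side.
    · linear_combination (Ψ₁ r (expWeight u l (Function.update g e x)) * Real.sqrt (l e) *
        expWeight u l (Function.update g e x) r) * hu e r
  · exact Finset.measurable_fun_sum _ fun s _ => (m1 s).mul ((mps s).const_mul _)
  · exact ((Finset.measurable_fun_sum _ fun r _ => Finset.measurable_fun_sum _ fun s _ =>
      ((m2 r s).mul ((mps r).const_mul _)).mul ((mps s).const_mul _)).add
      (Finset.measurable_fun_sum _ fun s _ => (m1 s).mul (mps s))).const_mul _
  · intro g
    simp only [K]
    rw [mul_assoc, ← weightBound_pow]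
    refine (bA g).trans ?_
    have := mul_le_mul_of_nonneg_left (mono g) (mul_nonneg hn0 hC)
    have : 0 ≤ q * (n * n * C + n * C) * weightBound E Λ g ^ (k + 2) :=
      mul_nonneg (by positivity) (pow_nonneg (zero_le_one.trans (hbd g).1) _)
    linarith
  · intro g
    simp only [K]
    rw [mul_assoc, ← weightBound_pow, abs_mul, abs_of_nonneg hq0]
    have h3 := (abs_add_le _ _).trans (add_le_add (bB g) (bA' g))
    have h4 := mul_le_mul_of_nonneg_left h3 hq0
    refine h4.trans ?_
    have h5 := mul_le_mul_of_nonneg_left (mono g) (mul_nonneg hq0 (mul_nonneg hn0 hC))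
    have h6 : 0 ≤ n * C * weightBound E Λ g ^ (k + 2) :=
      mul_nonneg (by positivity) (pow_nonneg (zero_le_one.trans (hbd g).1) _)
    linarith

end

/-! ### The heat equation for Gaussian expectations of the weights -/

section

variable {S E : Type*} [Fintype E] {u : E → S → ℝ}

theorem exists_abs_le (l : E → ℝ) : ∃ Λ : ℝ, 0 ≤ Λ ∧ ∀ e, |l e| ≤ Λ :=
  ⟨∑ e, |l e|, Finset.sum_nonneg fun _ _ => abs_nonneg _, fun e =>
    Finset.single_le_sum (f := fun e => |l e|) (fun _ _ => abs_nonneg _) (Finset.mem_univ e)⟩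

/-- Variation of the weights along a segment of covariances. -/
theorem hasDerivAt_expWeight_path (u : E → S → ℝ) (l v g : E → ℝ) (s : S) {t : ℝ}
    (ht : ∀ e, v e = 0 ∨ 0 < l e + t * v e) :
    HasDerivAt (fun t' : ℝ => expWeight u (fun e => l e + t' * v e) g s)
      (expWeight u (fun e => l e + t * v e) g s *
        ∑ e, (v e / (2 * Real.sqrt (l e + t * v e)) * (g e * u e s) - v e / 2)) t := by
  have h : HasDerivAt
      (fun t' : ℝ => ∑ e, (Real.sqrt (l e + t' * v e) * u e s * g e - (l e + t' * v e) / 2))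
      (∑ e, (v e / (2 * Real.sqrt (l e + t * v e)) * (g e * u e s) - v e / 2)) t := by
    refine HasDerivAt.fun_sum fun e _ => ?_
    rcases eq_or_ne (v e) 0 with h0 | h0
    · simp only [h0, mul_zero, add_zero, zero_div, zero_mul, sub_zero]
      exact hasDerivAt_const _ _
    · have hpos := (ht e).resolve_left h0
      have h1 : HasDerivAt (fun t' : ℝ => l e + t' * v e) (v e) t := by
        simpa using ((hasDerivAt_id t).mul_const (v e)).const_add (l e)
      refine (((h1.sqrt hpos.ne').mul_const (u e s)).mul_const (g e)).sub (h1.div_const 2)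
        |>.congr_deriv ?_
      ring
  unfold expWeight
  exact h.exp

theorem integrable_comp_expWeight (hu : ∀ e s, u e s ^ 2 = 1) {F : (S → ℝ) → ℝ}
    (mF : Measurable F) {C : ℝ} {k : ℕ} (hF : ∀ (p : S → ℝ) (M : ℝ), 1 ≤ M → (∀ s, M⁻¹ ≤ p s) →
      (∀ s, p s ≤ M) → |F p| ≤ C * M ^ k) (l : E → ℝ) :
    Integrable (fun g => F (expWeight u l g)) (stdGaussian E) := by
  obtain ⟨Λ, hΛ0, hΛ⟩ := exists_abs_le l
  exact integrable_of_le_weightBound_pow (mF.comp (measurable_expWeight u l)) fun g =>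
    hF _ _ (one_le_weightBound hΛ0 g) (inv_weightBound_le_expWeight hu hΛ g)
      (expWeight_le_weightBound hu hΛ g)

variable [Fintype S]

theorem TwiceDiffGrowth.const_nonneg {Ψ : (S → ℝ) → ℝ} {Ψ₁ : S → (S → ℝ) → ℝ}
    {Ψ₂ : S → S → (S → ℝ) → ℝ} {C : ℝ} {k : ℕ} (hΨ : TwiceDiffGrowth Ψ Ψ₁ Ψ₂ C k) : 0 ≤ C := by
  have := (abs_nonneg _).trans (hΨ.bound (fun _ => 1) 1 le_rfl (by simp) (by simp))
  simpa using this

theorem abs_mul_le_mul_pow {a b C M : ℝ} {j : ℕ} (ha : |a| ≤ C * M ^ j)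
    (hb : |b| ≤ M) : |a * b| ≤ C * M ^ (j + 1) := by
  rw [abs_mul, pow_succ, ← mul_assoc]
  exact mul_le_mul ha hb (abs_nonneg _) ((abs_nonneg _).trans ha)

/-- The heat equation: differentiation of Gaussian expectations along a segment of covariances. -/
theorem hasDerivAt_integral_weights (hu : ∀ e s, u e s ^ 2 = 1)
    {Ψ : (S → ℝ) → ℝ} {Ψ₁ : S → (S → ℝ) → ℝ} {Ψ₂ : S → S → (S → ℝ) → ℝ} {C : ℝ} {k : ℕ}
    (hΨ : TwiceDiffGrowth Ψ Ψ₁ Ψ₂ C k) (l v : E → ℝ) {t : ℝ}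
    (ht : ∀ e, v e = 0 ∨ 0 < l e + t * v e) :
    HasDerivAt (fun t' : ℝ => ∫ g, Ψ (expWeight u (fun e => l e + t' * v e) g) ∂(stdGaussian E))
      (∫ g, (1 / 2) * ∑ e, v e * ∑ r, ∑ s, Ψ₂ r s (expWeight u (fun e => l e + t * v e) g) *
        (u e r * expWeight u (fun e => l e + t * v e) g r) *
        (u e s * expWeight u (fun e => l e + t * v e) g s) ∂(stdGaussian E)) t := by
  set L : ℝ → E → ℝ := fun t' e => l e + t' * v e with hL
  have hC := hΨ.const_nonneg
  -- a neighbourhood of `t` on which the path stays away from the singularities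
  set N : Set ℝ := {t' | ∀ e, (v e = 0 ∨ L t e / 2 < L t' e) ∧ |L t' e| < |L t e| + 1}
  have hN : N ∈ 𝓝 t := by
    have hcont : ∀ e, Tendsto (fun t' => L t' e) (𝓝 t) (𝓝 (L t e)) := fun e => by
      have : Continuous fun t' => L t' e := by simp only [hL]; fun_prop
      exact this.tendsto t
    have : ∀ᶠ t' in 𝓝 t, ∀ e, (v e = 0 ∨ L t e / 2 < L t' e) ∧ |L t' e| < |L t e| + 1 := by
      refine eventually_all.2 fun e => Eventually.and ?_ ?_
      · rcases ht e with h | h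
        · exact Eventually.of_forall fun _ => Or.inl h
        · exact ((hcont e).eventually (lt_mem_nhds (half_lt_self h))).mono fun _ h => Or.inr h
      · exact (hcont e).abs.eventually (gt_mem_nhds (lt_add_one _))
    exact this
  have hNpos : ∀ t' ∈ N, ∀ e, v e = 0 ∨ 0 < L t' e := fun t' h e => by
    rcases (h e).1 with h0 | h1
    · exact Or.inl h0
    · rcases ht e with h0 | h2
      · exact Or.inl h0
      · exact Or.inr ((half_pos h2).trans h1)
  obtain ⟨Λ₀, hΛ₀, hΛ₀'⟩ := exists_abs_le (L t)
  set Λ := Λ₀ + 1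
  have hΛ0 : 0 ≤ Λ := by positivity
  have hΛ : ∀ t' ∈ N, ∀ e, |L t' e| ≤ Λ := fun t' h e =>
    (h e).2.le.trans (by simp only [Λ]; linarith [hΛ₀' e])
  have htN : t ∈ N := mem_of_mem_nhds hN
  -- On `N` a moving coordinate stays above half of its value at `t`, which bounds `v / (2√l)`
  -- uniformly; coordinates that do not move contribute nothing.
  set b : E → ℝ := fun e => |v e| / (2 * Real.sqrt (L t e / 2)) + |v e| with hb
  have hb0 : ∀ e, 0 ≤ b e := fun e => by simp only [hb]; positivity
  have hcoef : ∀ t' ∈ N, ∀ e, |v e / (2 * Real.sqrt (L t' e))| + |v e / 2| ≤ b e := by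
    intro t' h e
    simp only [hb]
    refine add_le_add ?_ ?_
    · rcases eq_or_ne (v e) 0 with h0 | h0
      · simp [h0]
      · have h1 := (h e).1.resolve_left h0
        have h2 := (ht e).resolve_left h0
        rw [abs_div, abs_of_nonneg (by positivity : 0 ≤ 2 * Real.sqrt (L t' e))]
        have h3 : 0 < Real.sqrt (L t e / 2) := Real.sqrt_pos.2 (half_pos h2)
        have h4 := Real.sqrt_le_sqrt h1.le
        gcongr
    · rw [abs_div, abs_two]; linarith [abs_nonneg (v e)]
  have hpb : ∀ t' ∈ N, ∀ g, (∀ s, |expWeight u (L t') g s| ≤ weightBound E Λ g) ∧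
      ∀ r, |Ψ₁ r (expWeight u (L t') g)| ≤ C * weightBound E Λ g ^ k := by
    intro t' h g
    have h1 := inv_weightBound_le_expWeight hu (hΛ t' h) g
    have h2 := expWeight_le_weightBound hu (hΛ t' h) g
    exact ⟨fun s => by rw [abs_of_pos (expWeight_pos _ _ _ _)]; exact h2 s,
      hΨ.bound₁ _ _ (one_le_weightBound hΛ0 g) h1 h2⟩
  have mp : ∀ t', Measurable (expWeight u (L t')) := fun t' => measurable_expWeight u (L t')
  have mps : ∀ t' s, Measurable fun g => expWeight u (L t') g s :=
    fun t' s => (measurable_pi_apply s).comp (mp t')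
  have m1 : ∀ t' s, Measurable fun g => Ψ₁ s (expWeight u (L t') g) :=
    fun t' s => (hΨ.meas₁ s).comp (mp t')
  set D : ℝ → (E → ℝ) → ℝ := fun t' g => ∑ s, Ψ₁ s (expWeight u (L t') g) *
    (expWeight u (L t') g s *
      ∑ e, (v e / (2 * Real.sqrt (L t' e)) * (g e * u e s) - v e / 2)) with hD
  have key := hasDerivAt_integral_of_dominated_loc_of_deriv_le (μ := stdGaussian E) (x₀ := t)
    (F := fun t' g => Ψ (expWeight u (L t') g)) (F' := D) (s := N)
    (bound := fun g => (Fintype.card S * C * (∑ e, b e) *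
        Real.exp ((k + 1 : ℕ) * (Fintype.card E * Λ))) *
        Real.exp (((k + 1 : ℕ) * Real.sqrt Λ + 1) * ∑ e, |g e|)) hN
    (Eventually.of_forall fun t' => (hΨ.meas.comp (mp t')).aestronglyMeasurable)
    (integrable_comp_expWeight hu hΨ.meas hΨ.bound _) ?_ ?_ ?_ ?_
  · refine key.2.congr_deriv ?_
    -- integration by parts
    have i1 : ∀ e, Integrable (fun g => v e / (2 * Real.sqrt (L t e)) * (g e *
        ∑ s, Ψ₁ s (expWeight u (L t) g) * (u e s * expWeight u (L t) g s))) (stdGaussian E) := by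
      intro e
      refine Integrable.const_mul ?_ _
      refine ((integrable_exp_mul_sum_abs (E := E) ((k + 1 : ℕ) * Real.sqrt Λ + 1)).const_mul
        (Fintype.card S * C * Real.exp ((k + 1 : ℕ) * (Fintype.card E * Λ)))).mono'
        (((measurable_pi_apply e).mul (Finset.measurable_fun_sum _ fun s _ =>
          (m1 t s).mul ((mps t s).const_mul _))).aestronglyMeasurable)
        (Eventually.of_forall fun g => ?_)
      rw [Real.norm_eq_abs, abs_mul]
      have h1 : |∑ s, Ψ₁ s (expWeight u (L t) g) * (u e s * expWeight u (L t) g s)| ≤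
          Fintype.card S * (C * weightBound E Λ g ^ (k + 1)) :=
        abs_sum_le_card_mul fun s => abs_mul_le_mul_pow ((hpb t htN g).2 s) (by
          rw [abs_mul, abs_eq_one_of_sq (hu e s), one_mul]; exact (hpb t htN g).1 s)
      rw [weightBound_pow] at h1
      have h2 := mul_le_mul_of_nonneg_left h1 (abs_nonneg (g e))
      have h3 := mul_le_mul_of_nonneg_left
        (abs_coord_mul_exp_le ((k + 1 : ℕ) * Real.sqrt Λ) g e)
        (by positivity : 0 ≤ Fintype.card S * C * Real.exp ((k + 1 : ℕ) * (Fintype.card E * Λ)))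
      linarith
    have i2 : Integrable (fun g => ∑ s, Ψ₁ s (expWeight u (L t) g) * expWeight u (L t) g s)
        (stdGaussian E) :=
      integrable_comp_expWeight (C := Fintype.card S * C) (k := k + 1) hu
        (F := fun p => ∑ s, Ψ₁ s p * p s)
        (Finset.measurable_fun_sum _ fun s _ => (hΨ.meas₁ s).mul (measurable_pi_apply s))
        (fun p M hM h1 h2 => by
          rw [mul_assoc]
          refine abs_sum_le_card_mul fun s => abs_mul_le_mul_pow (hΨ.bound₁ p M hM h1 h2 s) ?_
          rw [abs_of_nonneg ((inv_nonneg.2 (zero_le_one.trans hM)).trans (h1 s))]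
          exact h2 s) (L t)
    have i3 : ∀ e, Integrable (fun g => ∑ r, ∑ s, Ψ₂ r s (expWeight u (L t) g) *
        (u e r * expWeight u (L t) g r) * (u e s * expWeight u (L t) g s)) (stdGaussian E) :=
      fun e => integrable_comp_expWeight (C := Fintype.card S * (Fintype.card S * C)) (k := k + 2)
        hu (F := fun p => ∑ r, ∑ s, Ψ₂ r s p * (u e r * p r) * (u e s * p s))
        (Finset.measurable_fun_sum _ fun r _ => Finset.measurable_fun_sum _ fun s _ =>
          ((hΨ.meas₂ r s).mul ((measurable_pi_apply r).const_mul _)).mul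
            ((measurable_pi_apply s).const_mul _))
        (fun p M hM h1 h2 => by
          have h3 : ∀ s, |u e s * p s| ≤ M := fun s => by
            rw [abs_mul, abs_eq_one_of_sq (hu e s), one_mul,
              abs_of_nonneg ((inv_nonneg.2 (zero_le_one.trans hM)).trans (h1 s))]
            exact h2 s
          rw [mul_assoc, mul_assoc]
          exact abs_sum_le_card_mul fun r => abs_sum_le_card_mul fun s =>
            abs_mul_le_mul_pow (abs_mul_le_mul_pow (hΨ.bound₂ p M hM h1 h2 r s) (h3 r)) (h3 s))
        (L t)
    have e1 : ∀ g, D t g = ∑ e, (v e / (2 * Real.sqrt (L t e)) * (g e *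
        ∑ s, Ψ₁ s (expWeight u (L t) g) * (u e s * expWeight u (L t) g s)) -
        v e / 2 * ∑ s, Ψ₁ s (expWeight u (L t) g) * expWeight u (L t) g s) := by
      intro g
      simp only [hD, Finset.mul_sum]
      rw [Finset.sum_comm]
      refine Finset.sum_congr rfl fun e _ => ?_
      rw [← Finset.sum_sub_distrib]
      refine Finset.sum_congr rfl fun s _ => ?_
      ring
    have i4 : ∀ e, Integrable (fun g => v e / (2 * Real.sqrt (L t e)) * (g e *
        ∑ s, Ψ₁ s (expWeight u (L t) g) * (u e s * expWeight u (L t) g s)) -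
        v e / 2 * ∑ s, Ψ₁ s (expWeight u (L t) g) * expWeight u (L t) g s) (stdGaussian E) :=
      fun e => (i1 e).sub (i2.const_mul _)
    rw [integral_congr_ae (Eventually.of_forall e1), integral_finsetSum _ fun e _ => i4 e]
    have e2 : ∀ e, ∫ g, (v e / (2 * Real.sqrt (L t e)) * (g e *
        ∑ s, Ψ₁ s (expWeight u (L t) g) * (u e s * expWeight u (L t) g s)) -
        v e / 2 * ∑ s, Ψ₁ s (expWeight u (L t) g) * expWeight u (L t) g s) ∂(stdGaussian E) =
        ∫ g, 1 / 2 * (v e * ∑ r, ∑ s, Ψ₂ r s (expWeight u (L t) g) *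
          (u e r * expWeight u (L t) g r) * (u e s * expWeight u (L t) g s))
          ∂(stdGaussian E) := by
      intro e
      rw [integral_sub (i1 e) (i2.const_mul _), integral_const_mul, integral_const_mul,
        integral_coord_mul_weights hu hΨ (L t) e, integral_const_mul, integral_add (i3 e) i2,
        integral_const_mul, integral_const_mul]
      -- The factor `1 / (2√l)` from differentiating `√l` cancels the `√l` produced by integration
      -- by parts. The first-order term then cancels the drift `-v / 2`, and only the second-order
      -- term survives.
      rcases eq_or_ne (v e) 0 with h0 | h0
      · simp [h0]
      · have h1 : Real.sqrt (L t e) ≠ 0 := (Real.sqrt_pos.2 ((ht e).resolve_left h0)).ne'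
        field_simp
        ring
    simp only [e2]
    rw [← integral_finsetSum _ fun e _ => ((i3 e).const_mul _).const_mul _]
    simp only [Finset.mul_sum]
    rfl
  · exact (Finset.measurable_fun_sum _ fun s _ => (m1 t s).mul ((mps t s).mul
      (by fun_prop))).aestronglyMeasurable
  · refine Eventually.of_forall fun g t' ht' => ?_
    rw [Real.norm_eq_abs]
    have h1 : ∀ s, |∑ e, (v e / (2 * Real.sqrt (L t' e)) * (g e * u e s) - v e / 2)| ≤
        (∑ e, b e) * Real.exp (∑ e, |g e|) := by
      intro s
      rw [Finset.sum_mul]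
      refine (Finset.abs_sum_le_sum_abs _ _).trans (Finset.sum_le_sum fun e _ => ?_)
      have h2 : |g e| ≤ Real.exp (∑ e, |g e|) := (abs_le_exp_abs _).trans (Real.exp_le_exp.2
        (Finset.single_le_sum (f := fun i => |g i|) (fun i _ => abs_nonneg _) (Finset.mem_univ e)))
      have h3 : 1 ≤ Real.exp (∑ e, |g e|) :=
        Real.one_le_exp (Finset.sum_nonneg fun _ _ => abs_nonneg _)
      refine (abs_sub _ _).trans ?_
      rw [abs_mul, abs_mul (g e), abs_eq_one_of_sq (hu e s), mul_one]
      have h4 := mul_le_mul_of_nonneg_left h2 (abs_nonneg (v e / (2 * Real.sqrt (L t' e))))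
      have h5 := mul_le_mul_of_nonneg_left h3 (abs_nonneg (v e / 2))
      have h6 := mul_le_mul_of_nonneg_right (hcoef t' ht' e) (zero_le_one.trans h3)
      linarith
    refine (abs_sum_le_card_mul (B := C * weightBound E Λ g ^ (k + 1) *
      ((∑ e, b e) * Real.exp (∑ e, |g e|))) fun s => ?_).trans (le_of_eq ?_)
    · rw [← mul_assoc, abs_mul]
      exact mul_le_mul (abs_mul_le_mul_pow ((hpb t' ht' g).2 s) ((hpb t' ht' g).1 s)) (h1 s)
        (abs_nonneg _) (mul_nonneg hC (pow_nonneg (Real.exp_pos _).le _))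
    · rw [weightBound_pow, add_mul _ (1 : ℝ), one_mul, Real.exp_add]
      ring
  · exact (integrable_exp_mul_sum_abs _).const_mul _
  · refine Eventually.of_forall fun g t' ht' => ?_
    exact hΨ.deriv₁ (fun t' => expWeight u (L t') g) _ t'
      (fun s => hasDerivAt_expWeight_path u l v g s (hNpos t' ht')) fun s => expWeight_pos _ _ _ _

/-- Continuity of Gaussian expectations along a segment of covariances. -/
theorem continuous_integral_weights (hu : ∀ e s, u e s ^ 2 = 1) {F : (S → ℝ) → ℝ}
    (cF : Continuous F) {C : ℝ} {k : ℕ} (hF : ∀ (p : S → ℝ) (M : ℝ), 1 ≤ M → (∀ s, M⁻¹ ≤ p s) →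
      (∀ s, p s ≤ M) → |F p| ≤ C * M ^ k) (l v : E → ℝ) :
    Continuous fun t : ℝ => ∫ g, F (expWeight u (fun e => l e + t * v e) g) ∂(stdGaussian E) := by
  refine continuous_iff_continuousAt.2 fun t => ?_
  obtain ⟨Λ₀, hΛ₀, hΛ₀'⟩ := exists_abs_le fun e => l e + t * v e
  have hN : ∀ᶠ t' in 𝓝 t, ∀ e, |l e + t' * v e| < |l e + t * v e| + 1 := by
    refine eventually_all.2 fun e => ?_
    have : Continuous fun t' => |l e + t' * v e| := by fun_prop
    exact (this.tendsto t).eventually (gt_mem_nhds (lt_add_one _))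
  refine continuousAt_of_dominated (bound := fun g => C * weightBound E (Λ₀ + 1) g ^ k)
    (Eventually.of_forall fun t' =>
      (cF.measurable.comp (measurable_expWeight u _)).aestronglyMeasurable) ?_ ?_ ?_
  · filter_upwards [hN] with t' ht'
    have hΛ : ∀ e, |l e + t' * v e| ≤ Λ₀ + 1 := fun e => (ht' e).le.trans (by linarith [hΛ₀' e])
    exact Eventually.of_forall fun g => hF _ _ (one_le_weightBound (by positivity) g)
      (inv_weightBound_le_expWeight hu hΛ g) (expWeight_le_weightBound hu hΛ g)
  · simp only [weightBound_pow]
    exact ((integrable_exp_mul_sum_abs _).const_mul _).const_mul _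
  · refine Eventually.of_forall fun g => Continuous.continuousAt ?_
    refine cF.comp (continuous_pi fun s => ?_)
    unfold expWeight
    fun_prop

end

/-! ### Normalization of the weights -/

section

variable {S E : Type*} [Fintype E] {u : E → S → ℝ}

/-- The weights are normalized. -/
theorem integral_expWeight (hu : ∀ e s, u e s ^ 2 = 1) {l : E → ℝ} (hl : ∀ e, 0 ≤ l e) (s : S) :
    ∫ g, expWeight u l g s ∂(stdGaussian E) = 1 := by
  -- The weight of `s` is the Cameron-Martin density of the shift by `√l * u · s`, so its integral
  -- is the mass of a probability measure.
  have h := integral_pi_gaussianReal_eq (fun e => Real.sqrt (l e) * u e s) fun _ => 1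
  simp only [mul_one, integral_const, probReal_univ, smul_eq_mul] at h
  rw [h]
  refine integral_congr_ae (Eventually.of_forall fun g => ?_)
  simp only [expWeight, mul_pow, hu, mul_one, Real.sq_sqrt (hl _)]

theorem integrable_expWeight (hu : ∀ e s, u e s ^ 2 = 1) (l : E → ℝ) (s : S) :
    Integrable (fun g => expWeight u l g s) (stdGaussian E) := by
  refine integrable_comp_expWeight hu (F := fun p => p s) (C := 1) (k := 1)
    (measurable_pi_apply s) (fun p M hM h1 h2 => ?_) l
  rw [one_mul, pow_one, abs_of_nonneg ((inv_nonneg.2 (zero_le_one.trans hM)).trans (h1 s))]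
  exact h2 s

end

/-! ### The two functions of the weights fed to the heat equation -/

section

variable {S E : Type*} [Fintype S] {u : E → S → ℝ}

/-- The sum of the weights, as a function of the weights. -/
def totalWeight (p : S → ℝ) : ℝ := ∑ s, p s

/-- The sum of the weights against the observable `u e`. -/
def weightedSum (u : E → S → ℝ) (e : E) (p : S → ℝ) : ℝ := ∑ s, u e s * p s

theorem measurable_totalWeight : Measurable (totalWeight : (S → ℝ) → ℝ) := by
  unfold totalWeight; fun_prop

theorem measurable_weightedSum (u : E → S → ℝ) (e : E) : Measurable (weightedSum u e) := by
  unfold weightedSum; fun_prop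

theorem totalWeight_pos [Nonempty S] {p : S → ℝ} (hp : ∀ s, 0 < p s) : 0 < totalWeight p :=
  Finset.sum_pos (fun s _ => hp s) Finset.univ_nonempty

theorem inv_totalWeight_le [Nonempty S] {p : S → ℝ} {M : ℝ} (hM : 1 ≤ M) (h1 : ∀ s, M⁻¹ ≤ p s) :
    (totalWeight p)⁻¹ ≤ M := by
  have hM0 : 0 < M⁻¹ := inv_pos.2 (zero_lt_one.trans_le hM)
  obtain ⟨s⟩ := ‹Nonempty S›
  refine inv_le_of_inv_le₀ (zero_lt_one.trans_le hM) ((h1 s).trans ?_)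
  exact Finset.single_le_sum (f := p) (fun s _ => hM0.le.trans (h1 s)) (Finset.mem_univ s)

theorem totalWeight_le {p : S → ℝ} {M : ℝ} (h2 : ∀ s, p s ≤ M) :
    totalWeight p ≤ Fintype.card S * M := by
  refine (Finset.sum_le_sum fun s _ => h2 s).trans ?_
  simp

theorem abs_weightedSum_le (hu : ∀ e s, u e s ^ 2 = 1) {p : S → ℝ} {M : ℝ} (hM : 1 ≤ M)
    (h1 : ∀ s, M⁻¹ ≤ p s) (h2 : ∀ s, p s ≤ M) (e : E) :
    |weightedSum u e p| ≤ Fintype.card S * M := by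
  refine abs_sum_le_card_mul fun s => ?_
  rw [abs_mul, abs_eq_one_of_sq (hu e s), one_mul,
    abs_of_nonneg ((inv_nonneg.2 (zero_le_one.trans hM)).trans (h1 s))]
  exact h2 s

theorem hasDerivAt_totalWeight {c : ℝ → S → ℝ} {c' : S → ℝ} {x : ℝ}
    (hc : ∀ s, HasDerivAt (fun y => c y s) (c' s) x) :
    HasDerivAt (fun y => totalWeight (c y)) (∑ s, c' s) x :=
  HasDerivAt.fun_sum fun s _ => hc s

theorem hasDerivAt_weightedSum (e : E) {c : ℝ → S → ℝ} {c' : S → ℝ} {x : ℝ}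
    (hc : ∀ s, HasDerivAt (fun y => c y s) (c' s) x) :
    HasDerivAt (fun y => weightedSum u e (c y)) (∑ s, u e s * c' s) x :=
  HasDerivAt.fun_sum fun s _ => (hc s).const_mul (u e s)

/-- The second derivative of `W log W` is `1 / W` in every pair of directions, which gives the
derivative of the entropy the form `E[∑ v e (∑ u e s p s)² / W]`, up to a constant. The growth of
the logarithm comes from `log x ≤ x - 1` applied to both `W` and `W⁻¹`. -/
theorem twiceDiffGrowth_mul_log [Nonempty S] : TwiceDiffGrowth (S := S)
    (fun p => totalWeight p * Real.log (totalWeight p))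
    (fun _ p => Real.log (totalWeight p) + 1) (fun _ _ p => (totalWeight p)⁻¹)
    ((Fintype.card S : ℝ) ^ 2 + 1) 2 := by
  have hn : (1 : ℝ) ≤ Fintype.card S := by exact_mod_cast Fintype.card_pos
  have hpos : ∀ (p : S → ℝ) (M : ℝ), 1 ≤ M → (∀ s, M⁻¹ ≤ p s) → 0 < totalWeight p :=
    fun p M hM h1 => totalWeight_pos fun s => (inv_pos.2 (zero_lt_one.trans_le hM)).trans_le (h1 s)
  have hlog : ∀ (p : S → ℝ) (M : ℝ), 1 ≤ M → (∀ s, M⁻¹ ≤ p s) → (∀ s, p s ≤ M) →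
      |Real.log (totalWeight p)| ≤ Fintype.card S * M := by
    intro p M hM h1 h2
    have h0 := hpos p M hM h1
    have h3 := totalWeight_le h2
    have h4 := inv_totalWeight_le hM h1
    have h5 := Real.log_le_sub_one_of_pos h0
    have h6 := Real.log_le_sub_one_of_pos (inv_pos.2 h0)
    rw [Real.log_inv] at h6
    rw [abs_le]
    constructor <;> nlinarith
  refine ⟨?_, ?_, ?_, ?_, ?_, ?_, fun _ => ?_, fun _ _ => ?_⟩
  · intro c c' x hc hp
    have h := (Real.hasDerivAt_mul_log (totalWeight_pos hp).ne').comp x (hasDerivAt_totalWeight hc)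
    refine h.congr_deriv ?_
    rw [Finset.mul_sum]
  · intro c c' x hc hp _
    refine (((hasDerivAt_totalWeight hc).log (totalWeight_pos hp).ne').add_const 1).congr_deriv ?_
    rw [div_eq_inv_mul, Finset.mul_sum]
  · intro p M hM h1 h2
    have h3 := hlog p M hM h1 h2
    have h4 := totalWeight_le h2
    have h0 := hpos p M hM h1
    rw [abs_mul, abs_of_pos h0]
    have := mul_le_mul h4 h3 (abs_nonneg _) (by positivity)
    nlinarith [sq_nonneg M]
  · intro p M hM h1 h2 _
    have h3 := hlog p M hM h1 h2
    have := (abs_add_le (Real.log (totalWeight p)) 1).trans (add_le_add h3 abs_one.le)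
    have h5 : M ≤ M ^ 2 := by nlinarith
    have h6 : (Fintype.card S : ℝ) * M ≤ (Fintype.card S : ℝ) ^ 2 * M ^ 2 := by
      rw [sq (Fintype.card S : ℝ)]
      have : (Fintype.card S : ℝ) ≤ Fintype.card S * Fintype.card S := by nlinarith
      exact mul_le_mul this h5 (by positivity) (by positivity)
    nlinarith
  · intro p M hM h1 h2 _ _
    rw [abs_of_pos (inv_pos.2 (hpos p M hM h1))]
    have h3 := inv_totalWeight_le hM h1
    have h5 : M ≤ M ^ 2 := by nlinarith
    nlinarith [mul_nonneg (sq_nonneg (Fintype.card S : ℝ)) (sq_nonneg M)]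
  · exact measurable_totalWeight.mul (Real.measurable_log.comp measurable_totalWeight)
  · exact (Real.measurable_log.comp measurable_totalWeight).add_const 1
  · exact measurable_totalWeight.inv

/-- This function is the integrand of the first derivative of the entropy. A second application of
the heat equation to it yields the second derivative. -/
theorem twiceDiffGrowth_sq_div [Fintype E] [Nonempty S] (hu : ∀ e s, u e s ^ 2 = 1) (v : E → ℝ) :
    TwiceDiffGrowth (S := S)
    (fun p => ∑ e, v e * (weightedSum u e p ^ 2 * (totalWeight p)⁻¹))
    (fun r p => ∑ e, v e * (2 * weightedSum u e p * u e r * (totalWeight p)⁻¹ -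
      weightedSum u e p ^ 2 * (totalWeight p)⁻¹ ^ 2))
    (fun r s p => ∑ e, v e * (2 * u e s * u e r * (totalWeight p)⁻¹ -
      2 * weightedSum u e p * u e r * (totalWeight p)⁻¹ ^ 2 -
      2 * weightedSum u e p * u e s * (totalWeight p)⁻¹ ^ 2 +
      2 * weightedSum u e p ^ 2 * (totalWeight p)⁻¹ ^ 3))
    ((∑ e, |v e|) * (8 * (Fintype.card S : ℝ) ^ 2)) 5 := by
  have hn : (1 : ℝ) ≤ Fintype.card S := by exact_mod_cast Fintype.card_pos
  set n : ℝ := (Fintype.card S : ℝ)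
  have hinv : ∀ (p : S → ℝ) (M : ℝ), 1 ≤ M → (∀ s, M⁻¹ ≤ p s) → |(totalWeight p)⁻¹| ≤ M := by
    intro p M hM h1
    rw [abs_of_pos (inv_pos.2 (totalWeight_pos fun s =>
      (inv_pos.2 (zero_lt_one.trans_le hM)).trans_le (h1 s)))]
    exact inv_totalWeight_le hM h1
  have mw := fun e => measurable_weightedSum u e
  have mt := (measurable_totalWeight (S := S)).inv
  have hsum : ∀ {f : E → ℝ} {B : ℝ}, (∀ e, |f e| ≤ B) → |∑ e, v e * f e| ≤ (∑ e, |v e|) * B := by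
    intro f B hf
    rw [Finset.sum_mul]
    refine (Finset.abs_sum_le_sum_abs _ _).trans (Finset.sum_le_sum fun e _ => ?_)
    rw [abs_mul]
    exact mul_le_mul_of_nonneg_left (hf e) (abs_nonneg _)
  -- monomial bounds
  have hpow : ∀ {M : ℝ} {i j : ℕ}, 1 ≤ M → i ≤ 2 → j ≤ 5 →
      n ^ i * M ^ j ≤ n ^ 2 * M ^ 5 := fun hM hi hj =>
    mul_le_mul (pow_le_pow_right₀ hn hi) (pow_le_pow_right₀ hM hj)
      (pow_nonneg (zero_le_one.trans hM) _) (pow_nonneg (zero_le_one.trans hn) _)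
  have mono : ∀ {a q x M : ℝ} {i j : ℕ}, 1 ≤ M → |a| ≤ n * M → |q| ≤ M → |x| = 1 → i ≤ 2 →
      i + j ≤ 5 → |a ^ i * x * q ^ j| ≤ n ^ 2 * M ^ 5 := by
    intro a q x M i j hM ha hq hx hi hij
    rw [abs_mul, abs_mul, hx, mul_one, abs_pow, abs_pow]
    calc |a| ^ i * |q| ^ j ≤ (n * M) ^ i * M ^ j := by
          exact mul_le_mul (pow_le_pow_left₀ (abs_nonneg _) ha i)
            (pow_le_pow_left₀ (abs_nonneg _) hq j) (pow_nonneg (abs_nonneg _) _)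
            (pow_nonneg ((abs_nonneg _).trans ha) _)
      _ = n ^ i * M ^ (i + j) := by rw [mul_pow, pow_add]; ring
      _ ≤ _ := hpow hM hi hij
  have hu1 : ∀ e s, |u e s| = 1 := fun e s => abs_eq_one_of_sq (hu e s)
  refine ⟨?_, ?_, ?_, ?_, ?_, ?_, fun _ => ?_, fun _ _ => ?_⟩
  · intro c c' x hc hp
    have ht := (hasDerivAt_totalWeight hc).inv (totalWeight_pos hp).ne'
    refine (HasDerivAt.fun_sum (u := Finset.univ) fun e (_ : e ∈ Finset.univ) =>
      (((hasDerivAt_weightedSum (u := u) e hc).pow 2).mul ht).const_mul (v e)).congr_deriv ?_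
    simp only [Finset.sum_mul]
    rw [Finset.sum_comm]
    refine Finset.sum_congr rfl fun e _ => ?_
    simp only [Pi.pow_apply, Pi.inv_apply, Nat.cast_ofNat, Nat.add_one_sub_one, pow_one]
    have e1 : ∑ s, v e * (2 * weightedSum u e (c x) * u e s * (totalWeight (c x))⁻¹ -
        weightedSum u e (c x) ^ 2 * (totalWeight (c x))⁻¹ ^ 2) * c' s =
        v e * (2 * weightedSum u e (c x) * (totalWeight (c x))⁻¹) * (∑ s, u e s * c' s) -
        v e * (weightedSum u e (c x) ^ 2 * (totalWeight (c x))⁻¹ ^ 2) * ∑ s, c' s := by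
      rw [Finset.mul_sum, Finset.mul_sum, ← Finset.sum_sub_distrib]
      exact Finset.sum_congr rfl fun s _ => by ring
    rw [e1]
    ring
  · intro c c' x hc hp r
    have ht := (hasDerivAt_totalWeight hc).inv (totalWeight_pos hp).ne'
    refine (HasDerivAt.fun_sum (u := Finset.univ) fun e (_ : e ∈ Finset.univ) =>
      (((((hasDerivAt_weightedSum (u := u) e hc).const_mul 2).mul_const (u e r)).mul ht).sub
      (((hasDerivAt_weightedSum (u := u) e hc).pow 2).mul (ht.pow 2))).const_mul
        (v e)).congr_deriv ?_
    simp only [Finset.sum_mul]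
    rw [Finset.sum_comm]
    refine Finset.sum_congr rfl fun e _ => ?_
    simp only [Pi.pow_apply, Pi.inv_apply, Nat.cast_ofNat, Nat.add_one_sub_one, pow_one]
    have e1 : ∑ s, v e * (2 * u e s * u e r * (totalWeight (c x))⁻¹ -
      2 * weightedSum u e (c x) * u e r * (totalWeight (c x))⁻¹ ^ 2 -
      2 * weightedSum u e (c x) * u e s * (totalWeight (c x))⁻¹ ^ 2 +
      2 * weightedSum u e (c x) ^ 2 * (totalWeight (c x))⁻¹ ^ 3) * c' s =
        v e * (2 * u e r * (totalWeight (c x))⁻¹ -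
          2 * weightedSum u e (c x) * (totalWeight (c x))⁻¹ ^ 2) * (∑ s, u e s * c' s) +
        v e * (2 * weightedSum u e (c x) ^ 2 * (totalWeight (c x))⁻¹ ^ 3 -
          2 * weightedSum u e (c x) * u e r * (totalWeight (c x))⁻¹ ^ 2) * ∑ s, c' s := by
      rw [Finset.mul_sum, Finset.mul_sum, ← Finset.sum_add_distrib]
      exact Finset.sum_congr rfl fun s _ => by ring
    rw [e1]
    ring
  · intro p M hM h1 h2
    rw [mul_assoc]
    refine hsum fun e => ?_
    have := mono (i := 2) (j := 1) hM (abs_weightedSum_le hu hM h1 h2 e) (hinv p M hM h1)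
      abs_one le_rfl (by norm_num)
    rw [mul_one, pow_one] at this
    have h0 := (abs_nonneg _).trans this
    linarith
  · intro p M hM h1 h2 r
    rw [mul_assoc]
    refine hsum fun e => ?_
    have ha := abs_weightedSum_le hu hM h1 h2 e
    have hq := hinv p M hM h1
    have k1 := abs_le.1 (mono (i := 1) (j := 1) hM ha hq (hu1 e r) (by norm_num) (by norm_num))
    have k2 := abs_le.1 (mono (i := 2) (j := 2) hM ha hq abs_one (by norm_num) (by norm_num))
    rw [abs_le]
    constructor <;> linarith [k1.1, k1.2, k2.1, k2.2]
  · intro p M hM h1 h2 r s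
    rw [mul_assoc]
    refine hsum fun e => ?_
    have ha := abs_weightedSum_le hu hM h1 h2 e
    have hq := hinv p M hM h1
    have hx : |u e s * u e r| = 1 := by rw [abs_mul, hu1, hu1, one_mul]
    have k0 := abs_le.1 (mono (i := 0) (j := 1) hM ha hq hx (by norm_num) (by norm_num))
    have k1 := abs_le.1 (mono (i := 1) (j := 2) hM ha hq (hu1 e r) (by norm_num) (by norm_num))
    have k1' := abs_le.1 (mono (i := 1) (j := 2) hM ha hq (hu1 e s) (by norm_num) (by norm_num))
    have k2 := abs_le.1 (mono (i := 2) (j := 3) hM ha hq abs_one (by norm_num) (by norm_num))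
    rw [abs_le]
    constructor <;> linarith [k0.1, k0.2, k1.1, k1.2, k1'.1, k1'.2, k2.1, k2.2]
  · exact Finset.measurable_fun_sum _ fun e _ => (((mw e).pow_const 2).mul mt).const_mul _
  · exact Finset.measurable_fun_sum _ fun e _ => (((((mw e).const_mul 2).mul_const _).mul mt).sub
      (((mw e).pow_const 2).mul (mt.pow_const 2))).const_mul _
  · exact Finset.measurable_fun_sum _ fun e _ => ((((mt.const_mul _).sub
      ((((mw e).const_mul 2).mul_const _).mul (mt.pow_const 2))).sub
      ((((mw e).const_mul 2).mul_const _).mul (mt.pow_const 2))).add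
      ((((mw e).pow_const 2).const_mul 2).mul (mt.pow_const 3))).const_mul _

end

/-- `√` is not differentiable at zero, and couplings may vanish at an endpoint. In the open segment
each covariance either stands still or is positive; the endpoints are then reached by continuity. -/
theorem path_pos {E : Type*} {l₀ l₁ : E → ℝ} (h₀ : ∀ e, 0 ≤ l₀ e) (h₁ : ∀ e, 0 ≤ l₁ e)
    {t : ℝ} (ht0 : 0 < t)
    (ht1 : t < 1) (e : E) : l₁ e - l₀ e = 0 ∨ 0 < l₀ e + t * (l₁ e - l₀ e) := by
  rcases eq_or_ne (l₁ e - l₀ e) 0 with h | h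
  · exact Or.inl h
  · right
    have e1 : l₀ e + t * (l₁ e - l₀ e) = (1 - t) * l₀ e + t * l₁ e := by ring
    rw [e1]
    rcases (h₀ e).eq_or_lt with h2 | h2
    · have h3 : 0 < l₁ e := lt_of_le_of_ne (h₁ e) fun h4 => h (by rw [← h2, ← h4, sub_zero])
      rw [← h2]
      have := mul_pos ht0 h3
      linarith
    · have := mul_pos (sub_pos.2 ht1) h2
      have := mul_nonneg ht0.le (h₁ e)
      linarith

theorem path_nonneg {E : Type*} {l₀ l₁ : E → ℝ} (h₀ : ∀ e, 0 ≤ l₀ e) (h₁ : ∀ e, 0 ≤ l₁ e) {t : ℝ}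
    (ht0 : 0 ≤ t) (ht1 : t ≤ 1) (e : E) : 0 ≤ l₀ e + t * (l₁ e - l₀ e) := by
  have e1 : l₀ e + t * (l₁ e - l₀ e) = (1 - t) * l₀ e + t * l₁ e := by ring
  rw [e1]
  exact add_nonneg (mul_nonneg (sub_nonneg.2 ht1) (h₀ e)) (mul_nonneg ht0 (h₁ e))

/-! ### The entropy: derivative, comparison and convexity -/

section

variable {S E : Type*} [Fintype S] [Fintype E] {u : E → S → ℝ}

/-- The mean of `W log W`, where `W` is the normalized partition function of the centred Gaussian
field with coefficients `√(l e)`, divided by the number of configurations. -/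
def gaussEntropy (u : E → S → ℝ) (l : E → ℝ) : ℝ :=
  (∫ g, totalWeight (expWeight u l g) * Real.log (totalWeight (expWeight u l g))
    ∂(stdGaussian E)) / Fintype.card S

theorem sq_sum_eq_sum_sum (f : S → ℝ) : (∑ s, f s) ^ 2 = ∑ r, ∑ s, f r * f s := by
  rw [sq, Finset.sum_mul_sum]

theorem integral_totalWeight (hu : ∀ e s, u e s ^ 2 = 1) {l : E → ℝ} (hl : ∀ e, 0 ≤ l e) :
    ∫ g, totalWeight (expWeight u l g) ∂(stdGaussian E) = Fintype.card S := by
  unfold totalWeight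
  rw [integral_finsetSum _ fun s _ => integrable_expWeight hu l s]
  simp [integral_expWeight hu hl]

theorem integrable_totalWeight (hu : ∀ e s, u e s ^ 2 = 1) (l : E → ℝ) :
    Integrable (fun g => totalWeight (expWeight u l g)) (stdGaussian E) :=
  integrable_finsetSum _ fun s _ => integrable_expWeight hu l s

theorem continuous_gaussEntropy_path [Nonempty S] (hu : ∀ e s, u e s ^ 2 = 1) (l v : E → ℝ) :
    Continuous fun t : ℝ => gaussEntropy u fun e => l e + t * v e := by
  unfold gaussEntropy
  refine Continuous.div_const ?_ _
  refine continuous_integral_weights hu (F := fun p => totalWeight p * Real.log (totalWeight p))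
    ?_ (twiceDiffGrowth_mul_log (S := S)).bound l v
  refine Real.continuous_mul_log.comp ?_
  unfold totalWeight
  fun_prop

/-- The integrand of the derivative of the entropy. -/
theorem hasDerivAt_gaussEntropy_path [Nonempty S] (hu : ∀ e s, u e s ^ 2 = 1) (l v : E → ℝ) {t : ℝ}
    (ht : ∀ e, v e = 0 ∨ 0 < l e + t * v e) :
    HasDerivAt (fun t : ℝ => gaussEntropy u fun e => l e + t * v e)
      ((∫ g, ∑ e, v e * (weightedSum u e (expWeight u (fun e => l e + t * v e) g) ^ 2 *
        (totalWeight (expWeight u (fun e => l e + t * v e) g))⁻¹) ∂(stdGaussian E)) /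
          (2 * Fintype.card S)) t := by
  have h := (hasDerivAt_integral_weights hu (twiceDiffGrowth_mul_log (S := S)) l v ht).div_const
    (Fintype.card S : ℝ)
  refine h.congr_deriv ?_
  rw [integral_const_mul, ← div_div, one_div_mul_eq_div]
  congr 2
  refine integral_congr_ae (Eventually.of_forall fun g => Finset.sum_congr rfl fun e _ => ?_)
  simp only [weightedSum, sq_sum_eq_sum_sum, Finset.sum_mul]
  congr 1
  refine Finset.sum_congr rfl fun r _ => Finset.sum_congr rfl fun s _ => ?_
  ring

/-- Comparison of entropies by comparison of covariances. -/
theorem gaussEntropy_le_add [Nonempty S] (hu : ∀ e s, u e s ^ 2 = 1) {l₀ l₁ : E → ℝ}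
    (h₀ : ∀ e, 0 ≤ l₀ e) (h₁ : ∀ e, 0 ≤ l₁ e) {D : ℝ}
    (hD : ∀ r s, ∑ e, (l₁ e - l₀ e) * (u e r * u e s) ≤ D) :
    gaussEntropy u l₁ ≤ gaussEntropy u l₀ + D / 2 := by
  set v : E → ℝ := fun e => l₁ e - l₀ e with hv
  have hder : ∀ t ∈ interior (Set.Icc (0 : ℝ) 1), HasDerivAt
      (fun t : ℝ => gaussEntropy u fun e => l₀ e + t * v e) _ t := fun t ht =>
    hasDerivAt_gaussEntropy_path hu l₀ v
      (path_pos h₀ h₁ (by rw [interior_Icc] at ht; exact ht.1)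
        (by rw [interior_Icc] at ht; exact ht.2))
  have hcard : (0 : ℝ) < Fintype.card S := by exact_mod_cast Fintype.card_pos
  have h := (convex_Icc (0 : ℝ) 1).image_sub_le_mul_sub_of_deriv_le
    (continuous_gaussEntropy_path hu l₀ v).continuousOn
    (fun t ht => (hder t ht).differentiableAt.differentiableWithinAt) (C := D / 2) ?_
    0 (by simp) 1 (by simp) zero_le_one
  · have e0 : (fun e => l₀ e + (0 : ℝ) * v e) = l₀ := by ext e; simp
    have e1 : (fun e => l₀ e + (1 : ℝ) * v e) = l₁ := by ext e; simp [hv]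
    rw [e0, e1] at h
    linarith
  · intro t ht
    rw [(hder t ht).deriv]
    rw [interior_Icc] at ht
    set L : E → ℝ := fun e => l₀ e + t * v e with hL
    have hLn : ∀ e, 0 ≤ L e := path_nonneg h₀ h₁ ht.1.le ht.2.le
    rw [div_le_iff₀ (by positivity)]
    have : D / 2 * (2 * Fintype.card S) =
        ∫ g, D * totalWeight (expWeight u L g) ∂(stdGaussian E) := by
      rw [integral_const_mul, integral_totalWeight hu hLn]; ring
    rw [this]
    have hg := twiceDiffGrowth_sq_div (S := S) hu v
    refine integral_mono (integrable_comp_expWeight hu hg.meas hg.bound L)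
      ((integrable_totalWeight hu L).const_mul D) fun g => ?_
    simp only
    have hp := fun s => expWeight_pos u L g s
    have hW := totalWeight_pos hp
    simp only [← mul_assoc]
    rw [← Finset.sum_mul, ← div_eq_mul_inv, div_le_iff₀ hW, mul_assoc]
    -- Expanding the squares exhibits the covariance difference at each pair `(r, s)`. Bounding it
    -- by `D` gives `D W²`; after division by `W` the expectation is `D |S|`, since `E W = |S|`.
    have e2 : ∑ e, v e * weightedSum u e (expWeight u L g) ^ 2 =
        ∑ r, ∑ s, (expWeight u L g r * expWeight u L g s) * ∑ e, v e * (u e r * u e s) := by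
      simp only [weightedSum, sq_sum_eq_sum_sum, Finset.mul_sum]
      rw [Finset.sum_comm]
      refine Finset.sum_congr rfl fun r _ => ?_
      rw [Finset.sum_comm]
      refine Finset.sum_congr rfl fun s _ => Finset.sum_congr rfl fun e _ => ?_
      ring
    rw [e2]
    calc _ ≤ ∑ r, ∑ s, (expWeight u L g r * expWeight u L g s) * D :=
          Finset.sum_le_sum fun r _ => Finset.sum_le_sum fun s _ =>
            mul_le_mul_of_nonneg_left (hD r s) (mul_pos (hp r) (hp s)).le
      _ = _ := by
          simp only [← Finset.sum_mul, ← Finset.mul_sum, totalWeight]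
          ring

/-- Since `W log W ≥ W - 1` and `E W = |S| ≥ 1`. This is the lower bound needed for Fekete's lemma.
-/
theorem gaussEntropy_nonneg [Nonempty S] (hu : ∀ e s, u e s ^ 2 = 1) {l : E → ℝ}
    (hl : ∀ e, 0 ≤ l e) : 0 ≤ gaussEntropy u l := by
  have hg := twiceDiffGrowth_mul_log (S := S)
  have h : ∫ g, (totalWeight (expWeight u l g) - 1) ∂(stdGaussian E) ≤
      ∫ g, totalWeight (expWeight u l g) * Real.log (totalWeight (expWeight u l g))
        ∂(stdGaussian E) := by
    refine integral_mono ((integrable_totalWeight hu l).sub (integrable_const 1))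
      (integrable_comp_expWeight hu hg.meas hg.bound l) fun g => ?_
    have hW := totalWeight_pos fun s => expWeight_pos u l g s
    have := Real.one_sub_inv_le_log_of_pos hW
    have h2 := mul_le_mul_of_nonneg_left this hW.le
    rwa [mul_sub, mul_one, mul_inv_cancel₀ hW.ne'] at h2
  rw [integral_sub (integrable_totalWeight hu l) (integrable_const 1), integral_totalWeight hu hl]
    at h
  have hcard : (1 : ℝ) ≤ Fintype.card S := by exact_mod_cast Fintype.card_pos
  refine div_nonneg (le_trans ?_ h) (Nat.cast_nonneg _)
  simpa using hcard

/-- The entrywise square of a covariance matrix is positive semidefinite: writing each square with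
two replicas `r, s` turns the form into a positive combination of squares. -/
theorem sum_sum_mul_sq_covariance_nonneg (v : E → ℝ) {p : S → ℝ} (hp : ∀ s, 0 ≤ p s)
    (w : E → S → ℝ) : 0 ≤ ∑ f, v f * ∑ e, v e * (∑ s, p s * (w e s * w f s)) ^ 2 := by
  have : ∑ f, v f * ∑ e, v e * (∑ s, p s * (w e s * w f s)) ^ 2 =
      ∑ r, ∑ s, (p r * p s) * (∑ e, v e * (w e r * w e s)) ^ 2 := by
    calc ∑ f, v f * ∑ e, v e * (∑ s, p s * (w e s * w f s)) ^ 2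
        = ∑ f, ∑ e, ∑ r, ∑ s, (p r * p s) * ((v e * (w e r * w e s)) * (v f * (w f r * w f s))) := by
          refine Finset.sum_congr rfl fun f _ => ?_
          rw [Finset.mul_sum]
          refine Finset.sum_congr rfl fun e _ => ?_
          rw [sq, Finset.sum_mul_sum, Finset.mul_sum, Finset.mul_sum]
          refine Finset.sum_congr rfl fun r _ => ?_
          rw [Finset.mul_sum, Finset.mul_sum]
          exact Finset.sum_congr rfl fun s _ => by ring
      _ = ∑ f, ∑ r, ∑ s, ∑ e, (p r * p s) * ((v e * (w e r * w e s)) * (v f * (w f r * w f s))) := by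
          refine Finset.sum_congr rfl fun f _ => ?_
          rw [Finset.sum_comm]
          exact Finset.sum_congr rfl fun r _ => Finset.sum_comm
      _ = ∑ r, ∑ s, ∑ f, ∑ e, (p r * p s) * ((v e * (w e r * w e s)) * (v f * (w f r * w f s))) := by
          rw [Finset.sum_comm]
          exact Finset.sum_congr rfl fun r _ => Finset.sum_comm
      _ = _ := by
          refine Finset.sum_congr rfl fun r _ => Finset.sum_congr rfl fun s _ => ?_
          rw [sq, Finset.sum_mul_sum, Finset.sum_comm, Finset.mul_sum]
          exact Finset.sum_congr rfl fun e _ => by rw [Finset.mul_sum]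
  rw [this]
  exact Finset.sum_nonneg fun r _ => Finset.sum_nonneg fun s _ =>
    mul_nonneg (mul_nonneg (hp r) (hp s)) (sq_nonneg _)

/-- The integrand of the second derivative of the entropy is nonnegative. -/
theorem second_derivative_integrand_nonneg [Nonempty S] (v : E → ℝ) {p : S → ℝ}
    (hp : ∀ s, 0 < p s) :
    0 ≤ (1 / 2) * ∑ f, v f * ∑ r, ∑ s, (∑ e, v e * (2 * u e s * u e r * (totalWeight p)⁻¹ -
      2 * weightedSum u e p * u e r * (totalWeight p)⁻¹ ^ 2 -
      2 * weightedSum u e p * u e s * (totalWeight p)⁻¹ ^ 2 +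
      2 * weightedSum u e p ^ 2 * (totalWeight p)⁻¹ ^ 3)) * (u f r * p r) * (u f s * p s) := by
  have hW := totalWeight_pos hp
  set q := (totalWeight p)⁻¹ with hq
  have hWq : totalWeight p * q = 1 := mul_inv_cancel₀ hW.ne'
  set w : E → S → ℝ := fun e s => u e s - weightedSum u e p * q
  -- Each pair `(f, e)` contributes `2 / W` times the square of the unnormalized covariance of `u e`
  -- and `u f` under the weights.
  have key : ∀ f e, ∑ r, ∑ s, (2 * u e s * u e r * q - 2 * weightedSum u e p * u e r * q ^ 2 -
      2 * weightedSum u e p * u e s * q ^ 2 + 2 * weightedSum u e p ^ 2 * q ^ 3) *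
      (u f r * p r) * (u f s * p s) = 2 * q * (∑ s, p s * (w e s * w f s)) ^ 2 := by
    intro f e
    -- A covariance does not change when only one of its two factors is centred.
    have h1 : ∑ s, p s * (w e s * w f s) = ∑ s, (u e s - weightedSum u e p * q) * (u f s * p s) := by
      have : ∑ s, p s * (w e s * w f s) = ∑ s, (u e s - weightedSum u e p * q) * (u f s * p s) -
          weightedSum u f p * q * (weightedSum u e p - weightedSum u e p * q * totalWeight p) := by
        simp only [w]
        conv_rhs => rw [mul_sub]
        rw [show weightedSum u f p * q * weightedSum u e p =
          ∑ s, weightedSum u f p * q * (u e s * p s) by rw [← Finset.mul_sum]; rfl,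
          show weightedSum u f p * q * (weightedSum u e p * q * totalWeight p) =
          ∑ s, weightedSum u f p * q * (weightedSum u e p * q * p s) by
            rw [← Finset.mul_sum, ← Finset.mul_sum]; rfl,
          ← Finset.sum_sub_distrib, ← Finset.sum_sub_distrib]
        exact Finset.sum_congr rfl fun s _ => by ring
      rw [this]
      linear_combination (weightedSum u f p * q * weightedSum u e p) * hWq
    rw [h1, sq_sum_eq_sum_sum, Finset.mul_sum]
    refine Finset.sum_congr rfl fun r _ => ?_
    rw [Finset.mul_sum]
    exact Finset.sum_congr rfl fun s _ => by ring
  have : ∑ f, v f * ∑ r, ∑ s, (∑ e, v e * (2 * u e s * u e r * q -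
      2 * weightedSum u e p * u e r * q ^ 2 - 2 * weightedSum u e p * u e s * q ^ 2 +
      2 * weightedSum u e p ^ 2 * q ^ 3)) * (u f r * p r) * (u f s * p s) =
      2 * q * ∑ f, v f * ∑ e, v e * (∑ s, p s * (w e s * w f s)) ^ 2 := by
    rw [Finset.mul_sum]
    refine Finset.sum_congr rfl fun f _ => ?_
    rw [mul_left_comm]
    congr 1
    rw [Finset.mul_sum]
    simp only [mul_left_comm (2 * q), ← key f]
    simp only [Finset.sum_mul, Finset.mul_sum]
    rw [Finset.sum_comm' (s := (Finset.univ : Finset E)) (t := fun _ => Finset.univ)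
      (s' := fun _ => Finset.univ) (t' := Finset.univ) (by simp)]
    refine Finset.sum_congr rfl fun r _ => ?_
    rw [Finset.sum_comm]
    refine Finset.sum_congr rfl fun s _ => Finset.sum_congr rfl fun e _ => ?_
    ring
  rw [this]
  have h2 := sum_sum_mul_sq_covariance_nonneg v (fun s => (hp s).le) w
  have h3 : 0 ≤ q := (inv_pos.2 hW).le
  positivity

/-- The entropy is a convex function of the covariances. -/
theorem convexOn_gaussEntropy [Nonempty S] (hu : ∀ e s, u e s ^ 2 = 1) :
    ConvexOn ℝ {l : E → ℝ | ∀ e, 0 ≤ l e} (gaussEntropy u) := by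
  refine ⟨fun x hx y hy a b ha hb _ e => ?_, fun l₀ h₀ l₁ h₁ a b ha hb hab => ?_⟩
  · simp only [Pi.add_apply, Pi.smul_apply, smul_eq_mul]
    exact add_nonneg (mul_nonneg ha (hx e)) (mul_nonneg hb (hy e))
  set v : E → ℝ := fun e => l₁ e - l₀ e with hv
  have hcard : (0 : ℝ) < Fintype.card S := by exact_mod_cast Fintype.card_pos
  have hpos : ∀ t ∈ interior (Set.Icc (0 : ℝ) 1), ∀ e, v e = 0 ∨ 0 < l₀ e + t * v e := fun t ht =>
    path_pos h₀ h₁ (by rw [interior_Icc] at ht; exact ht.1) (by rw [interior_Icc] at ht; exact ht.2)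
  have hc : ConvexOn ℝ (Set.Icc (0 : ℝ) 1) fun t : ℝ => gaussEntropy u fun e => l₀ e + t * v e := by
    refine convexOn_of_hasDerivWithinAt2_nonneg (convex_Icc 0 1)
      (continuous_gaussEntropy_path hu l₀ v).continuousOn
      (fun t ht => (hasDerivAt_gaussEntropy_path hu l₀ v (hpos t ht)).hasDerivWithinAt)
      (fun t ht => ((hasDerivAt_integral_weights hu (twiceDiffGrowth_sq_div (S := S) hu v) l₀ v
        (hpos t ht)).div_const (2 * (Fintype.card S : ℝ))).hasDerivWithinAt) fun t ht => ?_
    refine div_nonneg (integral_nonneg fun g => ?_) (by positivity)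
    exact second_derivative_integrand_nonneg v fun s => expWeight_pos _ _ _ _
  have h := hc.2 (x := 0) (by simp) (y := 1) (by simp) ha hb hab
  simp only [smul_eq_mul, mul_zero, mul_one, zero_add, zero_mul, add_zero, one_mul] at h
  have e1 : (fun e => l₀ e + v e) = l₁ := by ext e; simp [hv]
  have e2 : (fun e => l₀ e + b * v e) = a • l₀ + b • l₁ := by
    ext e
    simp only [hv, Pi.add_apply, Pi.smul_apply, smul_eq_mul]
    rw [← eq_sub_iff_add_eq] at hab
    rw [hab]; ring
  rw [e1, e2] at h
  simpa only [smul_eq_mul] using h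

end

/-! ### The Nishimori identity -/

theorem integral_eq_integral_comp {α α' : Type*} [MeasurableSpace α] [MeasurableSpace α']
    {μ : Measure α} {ν : Measure α'} {T : α → α'} (hT : MeasurePreserving T μ ν) {f : α' → ℝ}
    (hf : Measurable f) : ∫ y, f y ∂ν = ∫ x, f (T x) ∂μ := by
  rw [← hT.map_eq, integral_map hT.measurable.aemeasurable hf.aestronglyMeasurable]

theorem sign_of_sq {x : ℝ} (h : x ^ 2 = 1) : x = 1 ∨ x = -1 := sq_eq_one_iff.1 h

/-- On the Nishimori line the mean of `log Z` is the entropy, up to an explicit constant. -/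
theorem integral_log_sum_exp_nishimori {S E : Type*} [Fintype S] [Fintype E] [Group S]
    {u : E → S → ℝ} (hu : ∀ e s, u e s ^ 2 = 1) (hmul : ∀ e r s, u e (r * s) = u e r * u e s)
    {l : E → ℝ} (hl : ∀ e, 0 ≤ l e) :
    ∫ g, Real.log (∑ s, Real.exp (∑ e, Real.sqrt (l e) * g e * u e s))
      ∂(Measure.pi fun e => gaussianReal (Real.sqrt (l e)) 1) =
      (∑ e, l e) / 2 + gaussEntropy u l := by
  have hone : ∀ e, u e 1 = 1 := fun e => by
    have h1 := hmul e 1 1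
    rw [mul_one, ← sq, hu] at h1
    exact h1
  set c := ∑ e, l e / 2 with hc
  have hcc : (∑ e, l e) / 2 = c := by rw [hc, Finset.sum_div]
  have hlog : ∀ g : E → ℝ, Real.log (∑ s, Real.exp (∑ e, Real.sqrt (l e) * g e * u e s)) =
      Real.log (totalWeight (expWeight u l g)) + c := by
    intro g
    have h1 : ∑ s, Real.exp (∑ e, Real.sqrt (l e) * g e * u e s) =
        totalWeight (expWeight u l g) * Real.exp c := by
      rw [totalWeight, Finset.sum_mul]
      refine Finset.sum_congr rfl fun s _ => ?_
      rw [expWeight, ← Real.exp_add, hc, ← Finset.sum_add_distrib]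
      congr 1
      exact Finset.sum_congr rfl fun e _ => by ring
    rw [h1, Real.log_mul (totalWeight_pos fun s => expWeight_pos u l g s).ne' (Real.exp_ne_zero _),
      Real.log_exp]
  have mW : Measurable fun g => totalWeight (expWeight u l g) :=
    measurable_totalWeight.comp (measurable_expWeight u l)
  have mp : ∀ s, Measurable fun g => expWeight u l g s := fun s =>
    (measurable_pi_apply s).comp (measurable_expWeight u l)
  have hb := (twiceDiffGrowth_mul_log (S := S)).bound₁
  have hint : ∀ s, Integrable (fun g => expWeight u l g s *
      Real.log (totalWeight (expWeight u l g))) (stdGaussian E) := by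
    intro s
    have h1 : Integrable (fun g => expWeight u l g s *
        (Real.log (totalWeight (expWeight u l g)) + 1)) (stdGaussian E) := by
      refine integrable_comp_expWeight hu (C := (Fintype.card S : ℝ) ^ 2 + 1) (k := 3)
        (F := fun p => p s * (Real.log (totalWeight p) + 1))
        ((measurable_pi_apply s).mul
          ((Real.measurable_log.comp measurable_totalWeight).add_const 1))
        (fun p M hM h1 h2 => ?_) l
      rw [mul_comm]
      refine abs_mul_le_mul_pow (hb p M hM h1 h2 s) ?_
      rw [abs_of_nonneg ((inv_nonneg.2 (zero_le_one.trans hM)).trans (h1 s))]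
      exact h2 s
    refine (h1.sub (integrable_expWeight hu l s)).congr (Eventually.of_forall fun g => ?_)
    simp only [Pi.sub_apply]
    ring
  -- Gauge symmetry: the sign change `g ↦ u · s * g` preserves the Gaussian law and translates the
  -- weights by `s`. It leaves `W` unchanged and sends the weight of `s` to that of `s * s`, which
  -- equals that of `1`. So all terms of `E[W log W]` are equal, and the entropy is any one of them.
  have hgauge : ∀ s, ∫ g, expWeight u l g s * Real.log (totalWeight (expWeight u l g))
      ∂(stdGaussian E) = ∫ g, expWeight u l g 1 * Real.log (totalWeight (expWeight u l g))
      ∂(stdGaussian E) := by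
    intro s
    have hp := measurePreserving_sign_mul (fun e => u e s) fun e => sign_of_sq (hu e s)
    have hm : Measurable fun g => expWeight u l g s * Real.log (totalWeight (expWeight u l g)) :=
      (mp s).mul (Real.measurable_log.comp mW)
    rw [integral_eq_integral_comp hp hm]
    have hw : ∀ g r, expWeight u l (fun e => u e s * g e) r = expWeight u l g (s * r) := by
      intro g r
      unfold expWeight
      congr 1
      exact Finset.sum_congr rfl fun e _ => by rw [hmul]; ring
    have hw' : ∀ g, expWeight u l g (s * s) = expWeight u l g 1 := by
      intro g
      unfold expWeight
      congr 1
      exact Finset.sum_congr rfl fun e _ => by rw [hmul, ← sq, hu, hone]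
    refine integral_congr_ae (Eventually.of_forall fun g => ?_)
    simp only [hw, hw', totalWeight]
    rw [Fintype.sum_equiv (Equiv.mulLeft s) (fun r => expWeight u l g (s * r))
      (fun r => expWeight u l g r) fun r => rfl]
  have hent : gaussEntropy u l = ∫ g, expWeight u l g 1 *
      Real.log (totalWeight (expWeight u l g)) ∂(stdGaussian E) := by
    have hcard : (Fintype.card S : ℝ) ≠ 0 := by exact_mod_cast Fintype.card_ne_zero
    have h1 : ∫ g, totalWeight (expWeight u l g) * Real.log (totalWeight (expWeight u l g))
        ∂(stdGaussian E) = ∑ s, ∫ g, expWeight u l g s *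
          Real.log (totalWeight (expWeight u l g)) ∂(stdGaussian E) := by
      rw [← integral_finsetSum _ fun s _ => hint s]
      refine integral_congr_ae (Eventually.of_forall fun g => ?_)
      simp only
      rw [← Finset.sum_mul]
      rfl
    rw [gaussEntropy, h1, Finset.sum_congr rfl fun s _ => hgauge s, Finset.sum_const,
      Finset.card_univ, nsmul_eq_mul, mul_div_cancel_left₀ _ hcard]
  -- As `u e 1 = 1`, the density of the Nishimori law with respect to the centred one is exactly the
  -- weight of the configuration `1`.
  rw [integral_pi_gaussianReal_eq, hcc, hent]
  have h2 : ∀ g : E → ℝ, Real.exp (∑ e, (Real.sqrt (l e) * g e - Real.sqrt (l e) ^ 2 / 2)) *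
      Real.log (∑ s, Real.exp (∑ e, Real.sqrt (l e) * g e * u e s)) =
      c * expWeight u l g 1 + expWeight u l g 1 * Real.log (totalWeight (expWeight u l g)) := by
    intro g
    rw [hlog]
    have : Real.exp (∑ e, (Real.sqrt (l e) * g e - Real.sqrt (l e) ^ 2 / 2)) =
        expWeight u l g 1 := by
      simp only [expWeight, hone, mul_one, Real.sq_sqrt (hl _)]
    rw [this]; ring
  rw [integral_congr_ae (Eventually.of_forall h2),
    integral_add ((integrable_expWeight hu l 1).const_mul c) (hint 1), integral_const_mul,
    integral_expWeight hu hl, mul_one]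

/-! ### Spin systems with pair couplings -/

/-- The product of the spins of a pair of sites. -/
def pairSpin {ι : Type*} (e : ι × ι) (σ : SpinConfig ι) : ℝ := spinVal (σ e.1) * spinVal (σ e.2)

theorem spinVal_sq (s : ℤˣ) : spinVal s ^ 2 = 1 := by
  rcases Int.units_eq_one_or s with h | h <;> simp [spinVal, h]

theorem spinVal_mul (r s : ℤˣ) : spinVal (r * s) = spinVal r * spinVal s := by
  simp [spinVal]

theorem pairSpin_sq {ι : Type*} (e : ι × ι) (σ : SpinConfig ι) : pairSpin e σ ^ 2 = 1 := by
  rw [pairSpin, mul_pow, spinVal_sq, spinVal_sq, one_mul]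

theorem pairSpin_mul {ι : Type*} (e : ι × ι) (σ τ : SpinConfig ι) :
    pairSpin e (σ * τ) = pairSpin e σ * pairSpin e τ := by
  simp only [pairSpin, Pi.mul_apply, spinVal_mul]
  ring

variable {ι : Type*} [Fintype ι]

theorem measurePreserving_add_couplingLaw (J₀ : ι → ι → ℝ) :
    MeasurePreserving (fun (g : ι × ι → ℝ) e => g e + J₀ e.1 e.2) (stdGaussian (ι × ι))
      (couplingLaw J₀) := by
  refine measurePreserving_pi (f := fun (e : ι × ι) (x : ℝ) => x + J₀ e.1 e.2) _ _
    fun e => ⟨by fun_prop, ?_⟩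
  rw [gaussianReal_map_add_const, zero_add]

variable [DecidableEq ι]

/-- The entropy of the spin system with signal-to-noise ratios `l`. -/
def pairEntropy (l : ι × ι → ℝ) : ℝ := gaussEntropy (S := SpinConfig ι) pairSpin l

theorem partitionFunction_eq (β : ℝ) (a : ι → ι → ℝ) (J : ι × ι → ℝ) :
    partitionFunction β a J =
      ∑ σ : SpinConfig ι, Real.exp (∑ e : ι × ι, β * a e.1 e.2 * J e * pairSpin e σ) := by
  unfold partitionFunction hamiltonian
  refine Finset.sum_congr rfl fun σ _ => ?_
  congr 1
  rw [neg_mul_neg, Fintype.sum_prod_type, Finset.mul_sum]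
  refine Finset.sum_congr rfl fun i _ => ?_
  rw [Finset.mul_sum]
  refine Finset.sum_congr rfl fun j _ => ?_
  simp only [pairSpin]
  ring

theorem measurable_log_partitionFunction (β : ℝ) (a : ι → ι → ℝ) :
    Measurable fun J => Real.log (partitionFunction β a J) := by
  unfold partitionFunction hamiltonian; fun_prop

/-- The means enter `log Z` only through `a * J₀`, so a coupling with zero coefficient may be given
any mean. This reconciles the constant mean of the Sherrington-Kirkpatrick model, diagonal included,
with the form `β * a`. -/
theorem integral_log_partitionFunction_congr {β : ℝ} {a J₀ J₁ : ι → ι → ℝ}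
    (h : ∀ i j, a i j * J₀ i j = a i j * J₁ i j) :
    ∫ J, Real.log (partitionFunction β a J) ∂(couplingLaw J₀) =
      ∫ J, Real.log (partitionFunction β a J) ∂(couplingLaw J₁) := by
  rw [integral_eq_integral_comp (measurePreserving_add_couplingLaw J₀)
      (measurable_log_partitionFunction β a),
    integral_eq_integral_comp (measurePreserving_add_couplingLaw J₁)
      (measurable_log_partitionFunction β a)]
  refine integral_congr_ae (Eventually.of_forall fun g => ?_)
  simp only [partitionFunction_eq]
  congr 1
  refine Finset.sum_congr rfl fun σ _ => ?_
  congr 1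
  refine Finset.sum_congr rfl fun e _ => ?_
  linear_combination β * pairSpin e σ * h e.1 e.2

/-- The mean of `log Z` on the Nishimori line. -/
theorem integral_log_partitionFunction_nishimori {β : ℝ} (hβ : 0 ≤ β) {a : ι → ι → ℝ}
    (ha : ∀ i j, 0 ≤ a i j) :
    ∫ J, Real.log (partitionFunction β a J) ∂(couplingLaw fun i j => β * a i j) =
      (∑ e : ι × ι, (β * a e.1 e.2) ^ 2) / 2 +
        pairEntropy fun e : ι × ι => (β * a e.1 e.2) ^ 2 := by
  have h := integral_log_sum_exp_nishimori (S := SpinConfig ι) (u := pairSpin) pairSpin_sq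
    pairSpin_mul (l := fun e : ι × ι => (β * a e.1 e.2) ^ 2) fun e => sq_nonneg _
  simp only [Real.sqrt_sq (mul_nonneg hβ (ha _ _))] at h
  rw [pairEntropy, ← h]
  simp only [partitionFunction_eq]
  rfl

theorem totalWeight_reindex {κ : Type*} [Fintype κ] [DecidableEq κ] (φ : ι ≃ κ) (l : κ × κ → ℝ)
    (g : κ × κ → ℝ) :
    totalWeight (expWeight (S := SpinConfig ι) pairSpin (fun e : ι × ι => l (φ e.1, φ e.2))
      fun e => g (φ e.1, φ e.2)) = totalWeight (expWeight (S := SpinConfig κ) pairSpin l g) := by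
  unfold totalWeight
  refine Fintype.sum_equiv (φ.arrowCongr (Equiv.refl ℤˣ)) _ _ fun σ => ?_
  unfold expWeight
  congr 1
  refine Fintype.sum_equiv (φ.prodCongr φ) _ _ fun e => ?_
  simp [pairSpin, Prod.map]

/-- The entropy is invariant under relabelling of the sites. -/
theorem pairEntropy_reindex {κ : Type*} [Fintype κ] [DecidableEq κ] (φ : ι ≃ κ) (l : κ × κ → ℝ) :
    pairEntropy (fun e : ι × ι => l (φ e.1, φ e.2)) = pairEntropy l := by
  have hp : MeasurePreserving (fun (g : κ × κ → ℝ) (e : ι × ι) => g (φ e.1, φ e.2))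
      (stdGaussian (κ × κ)) (stdGaussian (ι × ι)) :=
    measurePreserving_pi_comp (fun _ => 0) (φ.prodCongr φ).injective
  have mW : Measurable fun g => totalWeight (expWeight (S := SpinConfig ι) pairSpin
      (fun e : ι × ι => l (φ e.1, φ e.2)) g) :=
    measurable_totalWeight.comp (measurable_expWeight pairSpin _)
  unfold pairEntropy gaussEntropy
  have hm : Measurable fun g =>
      totalWeight (expWeight (S := SpinConfig ι) pairSpin (fun e : ι × ι => l (φ e.1, φ e.2)) g) *
      Real.log (totalWeight (expWeight (S := SpinConfig ι) pairSpin
        (fun e : ι × ι => l (φ e.1, φ e.2)) g)) := mW.mul (Real.measurable_log.comp mW)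
  rw [integral_eq_integral_comp hp hm]
  simp only [totalWeight_reindex φ l]
  congr 2
  exact Fintype.card_congr (φ.arrowCongr (Equiv.refl ℤˣ))

/-! ### Systems split into independent blocks -/

section Blocks

variable {ι κ : Type*} [Fintype ι] [DecidableEq κ]

/-- The number of sites in a block. -/
def blockCard (f : ι → κ) (a : κ) : ℕ := Fintype.card {i // f i = a}

/-- The averaging matrix of the partition of the sites into the fibres of `f`. -/
def blockAvg (f : ι → κ) (i j : ι) : ℝ := if f i = f j then (blockCard f (f i) : ℝ)⁻¹ else 0

/-- The average over the block of a site. -/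
def blockMean (f : ι → κ) (x : ι → ℝ) (i : ι) : ℝ := ∑ j, blockAvg f i j * x j

theorem blockCard_pos (f : ι → κ) (i : ι) : 0 < blockCard f (f i) :=
  Fintype.card_pos_iff.2 ⟨⟨i, rfl⟩⟩

theorem blockAvg_nonneg (f : ι → κ) (i j : ι) : 0 ≤ blockAvg f i j := by
  unfold blockAvg
  split_ifs <;> positivity

theorem blockAvg_comm (f : ι → κ) (i j : ι) : blockAvg f i j = blockAvg f j i := by
  unfold blockAvg
  by_cases h : f i = f j
  · rw [if_pos h, if_pos h.symm, h]
  · rw [if_neg h, if_neg (Ne.symm h)]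

theorem sum_blockAvg (f : ι → κ) (i : ι) : ∑ j, blockAvg f i j = 1 := by
  unfold blockAvg
  have h : ((blockCard f (f i) : ℕ) : ℝ) ≠ 0 := by exact_mod_cast (blockCard_pos f i).ne'
  rw [← Finset.sum_filter, Finset.sum_const, nsmul_eq_mul]
  have h2 : (Finset.univ.filter fun j => f i = f j).card = blockCard f (f i) := by
    rw [blockCard, Fintype.card_subtype]
    congr 1
    ext j
    simp [eq_comm]
  rw [h2, mul_inv_cancel₀ h]

theorem blockMean_congr (f : ι → κ) (x : ι → ℝ) {i j : ι} (h : f i = f j) :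
    blockMean f x i = blockMean f x j := by
  unfold blockMean blockAvg
  rw [h]

theorem blockMean_blockMean (f : ι → κ) (x : ι → ℝ) (i : ι) :
    blockMean f (blockMean f x) i = blockMean f x i := by
  rw [blockMean]
  have : ∀ j, blockAvg f i j * blockMean f x j = blockAvg f i j * blockMean f x i := by
    intro j
    by_cases h : f i = f j
    · rw [blockMean_congr f x h]
    · simp [blockAvg, h]
  rw [Finset.sum_congr rfl fun j _ => this j, ← Finset.sum_mul, sum_blockAvg, one_mul]

theorem sum_mul_blockMean (f : ι → κ) (x y : ι → ℝ) :
    ∑ i, x i * blockMean f y i = ∑ i, blockMean f x i * y i := by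
  simp only [blockMean, Finset.mul_sum, Finset.sum_mul]
  rw [Finset.sum_comm]
  refine Finset.sum_congr rfl fun i _ => Finset.sum_congr rfl fun j _ => ?_
  rw [blockAvg_comm]
  ring

/-- Block averaging is symmetric and idempotent, hence an orthogonal projection. -/
theorem sum_sq_blockMean (f : ι → κ) (x : ι → ℝ) :
    ∑ i, blockMean f x i ^ 2 = ∑ i, x i * blockMean f x i := by
  rw [sum_mul_blockMean f x (x)]
  have := sum_mul_blockMean f x (blockMean f x)
  simp only [blockMean_blockMean] at this
  rw [← sum_mul_blockMean, this]
  exact Finset.sum_congr rfl fun i _ => sq _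

theorem sum_blockMean (f : ι → κ) (x : ι → ℝ) : ∑ i, blockMean f x i = ∑ i, x i := by
  simp only [blockMean]
  rw [Finset.sum_comm]
  refine Finset.sum_congr rfl fun i _ => ?_
  rw [← Finset.sum_mul, Finset.sum_congr rfl fun j _ => blockAvg_comm f j i, sum_blockAvg, one_mul]

/-- The couplings of independent blocks, with constant couplings `b a` inside the block `a`. -/
def blockCov (f : ι → κ) (b : κ → ℝ) (e : ι × ι) : ℝ := if f e.1 = f e.2 then b (f e.1) else 0

theorem sum_fibers [Fintype κ] (f : ι → κ) (h : ι → ℝ) :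
    ∑ i, h i = ∑ a, ∑ i : {i // f i = a}, h i := by
  rw [← (Equiv.sigmaFiberEquiv f).sum_comp h, Fintype.sum_sigma]
  rfl

theorem sum_fibers_block [Fintype κ] (f : ι → κ) (h : ι → ι → ℝ)
    (hz : ∀ i j, f i ≠ f j → h i j = 0) :
    ∑ i, ∑ j, h i j = ∑ a, ∑ i : {i // f i = a}, ∑ j : {i // f i = a}, h i j := by
  rw [sum_fibers f]
  refine Finset.sum_congr rfl fun a _ => Finset.sum_congr rfl fun i _ => ?_
  rw [sum_fibers f, Finset.sum_eq_single a]
  · intro b _ hb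
    refine Finset.sum_eq_zero fun j _ => hz _ _ ?_
    rw [i.2, j.2]
    exact hb.symm
  · exact fun h => absurd (Finset.mem_univ a) h

variable [DecidableEq ι] [Fintype κ]

/-- Splitting a configuration into its restrictions to the blocks. -/
def configSplit (f : ι → κ) : SpinConfig ι ≃ ((a : κ) → SpinConfig {i // f i = a}) where
  toFun σ a i := σ i.1
  invFun p i := p (f i) ⟨i, rfl⟩
  left_inv _ := rfl
  right_inv p := by
    funext a ⟨i, hi⟩
    subst hi
    rfl

theorem partitionFunction_blockCov (f : ι → κ) (b : κ → ℝ) (J : ι × ι → ℝ) :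
    partitionFunction 1 (fun i j => Real.sqrt (blockCov f b (i, j))) J =
      ∏ a, partitionFunction (ι := {i // f i = a}) 1 (fun _ _ => Real.sqrt (b a))
        fun e => J (e.1, e.2) := by
  simp only [partitionFunction]
  rw [Finset.prod_univ_sum, Fintype.piFinset_univ]
  refine Fintype.sum_equiv (configSplit f) _ _ fun σ => ?_
  rw [← Real.exp_sum]
  congr 1
  simp only [hamiltonian, neg_mul_neg, one_mul]
  rw [sum_fibers_block f]
  · refine Finset.sum_congr rfl fun a _ => Finset.sum_congr rfl fun i _ =>
      Finset.sum_congr rfl fun j _ => ?_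
    simp [blockCov, i.2, j.2, configSplit]
  · intro i j h
    simp [blockCov, h]

theorem partitionFunction_pos (β : ℝ) (a : ι → ι → ℝ) (J : ι × ι → ℝ) :
    0 < partitionFunction β a J :=
  Finset.sum_pos (fun _ _ => Real.exp_pos _) Finset.univ_nonempty

/-- With `β = 1` and `a = √l`, every nonnegative `l` comes from a Nishimori model, so identities for
`log Z` transfer to the entropy. -/
theorem integral_log_partitionFunction_sqrt {l : ι × ι → ℝ} (hl : ∀ e, 0 ≤ l e) :
    ∫ J, Real.log (partitionFunction 1 (fun i j => Real.sqrt (l (i, j))) J)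
      ∂(couplingLaw fun i j => Real.sqrt (l (i, j))) = (∑ e, l e) / 2 + pairEntropy l := by
  have h := integral_log_partitionFunction_nishimori (β := 1) zero_le_one
    (a := fun i j => Real.sqrt (l (i, j))) fun _ _ => Real.sqrt_nonneg _
  simp only [one_mul, Prod.mk.eta, Real.sq_sqrt (hl _)] at h
  exact h

/-- The entropy of independent blocks is the sum of the entropies of the blocks. -/
theorem pairEntropy_blockCov (f : ι → κ) {b : κ → ℝ} (hb : ∀ a, 0 ≤ b a) :
    pairEntropy (blockCov f b) =
      ∑ a, pairEntropy (ι := {i // f i = a}) fun _ => b a := by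
  have hl : ∀ e, 0 ≤ blockCov f b e := fun e => by
    unfold blockCov; split_ifs; exacts [hb _, le_rfl]
  have h := integral_log_partitionFunction_sqrt hl
  -- Without couplings between blocks `log Z` is additive. The entropy inherits additivity because
  -- the explicit terms `(∑ l) / 2` add up as well.
  have h1 : ∀ J, Real.log (partitionFunction 1 (fun i j => Real.sqrt (blockCov f b (i, j))) J) =
      ∑ a, Real.log (partitionFunction (ι := {i // f i = a}) 1 (fun _ _ => Real.sqrt (b a))
        fun e => J (e.1, e.2)) := fun J => by
    rw [partitionFunction_blockCov, Real.log_prod fun a _ => (partitionFunction_pos _ _ _).ne']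
  have hmp : ∀ a, MeasurePreserving
      (fun (J : ι × ι → ℝ) (e : {i // f i = a} × {i // f i = a}) => J (e.1, e.2))
      (couplingLaw fun i j => Real.sqrt (blockCov f b (i, j)))
      (couplingLaw fun _ _ : {i // f i = a} => Real.sqrt (b a)) := by
    intro a
    have h2 := measurePreserving_pi_comp (fun e : ι × ι => Real.sqrt (blockCov f b (e.1, e.2)))
      (j := fun e : {i // f i = a} × {i // f i = a} => ((e.1 : ι), (e.2 : ι))) (by
        rintro ⟨⟨i, _⟩, ⟨j, _⟩⟩ ⟨⟨i', _⟩, ⟨j', _⟩⟩ h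
        simp only [Prod.mk.injEq] at h
        simp [h.1, h.2])
    have h3 : ∀ e : {i // f i = a} × {i // f i = a},
        blockCov f b ((e.1 : ι), (e.2 : ι)) = b a := fun e => by
      simp [blockCov, e.1.2, e.2.2]
    simp only [h3] at h2
    exact h2
  have hint : ∀ a, Integrable (fun J : ι × ι → ℝ => Real.log (partitionFunction
      (ι := {i // f i = a}) 1 (fun _ _ => Real.sqrt (b a)) fun e => J (e.1, e.2)))
      (couplingLaw fun i j => Real.sqrt (blockCov f b (i, j))) := fun a =>
    (hmp a).integrable_comp_of_integrable
      (integrable_log_partitionFunction 1 (fun _ _ : {i // f i = a} => Real.sqrt (b a)) _)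
  simp only [h1] at h
  rw [integral_finsetSum _ fun a _ => hint a] at h
  have h4 : ∀ a, ∫ J, Real.log (partitionFunction (ι := {i // f i = a}) 1
      (fun _ _ => Real.sqrt (b a)) fun e => J (e.1, e.2))
      ∂(couplingLaw fun i j => Real.sqrt (blockCov f b (i, j))) =
      (∑ _e : {i // f i = a} × {i // f i = a}, b a) / 2 +
        pairEntropy (ι := {i // f i = a}) fun _ => b a := by
    intro a
    rw [← integral_log_partitionFunction_sqrt fun _ => hb a]
    exact (integral_eq_integral_comp (hmp a) (measurable_log_partitionFunction 1
      fun _ _ : {i // f i = a} => Real.sqrt (b a))).symm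
  simp only [h4] at h
  rw [Finset.sum_add_distrib, ← Finset.sum_div] at h
  have h5 : ∑ e, blockCov f b e = ∑ a, ∑ _e : {i // f i = a} × {i // f i = a}, b a := by
    rw [Fintype.sum_prod_type, sum_fibers_block f (fun i j => blockCov f b (i, j))
      (fun i j h => by simp [blockCov, h])]
    refine Finset.sum_congr rfl fun a _ => ?_
    rw [Fintype.sum_prod_type]
    refine Finset.sum_congr rfl fun i _ => Finset.sum_congr rfl fun j _ => ?_
    simp [blockCov, i.2, j.2]
  rw [h5] at h
  linarith

/-! ### The mean-field entropy -/

/-- The entropy of the mean-field model with all couplings equal to `c / n`. -/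
def meanFieldEntropy (c : ℝ) (n : ℕ) : ℝ := pairEntropy (ι := Fin n) fun _ => c / n

theorem pairEntropy_const {n : ℕ} (h : Fintype.card ι = n) (c : ℝ) :
    pairEntropy (ι := ι) (fun _ => c / n) = meanFieldEntropy c n := by
  rw [meanFieldEntropy]
  exact pairEntropy_reindex (Fintype.equivFinOfCardEq h) fun _ => c / n

theorem meanFieldEntropy_nonneg {c : ℝ} (hc : 0 ≤ c) (n : ℕ) : 0 ≤ meanFieldEntropy c n :=
  gaussEntropy_nonneg pairSpin_sq fun _ => by positivity

/-- Since `pairSpin` is multiplicative, the condition on pairs of configurations `σ, τ` involves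
only the single sign vector `σ * τ`. -/
theorem pairEntropy_le_add {l₀ l₁ : ι × ι → ℝ} (h₀ : ∀ e, 0 ≤ l₀ e) (h₁ : ∀ e, 0 ≤ l₁ e) {D : ℝ}
    (hD : ∀ x : ι → ℝ, (∀ i, |x i| = 1) →
      ∑ i, ∑ j, (l₁ (i, j) - l₀ (i, j)) * (x i * x j) ≤ D) :
    pairEntropy l₁ ≤ pairEntropy l₀ + D / 2 := by
  refine gaussEntropy_le_add pairSpin_sq h₀ h₁ fun σ τ => ?_
  simp only [← pairSpin_mul]
  rw [Fintype.sum_prod_type]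
  exact hD (fun i => spinVal ((σ * τ) i)) fun i => abs_eq_one_of_sq (spinVal_sq _)

/-- A model whose couplings are dominated, as a quadratic form, by those of independent mean-field
models on the blocks of a partition. -/
theorem pairEntropy_le_sum_blocks (f : ι → κ) {c : ℝ} (hc : 0 ≤ c) {l : ι × ι → ℝ}
    (hl : ∀ e, 0 ≤ l e) {D : ℝ} (hD : ∀ x : ι → ℝ, (∀ i, |x i| = 1) →
      ∑ i, ∑ j, l (i, j) * (x i * x j) ≤ c * ∑ i, x i * blockMean f x i + D) :
    pairEntropy l ≤ ∑ a, meanFieldEntropy c (blockCard f a) + D / 2 := by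
  have hb : ∀ a, 0 ≤ c / blockCard f a := fun a => by positivity
  have h1 : pairEntropy (blockCov f fun a => c / blockCard f a) =
      ∑ a, meanFieldEntropy c (blockCard f a) := by
    rw [pairEntropy_blockCov f hb]
    exact Finset.sum_congr rfl fun a _ => pairEntropy_const rfl c
  rw [← h1]
  refine pairEntropy_le_add (fun e => ?_) hl fun x hx => ?_
  · unfold blockCov; split_ifs; exacts [hb _, le_rfl]
  · have h2 : ∑ i, ∑ j, blockCov f (fun a => c / blockCard f a) (i, j) * (x i * x j) =
        c * ∑ i, x i * blockMean f x i := by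
      rw [Finset.mul_sum]
      refine Finset.sum_congr rfl fun i _ => ?_
      rw [blockMean, Finset.mul_sum, Finset.mul_sum]
      refine Finset.sum_congr rfl fun j _ => ?_
      by_cases h : f i = f j
      · simp only [blockCov, blockAvg, if_pos h]; ring
      · simp [blockCov, blockAvg, if_neg h]
    simp only [sub_mul, Finset.sum_sub_distrib]
    rw [h2]
    linarith [hD x hx]

/-- Block averaging preserves the total, so the mean-field form is `(c / N) (∑ y i)²` in terms of
the block means `y`; Cauchy-Schwarz bounds it by `c ∑ y i²`, the form of the independent blocks.
There is no error term. -/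
theorem meanFieldEntropy_le_sum_blocks (f : ι → κ) {c : ℝ} (hc : 0 ≤ c) :
    meanFieldEntropy c (Fintype.card ι) ≤ ∑ a, meanFieldEntropy c (blockCard f a) := by
  rw [← pairEntropy_const (ι := ι) rfl c]
  have h := pairEntropy_le_sum_blocks f hc (l := fun _ => c / Fintype.card ι)
    (fun _ => by positivity) (D := 0) fun x _ => ?_
  · simpa using h
  · rw [← sum_sq_blockMean, add_zero]
    have h1 : ∑ i, ∑ j, c / Fintype.card ι * (x i * x j) =
        c / Fintype.card ι * (∑ i, blockMean f x i) ^ 2 := by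
      rw [sum_blockMean, sq, Finset.sum_mul_sum, Finset.mul_sum]
      exact Finset.sum_congr rfl fun i _ => by rw [Finset.mul_sum]
    rw [h1]
    rcases isEmpty_or_nonempty ι with hι | hι
    · simp
    have h2 := sq_sum_le_card_mul_sum_sq (s := Finset.univ) (f := blockMean f x)
    rw [Finset.card_univ] at h2
    have hN : (0 : ℝ) < Fintype.card ι := by exact_mod_cast Fintype.card_pos
    rw [div_mul_eq_mul_div, div_le_iff₀ hN]
    have := mul_le_mul_of_nonneg_left h2 hc
    linarith

theorem subadditive_meanFieldEntropy {c : ℝ} (hc : 0 ≤ c) : Subadditive (meanFieldEntropy c) := by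
  intro m n
  have h := meanFieldEntropy_le_sum_blocks (ι := Fin m ⊕ Fin n) (κ := Bool) Sum.isLeft hc
  have h1 : blockCard (Sum.isLeft : Fin m ⊕ Fin n → Bool) true = m := by
    rw [blockCard, Fintype.card_congr (β := Fin m)
      ⟨fun x => x.1.getLeft x.2, fun i => ⟨Sum.inl i, rfl⟩, fun x => by simp, fun i => by simp⟩]
    exact Fintype.card_fin m
  have h2 : blockCard (Sum.isLeft : Fin m ⊕ Fin n → Bool) false = n := by
    rw [blockCard, Fintype.card_congr (β := Fin n)
      ⟨fun x => x.1.getRight (Sum.isLeft_eq_false.1 x.2), fun i => ⟨Sum.inr i, rfl⟩,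
        fun x => by simp,
        fun i => by simp⟩]
    exact Fintype.card_fin n
  rw [Fintype.sum_bool, h1, h2, Fintype.card_sum, Fintype.card_fin, Fintype.card_fin] at h
  exact h

/-- The limit of the mean-field entropy per site. -/
theorem exists_tendsto_meanFieldEntropy {c : ℝ} (hc : 0 ≤ c) :
    ∃ p : ℝ, Tendsto (fun n : ℕ => meanFieldEntropy c n / n) atTop (𝓝 p) := by
  refine ⟨(subadditive_meanFieldEntropy hc).lim, (subadditive_meanFieldEntropy hc).tendsto_lim ?_⟩
  refine ⟨0, ?_⟩
  rintro _ ⟨n, rfl⟩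
  exact div_nonneg (meanFieldEntropy_nonneg hc n) (Nat.cast_nonneg n)

end Blocks

/-! ### Comparison with the mean-field model -/

section Comparison

/-- Double transitivity of the symmetric group: symmetrized couplings take only one diagonal and one
off-diagonal value. -/
theorem exists_perm_map_pair {ι : Type*} [DecidableEq ι] {i j i' j' : ι} (h : i ≠ j)
    (h' : i' ≠ j') :
    ∃ π : Equiv.Perm ι, π i = i' ∧ π j = j' := by
  refine ⟨Equiv.swap (Equiv.swap i i' j) j' * Equiv.swap i i', ?_, ?_⟩
  · rw [Equiv.Perm.mul_apply, Equiv.swap_apply_left]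
    refine Equiv.swap_apply_of_ne_of_ne (fun h1 => h ?_) h'
    have := (Equiv.swap i i').injective ((Equiv.swap_apply_left i i').trans h1)
    exact this
  · rw [Equiv.Perm.mul_apply, Equiv.swap_apply_left]

variable {ι : Type*} [Fintype ι] [DecidableEq ι]

/-- The average of the couplings over all relabellings of the sites. -/
def symmetrization (l : ι × ι → ℝ) (e : ι × ι) : ℝ :=
  ∑ π : Equiv.Perm ι, (Fintype.card (Equiv.Perm ι) : ℝ)⁻¹ * l (π e.1, π e.2)

theorem symmetrization_perm (l : ι × ι → ℝ) (τ : Equiv.Perm ι) (i j : ι) :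
    symmetrization l (τ i, τ j) = symmetrization l (i, j) :=
  Fintype.sum_equiv (Equiv.mulRight τ) _ _ fun π => by simp

/-- Jensen's inequality for the convex entropy, all relabellings having the same entropy. -/
theorem pairEntropy_symmetrization_le {l : ι × ι → ℝ} (hl : ∀ e, 0 ≤ l e) :
    pairEntropy (symmetrization l) ≤ pairEntropy l := by
  have hcard : (Fintype.card (Equiv.Perm ι) : ℝ) ≠ 0 := by exact_mod_cast Fintype.card_ne_zero
  have h := (convexOn_gaussEntropy (S := SpinConfig ι) (u := pairSpin) pairSpin_sq).map_sum_le
    (t := Finset.univ) (w := fun _ : Equiv.Perm ι => (Fintype.card (Equiv.Perm ι) : ℝ)⁻¹)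
    (p := fun π e => l (π e.1, π e.2)) (fun _ _ => by positivity)
    (by simp [hcard]) (fun π _ e => hl _)
  have h1 : ∑ π : Equiv.Perm ι, (Fintype.card (Equiv.Perm ι) : ℝ)⁻¹ •
      (fun e : ι × ι => l (π e.1, π e.2)) = symmetrization l := by
    ext e
    simp [symmetrization]
  rw [h1] at h
  refine h.trans (le_of_eq ?_)
  have h2 : ∀ π : Equiv.Perm ι, gaussEntropy (S := SpinConfig ι) pairSpin
      (fun e : ι × ι => l (π e.1, π e.2)) = pairEntropy l := fun π => pairEntropy_reindex π l
  simp only [h2, Finset.sum_const, Finset.card_univ, nsmul_eq_mul, smul_eq_mul]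
  rw [← mul_assoc, mul_inv_cancel₀ hcard, one_mul]

theorem sum_symmetrization (l : ι × ι → ℝ) : ∑ e, symmetrization l e = ∑ e, l e := by
  have hcard : (Fintype.card (Equiv.Perm ι) : ℝ) ≠ 0 := by exact_mod_cast Fintype.card_ne_zero
  simp only [symmetrization]
  rw [Finset.sum_comm]
  have : ∀ π : Equiv.Perm ι, ∑ e : ι × ι, (Fintype.card (Equiv.Perm ι) : ℝ)⁻¹ * l (π e.1, π e.2) =
      (Fintype.card (Equiv.Perm ι) : ℝ)⁻¹ * ∑ e, l e := by
    intro π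
    rw [← Finset.mul_sum]
    congr 1
    exact Fintype.sum_equiv (π.prodCongr π) _ _ fun e => rfl
  simp only [this, Finset.sum_const, Finset.card_univ, nsmul_eq_mul]
  rw [← mul_assoc, mul_inv_cancel₀ hcard, one_mul]

/-- The mean-field model minimizes the entropy, up to a bounded error. -/
theorem meanFieldEntropy_le_pairEntropy_add {c : ℝ} (hc : 0 ≤ c) (hN : 2 ≤ Fintype.card ι)
    {l : ι × ι → ℝ} (hl : ∀ e, 0 ≤ l e) (hsum : ∑ e, l e = c * Fintype.card ι) :
    meanFieldEntropy c (Fintype.card ι) ≤ pairEntropy l + c := by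
  set N : ℝ := (Fintype.card ι : ℝ) with hNdef
  have hN2 : (2 : ℝ) ≤ N := by rw [hNdef]; exact_mod_cast hN
  obtain ⟨i₀, j₀, hij⟩ := Fintype.exists_pair_of_one_lt_card (α := ι) (by omega)
  set m := symmetrization l with hm
  have hm0 : ∀ e, 0 ≤ m e := fun e => Finset.sum_nonneg fun π _ => mul_nonneg (by positivity) (hl _)
  set α₀ := m (i₀, i₀)
  set α₁ := m (i₀, j₀)
  have hdiag : ∀ i, m (i, i) = α₀ := fun i => by
    have := symmetrization_perm l (Equiv.swap i₀ i) i₀ i₀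
    rwa [Equiv.swap_apply_left] at this
  have hoff : ∀ i j, i ≠ j → m (i, j) = α₁ := fun i j h => by
    obtain ⟨π, h1, h2⟩ := exists_perm_map_pair hij h
    have := symmetrization_perm l π i₀ j₀
    rwa [h1, h2] at this
  have hform : ∀ i j, m (i, j) = α₁ + if i = j then α₀ - α₁ else 0 := fun i j => by
    by_cases h : i = j
    · subst h; rw [hdiag, if_pos rfl]; ring
    · rw [hoff i j h, if_neg h, add_zero]
  have htot : N * (N * α₁ + (α₀ - α₁)) = c * N := by
    rw [← hsum, ← sum_symmetrization, Fintype.sum_prod_type]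
    simp only [← hm, hform, Finset.sum_add_distrib, Finset.sum_ite_eq, Finset.mem_univ, if_true,
      Finset.sum_const, Finset.card_univ, nsmul_eq_mul, ← hNdef]
    ring
  -- Symmetrization preserves the sum of the couplings, so every row of the symmetrized matrix sums
  -- to `c`, as in the mean-field model.
  have htot' : N * α₁ + (α₀ - α₁) = c := by
    have : N ≠ 0 := by positivity
    field_simp at htot
    linarith
  have hα₀ : 0 ≤ α₀ := hm0 _
  have hle := pairEntropy_le_add (l₀ := m) (l₁ := fun _ : ι × ι => c / N) hm0
    (fun _ => by positivity) (D := 2 * c) fun x hx => ?_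
  · rw [← pairEntropy_const (ι := ι) rfl c]
    have := pairEntropy_symmetrization_le hl
    linarith
  · have hxx : ∀ i, x i * x i = 1 := fun i => by rw [← abs_mul_abs_self, hx, one_mul]
    have h1 : ∑ i, ∑ j, (c / N - m (i, j)) * (x i * x j) =
        (c / N - α₁) * (∑ i, x i) ^ 2 - N * (α₀ - α₁) := by
      simp only [hform, sub_mul, add_mul, ite_mul, zero_mul, Finset.sum_sub_distrib,
        Finset.sum_add_distrib, Finset.sum_ite_eq, Finset.mem_univ, if_true, hxx, mul_one,
        Finset.sum_const, Finset.card_univ, nsmul_eq_mul, ← hNdef, ← Finset.mul_sum, sq,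
        Finset.sum_mul_sum]
      ring
    rw [h1]
    -- Equal row sums mean that the two forms agree on constant vectors; their difference becomes
    -- `(c / N - α₁) ((∑ x i)² - N²)`.
    have h2 : N * (α₀ - α₁) = (c / N - α₁) * N ^ 2 := by
      have : c = c / N * N := by field_simp
      rw [show α₀ - α₁ = c - N * α₁ by linarith, this]
      field_simp
    rw [h2]
    have h3 : (∑ i, x i) ^ 2 ≤ N ^ 2 := by
      rw [sq_le_sq, abs_of_nonneg (by positivity : 0 ≤ N)]
      refine (Finset.abs_sum_le_sum_abs _ _).trans (le_of_eq ?_)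
      simp [hx, hNdef]
    -- As `α₀ ≥ 0`, the row sum gives `α₁ (N - 1) ≤ c`. Hence `α₁ N - c ≤ α₁`, and `α₁ ≤ 2c / N`
    -- because `N ≥ 2`. This is where the error `D = 2c` comes from.
    have h4 : (α₁ - c / N) * N ≤ 2 * c / N := by
      have h5 : α₁ * (N - 1) ≤ c := by nlinarith
      have h6 : α₁ ≤ 2 * c / N := by
        rw [le_div_iff₀ (by positivity)]
        have : 0 ≤ α₁ := hm0 _
        nlinarith
      have h7 : (α₁ - c / N) * N = α₁ * N - c := by field_simp
      rw [h7]
      linarith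
    rcases le_total 0 (c / N - α₁) with h5 | h5
    · have := mul_le_mul_of_nonneg_left h3 h5
      linarith
    · have h6 : (α₁ - c / N) * N * N ≤ 2 * c / N * N :=
        mul_le_mul_of_nonneg_right h4 (by positivity)
      rw [div_mul_cancel₀ _ (by positivity : N ≠ 0)] at h6
      have h7 := mul_nonneg (sub_nonneg.2 h5) (sq_nonneg (∑ i, x i))
      nlinarith

/-! ### Slowly varying doubly stochastic couplings -/

end Comparison

section SlowlyVarying

variable {ι κ : Type*} [Fintype ι]

/-- By `2 y i y j ≤ y i² + y j²`, with the row sums applied to one square and the column sums to the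
other. -/
theorem sum_doublyStochastic_le {K : ι → ι → ℝ} (hK0 : ∀ i j, 0 ≤ K i j)
    (hrow : ∀ i, ∑ j, K i j = 1)
    (hcol : ∀ j, ∑ i, K i j = 1) (y : ι → ℝ) :
    ∑ i, ∑ j, K i j * (y i * y j) ≤ ∑ i, y i ^ 2 := by
  have h1 : ∀ i j, K i j * (y i * y j) ≤ K i j * (y i ^ 2 / 2) + K i j * (y j ^ 2 / 2) := by
    intro i j
    rw [← mul_add]
    exact mul_le_mul_of_nonneg_left (by nlinarith [sq_nonneg (y i - y j)]) (hK0 i j)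
  refine (Finset.sum_le_sum fun i _ => Finset.sum_le_sum fun j _ => h1 i j).trans (le_of_eq ?_)
  simp only [Finset.sum_add_distrib]
  rw [Finset.sum_comm (f := fun i j => K i j * (y j ^ 2 / 2))]
  simp only [← Finset.sum_mul, hrow, hcol, one_mul]
  rw [← Finset.sum_add_distrib]
  exact Finset.sum_congr rfl fun i _ => by ring

variable [DecidableEq κ]

theorem abs_blockMean_le (f : ι → κ) {x : ι → ℝ} (hx : ∀ i, |x i| ≤ 1) (i : ι) :
    |blockMean f x i| ≤ 1 := by
  rw [← sum_blockAvg f i]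
  refine (Finset.abs_sum_le_sum_abs _ _).trans (Finset.sum_le_sum fun j _ => ?_)
  rw [abs_mul, abs_of_nonneg (blockAvg_nonneg f i j)]
  exact mul_le_of_le_one_right (blockAvg_nonneg f i j) (hx j)

/-- A matrix whose columns vary little inside the blocks acts almost trivially on the
fluctuations around the block means. -/
theorem abs_sum_sub_blockMean_le (f : ι → κ) {K : ι → ι → ℝ} {ε : ℝ}
    (hK : ∀ j j', f j = f j' → ∑ i, |K i j - K i j'| ≤ ε) {x z : ι → ℝ} (hx : ∀ i, |x i| ≤ 1)
    (hz : ∀ i, |z i| ≤ 1) :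
    ∑ i, ∑ j, K i j * (z i * (x j - blockMean f x j)) ≤ Fintype.card ι * ε := by
  have h1 : ∀ i, ∑ j, K i j * (z i * (x j - blockMean f x j)) =
      ∑ j, ∑ j', blockAvg f j j' * ((K i j - K i j') * (z i * x j)) := by
    intro i
    -- The projection is symmetric, so it moves from `x` onto the row `K i`, where only the
    -- variation inside a block remains.
    have h2 : ∑ j, K i j * blockMean f x j = ∑ j, blockMean f (K i) j * x j :=
      sum_mul_blockMean f (K i) x
    have h3 : ∑ j, K i j * (z i * (x j - blockMean f x j)) =
        z i * (∑ j, K i j * x j - ∑ j, K i j * blockMean f x j) := by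
      rw [← Finset.sum_sub_distrib, Finset.mul_sum]
      exact Finset.sum_congr rfl fun j _ => by ring
    rw [h3, h2, ← Finset.sum_sub_distrib, Finset.mul_sum]
    refine Finset.sum_congr rfl fun j _ => ?_
    have h4 : ∑ j', blockAvg f j j' * ((K i j - K i j') * (z i * x j)) =
        (∑ j', blockAvg f j j') * (K i j * (z i * x j)) - blockMean f (K i) j * (z i * x j) := by
      rw [blockMean, Finset.sum_mul, Finset.sum_mul, ← Finset.sum_sub_distrib]
      exact Finset.sum_congr rfl fun j' _ => by ring
    rw [h4, sum_blockAvg]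
    ring
  simp only [h1]
  calc ∑ i, ∑ j, ∑ j', blockAvg f j j' * ((K i j - K i j') * (z i * x j))
      ≤ ∑ i, ∑ j, ∑ j', blockAvg f j j' * |K i j - K i j'| := by
        refine Finset.sum_le_sum fun i _ => Finset.sum_le_sum fun j _ =>
          Finset.sum_le_sum fun j' _ => mul_le_mul_of_nonneg_left ?_ (blockAvg_nonneg f j j')
        refine (le_abs_self _).trans ?_
        rw [abs_mul, abs_mul]
        exact mul_le_of_le_one_right (abs_nonneg _)
          (mul_le_one₀ (hz i) (abs_nonneg _) (hx j))
    _ = ∑ j, ∑ j', blockAvg f j j' * ∑ i, |K i j - K i j'| := by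
        rw [Finset.sum_comm]
        refine Finset.sum_congr rfl fun j _ => ?_
        rw [Finset.sum_comm]
        exact Finset.sum_congr rfl fun j' _ => by rw [Finset.mul_sum]
    _ ≤ ∑ j, ∑ j', blockAvg f j j' * ε := by
        refine Finset.sum_le_sum fun j _ => Finset.sum_le_sum fun j' _ => ?_
        by_cases h : f j = f j'
        · exact mul_le_mul_of_nonneg_left (hK j j' h) (blockAvg_nonneg f j j')
        · simp [blockAvg, h]
    _ = Fintype.card ι * ε := by
        simp only [← Finset.sum_mul, sum_blockAvg, Finset.sum_const, Finset.card_univ,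
          nsmul_eq_mul, mul_one]

/-- The entropy of slowly varying doubly stochastic couplings is at most that of independent
mean-field models on the blocks. -/
theorem pairEntropy_le_sum_blocks_of_slowly_varying [DecidableEq ι] [Fintype κ] (f : ι → κ)
    {c : ℝ} (hc : 0 ≤ c)
    {K : ι → ι → ℝ} (hK0 : ∀ i j, 0 ≤ K i j)
    (hrow : ∀ i, ∑ j, K i j = 1)
    (hcol : ∀ j, ∑ i, K i j = 1) {ε : ℝ}
    (h₁ : ∀ j j', f j = f j' → ∑ i, |K i j - K i j'| ≤ ε)
    (h₂ : ∀ i i', f i = f i' → ∑ j, |K i j - K i' j| ≤ ε) :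
    pairEntropy (fun e : ι × ι => c * K e.1 e.2) ≤
      ∑ a, meanFieldEntropy c (blockCard f a) + c * (Fintype.card ι * ε) := by
  have h := pairEntropy_le_sum_blocks f hc (l := fun e : ι × ι => c * K e.1 e.2)
    (fun e => mul_nonneg hc (hK0 _ _)) (D := 2 * (c * (Fintype.card ι * ε))) fun x hx => ?_
  · linarith
  · have hx1 : ∀ i, |x i| ≤ 1 := fun i => (hx i).le
    set y := blockMean f x with hy
    have hy1 : ∀ i, |y i| ≤ 1 := abs_blockMean_le f hx1
    have e1 := sum_doublyStochastic_le hK0 hrow hcol y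
    have e2 := abs_sum_sub_blockMean_le f h₁ hx1 hx1
    have e3 := abs_sum_sub_blockMean_le (K := fun j i => K i j) f h₂ hx1 hy1
    rw [Finset.sum_comm] at e3
    -- The main term involves only the block means `y`, and double stochasticity bounds it by `∑ y
    -- i²`. Each of the two fluctuation terms costs `N ε`, one using the variation of columns and
    -- the other that of rows.
    have e4 : ∑ i, ∑ j, K i j * (x i * x j) = ∑ i, ∑ j, K i j * (y i * y j) +
        ∑ i, ∑ j, K i j * (x i * (x j - y j)) + ∑ i, ∑ j, K i j * (y j * (x i - y i)) := by
      simp only [← Finset.sum_add_distrib]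
      exact Finset.sum_congr rfl fun i _ => Finset.sum_congr rfl fun j _ => by ring
    have e5 : ∑ i, ∑ j, c * K i j * (x i * x j) = c * ∑ i, ∑ j, K i j * (x i * x j) := by
      simp only [Finset.mul_sum, mul_assoc]
    have e6 := sum_sq_blockMean f x
    simp only at e3 ⊢
    rw [e5, ← e6]
    have : ∑ i, ∑ j, K i j * (x i * x j) ≤ ∑ i, y i ^ 2 + 2 * (Fintype.card ι * ε) := by linarith
    have := mul_le_mul_of_nonneg_left this hc
    linarith

end SlowlyVarying

/-! ### The Sherrington-Kirkpatrick model -/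

theorem sq_mul_skCoeff (N : ℕ) (β : ℝ) (i j : Fin N) :
    (β * skCoeff N i j) ^ 2 = if i = j then 0 else β ^ 2 / 2 / N := by
  unfold skCoeff
  split_ifs
  · simp
  · rw [mul_pow, div_pow, one_pow, Real.sq_sqrt (by positivity)]
    field_simp

theorem skFreeEnergy_eq (N : ℕ) {β : ℝ} (hβ : 0 < β) :
    skFreeEnergy N β = -(1 / (β * N)) * ((∑ e : Fin N × Fin N, (β * skCoeff N e.1 e.2) ^ 2) / 2 +
      pairEntropy fun e : Fin N × Fin N => (β * skCoeff N e.1 e.2) ^ 2) := by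
  rw [skFreeEnergy, quenchedFreeEnergy, Fintype.card_fin]
  congr 1
  rw [← integral_log_partitionFunction_nishimori hβ.le fun i j => ?_]
  · refine integral_log_partitionFunction_congr fun i j => ?_
    unfold skCoeff
    split_ifs
    · simp
    · ring
  · unfold skCoeff
    split_ifs <;> positivity

/-- On sign vectors `x i * x i = 1`, so the diagonal couplings only add a constant, at most `β² /
2`, to the quadratic form; comparison in both directions halves it. -/
theorem abs_pairEntropy_sk_sub_le (N : ℕ) (β : ℝ) :
    |pairEntropy (fun e : Fin N × Fin N => (β * skCoeff N e.1 e.2) ^ 2) -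
      meanFieldEntropy (β ^ 2 / 2) N| ≤ β ^ 2 / 4 := by
  have hform : ∀ (x : Fin N → ℝ), (∀ i, |x i| = 1) →
      ∑ i, ∑ j, (β ^ 2 / 2 / N - (β * skCoeff N i j) ^ 2) * (x i * x j) =
        N * (β ^ 2 / 2 / N) := by
    intro x hx
    have h1 : ∀ i j, (β ^ 2 / 2 / N - (β * skCoeff N i j) ^ 2) * (x i * x j) =
        if i = j then β ^ 2 / 2 / N else 0 := by
      intro i j
      rw [sq_mul_skCoeff]
      split_ifs with h
      · subst h; rw [← abs_mul_abs_self (x i), hx]; ring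
      · ring
    simp only [h1, Finset.sum_ite_eq, Finset.mem_univ, if_true, Finset.sum_const, Finset.card_univ,
      Fintype.card_fin, nsmul_eq_mul]
  have hN : (N : ℝ) * (β ^ 2 / 2 / N) ≤ β ^ 2 / 2 ∧ 0 ≤ (N : ℝ) * (β ^ 2 / 2 / N) := by
    refine ⟨?_, by positivity⟩
    rcases eq_or_ne (N : ℝ) 0 with h | h
    · rw [h, zero_mul]; positivity
    · rw [mul_div_cancel₀ _ h]
  have h1 := pairEntropy_le_add (ι := Fin N) (l₀ := fun e => (β * skCoeff N e.1 e.2) ^ 2)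
    (l₁ := fun _ => β ^ 2 / 2 / N) (fun _ => sq_nonneg _) (fun _ => by positivity)
    (D := β ^ 2 / 2) fun x hx => (hform x hx).le.trans hN.1
  have h2 := pairEntropy_le_add (ι := Fin N) (l₁ := fun e => (β * skCoeff N e.1 e.2) ^ 2)
    (l₀ := fun _ => β ^ 2 / 2 / N) (fun _ => by positivity) (fun _ => sq_nonneg _)
    (D := 0) fun x hx => ?_
  · unfold meanFieldEntropy
    rw [abs_le]
    constructor <;> nlinarith [sq_nonneg β]
  · have h3 := hform x hx
    have h4 : ∑ i, ∑ j, ((β * skCoeff N i j) ^ 2 - β ^ 2 / 2 / N) * (x i * x j) =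
        -(N * (β ^ 2 / 2 / N)) := by
      rw [← h3]
      simp only [← Finset.sum_neg_distrib]
      exact Finset.sum_congr rfl fun i _ => Finset.sum_congr rfl fun j _ => by ring
    simp only
    rw [h4]
    linarith [hN.2]

/-- The free energy of the Sherrington-Kirkpatrick model in terms of the mean-field entropy. -/
theorem tendsto_skFreeEnergy {β : ℝ} (hβ : 0 < β) {p : ℝ}
    (hp : Tendsto (fun n : ℕ => meanFieldEntropy (β ^ 2 / 2) n / n) atTop (𝓝 p)) :
    Tendsto (fun N : ℕ => skFreeEnergy N β) atTop (𝓝 (-(1 / β) * (β ^ 2 / 4 + p))) := by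
  have hinv : Tendsto (fun N : ℕ => (N : ℝ)⁻¹) atTop (𝓝 0) := tendsto_inv_atTop_nhds_zero_nat
  have hdiff : Tendsto (fun N : ℕ => (pairEntropy (fun e : Fin N × Fin N =>
      (β * skCoeff N e.1 e.2) ^ 2) - meanFieldEntropy (β ^ 2 / 2) N) * (N : ℝ)⁻¹) atTop (𝓝 0) := by
    refine squeeze_zero_norm (a := fun N : ℕ => β ^ 2 / 4 * (N : ℝ)⁻¹) (fun N => ?_) ?_
    · rw [norm_mul, Real.norm_eq_abs, norm_inv, Real.norm_natCast]
      exact mul_le_mul_of_nonneg_right (abs_pairEntropy_sk_sub_le N β) (by positivity)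
    · simpa using hinv.const_mul (β ^ 2 / 4)
  have hlim : Tendsto (fun N : ℕ => -(1 / β) * (β ^ 2 / 4 * (1 - (N : ℝ)⁻¹) +
      ((pairEntropy (fun e : Fin N × Fin N => (β * skCoeff N e.1 e.2) ^ 2) -
        meanFieldEntropy (β ^ 2 / 2) N) * (N : ℝ)⁻¹ + meanFieldEntropy (β ^ 2 / 2) N / N)))
      atTop (𝓝 (-(1 / β) * (β ^ 2 / 4 * (1 - 0) + (0 + p)))) :=
    (((hinv.const_sub 1).const_mul _).add (hdiff.add hp)).const_mul _
  rw [sub_zero, mul_one, zero_add] at hlim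
  refine hlim.congr' ?_
  filter_upwards [eventually_gt_atTop 0] with N hN
  have hN' : (N : ℝ) ≠ 0 := by exact_mod_cast hN.ne'
  rw [skFreeEnergy_eq N hβ]
  have h1 : ∑ e : Fin N × Fin N, (β * skCoeff N e.1 e.2) ^ 2 = β ^ 2 / 2 * (N - 1) := by
    simp only [sq_mul_skCoeff]
    rw [Fintype.sum_prod_type]
    have h2 : ∀ i j : Fin N, (if i = j then (0 : ℝ) else β ^ 2 / 2 / N) =
        β ^ 2 / 2 / N - if i = j then β ^ 2 / 2 / N else 0 := by
      intro i j; split_ifs <;> ring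
    simp only [h2, Finset.sum_sub_distrib, Finset.sum_ite_eq, Finset.mem_univ, if_true,
      Finset.sum_const, Finset.card_univ, Fintype.card_fin, nsmul_eq_mul]
    field_simp
  rw [h1]
  field_simp
  ring

/-! ### Riemann sums over the periodic hypercube -/

section Torus

variable {d : ℕ}

theorem norm_le_sum_abs (x : EuclideanSpace ℝ (Fin d)) : ‖x‖ ≤ ∑ k, |x k| := by
  rw [EuclideanSpace.norm_eq]
  refine Real.sqrt_le_iff.2 ⟨Finset.sum_nonneg fun _ _ => abs_nonneg _, ?_⟩
  exact Finset.sum_sq_le_sq_sum_of_nonneg fun _ _ => abs_nonneg _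

theorem norm_le_card_mul {x : EuclideanSpace ℝ (Fin d)} {b : ℝ} (h : ∀ k, |x k| ≤ b) :
    ‖x‖ ≤ d * b := by
  refine (norm_le_sum_abs x).trans ((Finset.sum_le_sum fun k _ => h k).trans ?_)
  simp

theorem abs_coord_le_norm (x : EuclideanSpace ℝ (Fin d)) (k : Fin d) : |x k| ≤ ‖x‖ :=
  PiLp.norm_apply_le x k

/-- The site `r` of the periodic hypercube, rescaled to the unit cube. -/
def scaledPos {L : ℕ} (r : Torus d L) : EuclideanSpace ℝ (Fin d) := (1 / (L : ℝ)) • position r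

theorem scaledPos_apply {L : ℕ} (r : Torus d L) (k : Fin d) :
    scaledPos r k = ((r k).valMinAbs : ℝ) / L := by
  simp [scaledPos, position, div_eq_inv_mul]

theorem abs_valMinAbs_neg {L : ℕ} (a : ZMod L) : |((-a).valMinAbs : ℝ)| = |(a.valMinAbs : ℝ)| := by
  have := ZMod.natAbs_valMinAbs_neg a
  rw [← Int.cast_abs, ← Int.cast_abs, Int.abs_eq_natAbs, Int.abs_eq_natAbs, this]

variable {L : ℕ} [NeZero L]

theorem natCast_pos_of_neZero (L : ℕ) [NeZero L] : (0 : ℝ) < L := by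
  exact_mod_cast NeZero.pos L

theorem abs_valMinAbs_le (a : ZMod L) : |(a.valMinAbs : ℝ)| ≤ L / 2 := by
  have h := ZMod.valMinAbs_mem_Ioc a
  have h1 : (-(L : ℝ)) < (a.valMinAbs : ℝ) * 2 := by exact_mod_cast h.1
  have h2 : (a.valMinAbs : ℝ) * 2 ≤ L := by exact_mod_cast h.2
  rw [abs_le]
  constructor <;> linarith

theorem abs_scaledPos_le (r : Torus d L) (k : Fin d) : |scaledPos r k| ≤ 1 / 2 := by
  have hL := natCast_pos_of_neZero L
  rw [scaledPos_apply, abs_div, abs_of_pos hL, div_le_iff₀ hL]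
  linarith [abs_valMinAbs_le (r k)]

theorem valMinAbs_add_of_lt {a b : ZMod L}
    (h : |(a.valMinAbs : ℝ) + b.valMinAbs| < L / 2) :
    (a + b).valMinAbs = a.valMinAbs + b.valMinAbs := by
  rw [ZMod.valMinAbs_spec]
  refine ⟨by simp, ?_⟩
  rw [abs_lt] at h
  constructor
  · have : (-(L : ℝ)) < ((a.valMinAbs : ℝ) + b.valMinAbs) * 2 := by linarith
    exact_mod_cast this
  · have : ((a.valMinAbs : ℝ) + b.valMinAbs) * 2 ≤ L := by linarith
    exact_mod_cast this

/-- Without wrapping, a translation of the hypercube is a translation of the rescaled positions. -/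
theorem norm_scaledPos_add_sub_le {r s : Torus d L} {ρ δ : ℝ} (hδρ : δ < ρ)
    (hr : ∀ k, |scaledPos r k| ≤ 1 / 2 - ρ) (hs : ∀ k, |scaledPos s k| ≤ δ) :
    ‖scaledPos (r + s) - scaledPos r‖ ≤ d * δ := by
  have hL := natCast_pos_of_neZero L
  refine norm_le_card_mul fun k => ?_
  have h1 := hr k
  have h2 := hs k
  have h3 : ((r + s) k).valMinAbs = (r k).valMinAbs + (s k).valMinAbs := by
    rw [Pi.add_apply]
    refine valMinAbs_add_of_lt ?_
    rw [scaledPos_apply, abs_div, abs_of_pos hL, div_le_iff₀ hL] at h1 h2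
    refine (abs_add_le _ _).trans_lt ?_
    nlinarith
  rw [PiLp.sub_apply, scaledPos_apply (r + s), h3, scaledPos_apply r]
  have : (((r k).valMinAbs + (s k).valMinAbs : ℤ) : ℝ) / L - (r k).valMinAbs / L =
      scaledPos s k := by
    rw [scaledPos_apply]; push_cast; ring
  rw [this]
  exact h2

/-- Normalized sums of products over the hypercube. -/
theorem sum_torus_prod (F : Fin d → ZMod L → ℝ) :
    ∑ r : Torus d L, (1 / (L : ℝ)) ^ d * ∏ k, F k (r k) = ∏ k, (1 / (L : ℝ)) * ∑ a, F k a := by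
  rw [← Finset.mul_sum, Finset.prod_mul_distrib, Finset.prod_const, Finset.card_univ,
    Fintype.card_fin, Finset.prod_univ_sum, Fintype.piFinset_univ]

theorem sum_torus_one : ∑ _r : Torus d L, (1 / (L : ℝ)) ^ d = 1 := by
  have hL := natCast_pos_of_neZero L
  have h := sum_torus_prod (d := d) (L := L) fun _ _ => 1
  simp only [Finset.prod_const_one, mul_one, Finset.sum_const, Finset.card_univ, ZMod.card,
    nsmul_eq_mul] at h
  rw [one_div_mul_cancel hL.ne', Finset.prod_const_one] at h
  simp

theorem sum_torus_coord (k : Fin d) (G : ZMod L → ℝ) :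
    ∑ r : Torus d L, (1 / (L : ℝ)) ^ d * G (r k) = (1 / (L : ℝ)) * ∑ a, G a := by
  have hL := natCast_pos_of_neZero L
  have h := sum_torus_prod (d := d) (L := L) fun k' a => if k' = k then G a else 1
  simp only [Finset.prod_ite_eq', Finset.mem_univ, if_true] at h
  rw [h, Finset.prod_eq_single k]
  · simp
  · intro b _ hb
    simp only [if_neg hb, Finset.sum_const, Finset.card_univ, ZMod.card, nsmul_eq_mul, mul_one]
    exact one_div_mul_cancel hL.ne'
  · exact fun h => absurd (Finset.mem_univ k) h

theorem card_Icc_ceil_floor_le {a b : ℝ} (h : a ≤ b) :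
    ((Finset.Icc ⌈a⌉ ⌊b⌋).card : ℝ) ≤ b - a + 1 := by
  rw [Int.card_Icc]
  have h1 := Int.le_ceil a
  have h2 := Int.floor_le b
  have h3 : (((⌊b⌋ + 1 - ⌈a⌉).toNat : ℤ) : ℝ) ≤ b - a + 1 := by
    rw [Int.toNat_eq_max]
    push_cast
    exact max_le (by linarith) (by linarith)
  exact_mod_cast h3

/-- The fraction of residues close to the boundary of the fundamental interval. -/
theorem card_boundary_le {ρ : ℝ} (hρ : 0 ≤ ρ) :
    (1 / (L : ℝ)) * ∑ a : ZMod L, (if 1 / 2 - ρ < |(a.valMinAbs : ℝ) / L| then (1 : ℝ) else 0) ≤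
      2 * ρ + 2 / L := by
  have hL := natCast_pos_of_neZero L
  rw [← Finset.sum_filter, Finset.sum_const, nsmul_eq_mul, mul_one]
  set T := Finset.univ.filter fun a : ZMod L => 1 / 2 - ρ < |(a.valMinAbs : ℝ) / L|
  -- The residues lie in two intervals of length `L ρ`, one at each end of `(-L/2, L/2]`, each with
  -- at most `L ρ + 1` integers.
  have h1 : T.card ≤ (Finset.Icc ⌈(L : ℝ) * (1 / 2 - ρ)⌉ ⌊(L : ℝ) / 2⌋ ∪
      Finset.Icc ⌈-((L : ℝ) / 2)⌉ ⌊-((L : ℝ) * (1 / 2 - ρ))⌋).card := by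
    refine Finset.card_le_card_of_injOn (fun a => a.valMinAbs) (fun a ha => ?_)
      (ZMod.injective_valMinAbs.injOn)
    have ha' := (Finset.mem_filter.1 ha).2
    rw [abs_div, abs_of_pos hL, lt_div_iff₀ hL] at ha'
    have hb := abs_le.1 (abs_valMinAbs_le a)
    simp only [Finset.coe_union, Finset.coe_Icc, Set.mem_union, Set.mem_Icc]
    rcases le_total 0 (a.valMinAbs : ℝ) with h | h
    · rw [abs_of_nonneg h] at ha'
      exact Or.inl ⟨Int.ceil_le.2 (by linarith), Int.le_floor.2 hb.2⟩
    · rw [abs_of_nonpos h] at ha'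
      exact Or.inr ⟨Int.ceil_le.2 hb.1, Int.le_floor.2 (by linarith)⟩
  have h2 : (T.card : ℝ) ≤ (L * ρ + 1) + (L * ρ + 1) := by
    refine (Nat.cast_le.2 (h1.trans (Finset.card_union_le _ _))).trans ?_
    push_cast
    have hle : (L : ℝ) * (1 / 2 - ρ) ≤ L / 2 := by nlinarith
    have h3 := card_Icc_ceil_floor_le hle
    have h4 := card_Icc_ceil_floor_le (neg_le_neg hle)
    linarith
  rw [one_div_mul_eq_div, div_le_iff₀ hL, add_mul, div_mul_cancel₀ _ hL.ne']
  linarith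

/-- The fraction of residues in an interval inside the fundamental interval. -/
theorem le_card_interval {x η : ℝ} (hx : |x| + η ≤ 1 / 2) (hL1 : 1 ≤ η * L) :
    η ≤ (1 / (L : ℝ)) * ∑ a : ZMod L,
      (if |(a.valMinAbs : ℝ) / L - x| < η then (1 : ℝ) else 0) := by
  have hL := natCast_pos_of_neZero L
  rw [← Finset.sum_filter, Finset.sum_const, nsmul_eq_mul, mul_one]
  set T := Finset.univ.filter fun a : ZMod L => |(a.valMinAbs : ℝ) / L - x| < η
  have hmem : ∀ z ∈ Finset.Icc (⌊(x - η) * L⌋ + 1) (⌈(x + η) * L⌉ - 1),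
      ((z : ZMod L)).valMinAbs = z ∧ |(z : ℝ) / L - x| < η := by
    intro z hz
    rw [Finset.mem_Icc] at hz
    have h1 : (x - η) * L < z := Int.floor_lt.1 (by omega)
    have h2 : (z : ℝ) < (x + η) * L := Int.lt_ceil.1 (by omega)
    have h3 : (x + η) ≤ 1 / 2 := by linarith [le_abs_self x]
    have h4 : -(1 / 2) ≤ x - η := by linarith [neg_abs_le x]
    constructor
    · rw [ZMod.valMinAbs_spec]
      refine ⟨rfl, ?_, ?_⟩
      · have : -(L : ℝ) < z * 2 := by nlinarith
        exact_mod_cast this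
      · have : (z : ℝ) * 2 ≤ L := by nlinarith
        exact_mod_cast this
    · rw [abs_lt]
      constructor
      · rw [lt_sub_iff_add_lt, lt_div_iff₀ hL]; linarith
      · rw [sub_lt_iff_lt_add, div_lt_iff₀ hL]; linarith
  have h1 : (Finset.Icc (⌊(x - η) * L⌋ + 1) (⌈(x + η) * L⌉ - 1)).card ≤ T.card := by
    refine Finset.card_le_card_of_injOn (fun z => (z : ZMod L)) (fun z hz => ?_)
      fun z hz z' hz' h => ?_
    · have := hmem z hz
      simp only [T, Finset.coe_filter, Finset.mem_univ, true_and, Set.mem_ofPred_eq, this.1]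
      exact this.2
    · rw [← (hmem z hz).1, ← (hmem z' hz').1]
      exact congrArg _ h
  -- An open interval of length `2 η L` contains at least `2 η L - 1` integers, and this is at least
  -- `η L` because `1 ≤ η L`.
  have h2 : 2 * η * L - 1 ≤ (T.card : ℝ) := by
    refine le_trans ?_ (Nat.cast_le.2 h1)
    rw [Int.card_Icc]
    have h3 : ((⌈(x + η) * L⌉ - 1 + 1 - (⌊(x - η) * L⌋ + 1) : ℤ) : ℝ) ≤
        (((⌈(x + η) * L⌉ - 1 + 1 - (⌊(x - η) * L⌋ + 1)).toNat : ℤ) : ℝ) :=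
      Int.cast_le.2 (Int.self_le_toNat _)
    have h4 := Int.le_ceil ((x + η) * L)
    have h5 := Int.floor_le ((x - η) * L)
    push_cast at h3 ⊢
    linarith
  rw [one_div_mul_eq_div, le_div_iff₀ hL]
  linarith

end Torus

/-! ### Riemann sums near the singularity at the origin -/

section Origin

variable {d : ℕ} {φ : EuclideanSpace ℝ (Fin d) → ℝ} {ψ : ℝ → ℝ}

theorem IsKacProfile.majorant_nonneg (hφ : IsKacProfile φ ψ) (hd : 1 ≤ d) {t : ℝ} (ht : 0 < t) :
    0 ≤ ψ t := by
  set x : EuclideanSpace ℝ (Fin d) := EuclideanSpace.single ⟨0, hd⟩ t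
  have hx : ‖x‖ = t := by rw [PiLp.norm_single, Real.norm_eq_abs, abs_of_pos ht]
  have hx0 : x ≠ 0 := fun h => by rw [h, norm_zero] at hx; exact ht.ne hx
  have := hφ.abs_le x hx0
  rw [hx] at this
  exact (abs_nonneg _).trans this

/-- Convexity stands in for monotonicity: on `[y, 1]` the majorant is at most the larger of its two
nonnegative end values. -/
theorem IsKacProfile.majorant_le_add (hφ : IsKacProfile φ ψ) (hd : 1 ≤ d) {y x : ℝ} (hy : 0 < y)
    (hyx : y ≤ x) (hx : x ≤ 1) : ψ x ≤ ψ y + ψ 1 := by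
  have h := hφ.majorant_convex.le_max_of_mem_Icc (x := y) (y := 1) hy
    (Set.mem_Ioi.2 zero_lt_one) (z := x) ⟨hyx, hx⟩
  have h1 := hφ.majorant_nonneg hd hy
  have h2 := hφ.majorant_nonneg hd zero_lt_one
  exact h.trans (max_le (by linarith) (by linarith))

/-- A small open cube around half of the position of a site. -/
def halfCell {L : ℕ} (r : Torus d L) : Set (EuclideanSpace ℝ (Fin d)) :=
  {y | ∀ k, |y k - scaledPos r k / 2| < 1 / (4 * d * L)}

theorem halfCell_eq {L : ℕ} (r : Torus d L) : halfCell r =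
    (WithLp.ofLp : EuclideanSpace ℝ (Fin d) → Fin d → ℝ) ⁻¹' (Set.univ.pi fun k =>
      Set.Ioo (scaledPos r k / 2 - 1 / (4 * d * L)) (scaledPos r k / 2 + 1 / (4 * d * L))) := by
  ext y
  simp only [halfCell, Set.mem_ofPred_eq, Set.mem_preimage, Set.mem_pi, Set.mem_univ,
    true_imp_iff, Set.mem_Ioo, abs_lt]
  refine forall_congr' fun k => ⟨fun h => ⟨?_, ?_⟩, fun h => ⟨?_, ?_⟩⟩ <;> linarith [h.1, h.2]

theorem measurableSet_halfCell {L : ℕ} (r : Torus d L) : MeasurableSet (halfCell r) := by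
  rw [halfCell_eq]
  exact (PiLp.volume_preserving_ofLp (Fin d)).measurable
    (MeasurableSet.univ_pi fun _ => measurableSet_Ioo)

theorem volume_halfCell {L : ℕ} (r : Torus d L) :
    volume.real (halfCell r) = (1 / (2 * d * L)) ^ d := by
  rw [Measure.real, halfCell_eq, (PiLp.volume_preserving_ofLp (Fin d)).measure_preimage
    (MeasurableSet.univ_pi fun _ => measurableSet_Ioo).nullMeasurableSet, Real.volume_pi_Ioo]
  have : ∀ k, scaledPos r k / 2 + 1 / (4 * d * L) - (scaledPos r k / 2 - 1 / (4 * d * L)) =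
      1 / (2 * (d : ℝ) * L) := fun k => by ring
  simp only [this, Finset.prod_const, Finset.card_univ, Fintype.card_fin]
  rw [← ENNReal.ofReal_pow (by positivity), ENNReal.toReal_ofReal (by positivity)]

theorem one_le_abs_valMinAbs {L : ℕ} {a : ZMod L} (h : a ≠ 0) : 1 ≤ |(a.valMinAbs : ℝ)| := by
  have h1 : a.valMinAbs ≠ 0 := fun h2 => h ((ZMod.valMinAbs_eq_zero a).1 h2)
  have := Int.one_le_abs h1
  exact_mod_cast this

variable {L : ℕ} [NeZero L]

theorem inv_le_norm_scaledPos {r : Torus d L} (hr : r ≠ 0) : 1 / (L : ℝ) ≤ ‖scaledPos r‖ := by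
  have hL := natCast_pos_of_neZero L
  obtain ⟨k, hk⟩ := Function.ne_iff.1 hr
  refine le_trans ?_ (abs_coord_le_norm _ k)
  rw [scaledPos_apply, abs_div, abs_of_pos hL]
  exact div_le_div_of_nonneg_right (one_le_abs_valMinAbs hk) hL.le

/-- The centre has norm at least `1 / (2L)` and the cell has radius at most `1 / (4L)`. So the cell
avoids the origin yet stays closer to it than the site does, where the value of `ψ` at the site can
be bounded by its values on the cell. -/
theorem norm_mem_halfCell (hd : 1 ≤ d) {r : Torus d L} (hr : r ≠ 0)
    {y : EuclideanSpace ℝ (Fin d)} (hy : y ∈ halfCell r) :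
    0 < ‖y‖ ∧ ‖y‖ ≤ ‖scaledPos r‖ := by
  have hL := natCast_pos_of_neZero L
  have hd' : (0 : ℝ) < d := by exact_mod_cast hd
  have h1 : ‖y - (1 / 2 : ℝ) • scaledPos r‖ ≤ d * (1 / (4 * d * L)) := by
    refine norm_le_card_mul fun k => ?_
    have := (hy k).le
    rwa [PiLp.sub_apply, PiLp.smul_apply, smul_eq_mul, one_div_mul_eq_div]
  have h2 : (d : ℝ) * (1 / (4 * d * L)) = 1 / 4 * (1 / L) := by field_simp
  have h3 := inv_le_norm_scaledPos hr
  have h4 : ‖(1 / 2 : ℝ) • scaledPos r‖ = 1 / 2 * ‖scaledPos r‖ := by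
    rw [norm_smul, Real.norm_eq_abs, abs_of_pos (by norm_num)]
  have h5 := norm_sub_norm_le ((1 / 2 : ℝ) • scaledPos r) y
  rw [norm_sub_rev] at h5
  have h6 := norm_sub_norm_le y ((1 / 2 : ℝ) • scaledPos r)
  have h7 : 0 < 1 / (L : ℝ) := by positivity
  constructor <;> linarith

/-- Distinct sites differ by at least `1 / L` in some coordinate, hence the centres by `1 / (2L)`,
while the open cells have side `1 / (2 d L)`. -/
theorem disjoint_halfCell (hd : 1 ≤ d) {r r' : Torus d L} (h : r ≠ r') :
    Disjoint (halfCell r) (halfCell r') := by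
  have hL := natCast_pos_of_neZero L
  have hd' : (1 : ℝ) ≤ d := by exact_mod_cast hd
  refine Set.disjoint_left.2 fun y hy hy' => ?_
  obtain ⟨k, hk⟩ := Function.ne_iff.1 h
  have h1 : (r k).valMinAbs ≠ (r' k).valMinAbs := fun h2 => hk (ZMod.injective_valMinAbs h2)
  have h2 : 1 ≤ |((r k).valMinAbs : ℝ) - (r' k).valMinAbs| := by
    have := Int.one_le_abs (sub_ne_zero.2 h1)
    exact_mod_cast this
  have h3 : 1 / (L : ℝ) ≤ |scaledPos r k - scaledPos r' k| := by
    rw [scaledPos_apply, scaledPos_apply, ← sub_div, abs_div, abs_of_pos hL]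
    exact div_le_div_of_nonneg_right h2 hL.le
  have h4 := abs_lt.1 (hy k)
  have h5 := abs_lt.1 (hy' k)
  have h6 : 1 / (4 * d * L) ≤ 1 / 4 * (1 / (L : ℝ)) := by
    rw [div_mul_div_comm, one_mul]
    refine one_div_le_one_div_of_le (by positivity) ?_
    nlinarith
  have h7 : |scaledPos r k - scaledPos r' k| < 1 / L := by
    rw [abs_lt]
    constructor <;> linarith [h4.1, h4.2, h5.1, h5.2]
  linarith

/-- The Riemann sums of the majorant near the origin are controlled by its integral. -/
theorem sum_majorant_le_integral (hφ : IsKacProfile φ ψ) (hd : 1 ≤ d) {ρ : ℝ} (hρ1 : ρ ≤ 1) :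
    ∑ r ∈ Finset.univ.filter (fun r : Torus d L => r ≠ 0 ∧ ‖scaledPos r‖ < ρ),
      (1 / (L : ℝ)) ^ d * ψ ‖scaledPos r‖ ≤
      (2 * d) ^ d * ∫ y in Metric.ball (0 : EuclideanSpace ℝ (Fin d)) ρ, (|ψ ‖y‖| + |ψ 1|) := by
  have hL := natCast_pos_of_neZero L
  have hd' : (0 : ℝ) < d := by exact_mod_cast hd
  set T := Finset.univ.filter fun r : Torus d L => r ≠ 0 ∧ ‖scaledPos r‖ < ρ with hT
  have hint : IntegrableOn (fun y : EuclideanSpace ℝ (Fin d) => |ψ ‖y‖| + |ψ 1|)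
      (Metric.ball 0 ρ) := by
    have h1 : IntegrableOn (fun y : EuclideanSpace ℝ (Fin d) => ψ ‖y‖) (Metric.ball 0 ρ) :=
      (hφ.majorant_integrable.integrableOn_isCompact (isCompact_closedBall 0 ρ)).mono_set
        Metric.ball_subset_closedBall
    exact h1.abs.add (integrableOn_const measure_ball_lt_top.ne)
  have hsub : ∀ r ∈ T, halfCell r ⊆ Metric.ball 0 ρ := fun r hr y hy => by
    have hr' := (Finset.mem_filter.1 hr).2
    rw [mem_ball_zero_iff]
    exact (norm_mem_halfCell hd hr'.1 hy).2.trans_lt hr'.2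
  -- The factor `(2d)^d` is the ratio of the lattice volume `L⁻ᵈ` to the volume `(2 d L)⁻ᵈ` of the
  -- cell.
  have hcell : ∀ r ∈ T, (1 / (L : ℝ)) ^ d * ψ ‖scaledPos r‖ ≤
      (2 * d) ^ d * ∫ y in halfCell r, (|ψ ‖y‖| + |ψ 1|) := by
    intro r hr
    have hr' := (Finset.mem_filter.1 hr).2
    have h1 : ∫ _y in halfCell r, ψ ‖scaledPos r‖ ≤ ∫ y in halfCell r, (|ψ ‖y‖| + |ψ 1|) := by
      refine setIntegral_mono_on (integrableOn_const ?_) (hint.mono_set (hsub r hr))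
        (measurableSet_halfCell r) fun y hy => ?_
      · exact ((measure_mono (hsub r hr)).trans_lt measure_ball_lt_top).ne
      · have h2 := norm_mem_halfCell hd hr'.1 hy
        exact (hφ.majorant_le_add hd h2.1 h2.2 (hr'.2.le.trans hρ1)).trans
          (add_le_add (le_abs_self _) (le_abs_self _))
    rw [setIntegral_const, volume_halfCell, smul_eq_mul] at h1
    have h3 := mul_le_mul_of_nonneg_left h1 (by positivity : (0 : ℝ) ≤ (2 * d) ^ d)
    rw [← mul_assoc, ← mul_pow] at h3
    have h4 : 2 * (d : ℝ) * (1 / (2 * d * L)) = 1 / L := by field_simp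
    rwa [h4] at h3
  refine (Finset.sum_le_sum hcell).trans ?_
  rw [← Finset.mul_sum, ← integral_biUnion_finset T (fun r _ => measurableSet_halfCell r)
    (fun r _ r' _ h => disjoint_halfCell hd h) fun r hr => hint.mono_set (hsub r hr)]
  refine mul_le_mul_of_nonneg_left ?_ (by positivity)
  refine setIntegral_mono_set hint (Eventually.of_forall fun y => ?_) (Eventually.of_forall ?_)
  · simp only [Pi.zero_apply]; positivity
  · exact Set.iUnion₂_subset hsub

/-- Absolute continuity of the integral, since the volume of small balls tends to zero. -/
theorem exists_integral_ball_lt {f : EuclideanSpace ℝ (Fin d) → ℝ} (hd : 1 ≤ d)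
    (hf : IntegrableOn f (Metric.ball 0 1)) {ε : ℝ} (hε : 0 < ε) :
    ∃ ρ, 0 < ρ ∧ ρ ≤ 1 ∧ ∫ y in Metric.ball 0 ρ, f y < ε := by
  have : Nontrivial (EuclideanSpace ℝ (Fin d)) := by
    have : Nonempty (Fin d) := ⟨⟨0, hd⟩⟩
    infer_instance
  have hvol : Tendsto (fun ρ : ℝ => volume.restrict (Metric.ball 0 1)
      (Metric.ball (0 : EuclideanSpace ℝ (Fin d)) ρ)) (𝓝[>] 0) (𝓝 0) := by
    have h1 : Tendsto (fun ρ : ℝ => ENNReal.ofReal (ρ ^ d) *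
        volume (Metric.ball (0 : EuclideanSpace ℝ (Fin d)) 1)) (𝓝[>] 0) (𝓝 0) := by
      have h2 : Tendsto (fun ρ : ℝ => ENNReal.ofReal (ρ ^ d)) (𝓝[>] 0) (𝓝 0) := by
        have h3 : Continuous fun ρ : ℝ => ENNReal.ofReal (ρ ^ d) :=
          ENNReal.continuous_ofReal.comp (continuous_pow d)
        have h4 := (h3.tendsto 0).mono_left (nhdsWithin_le_nhds (s := Set.Ioi 0))
        rwa [zero_pow (by omega), ENNReal.ofReal_zero] at h4
      have := ENNReal.Tendsto.mul_const h2
        (Or.inr (measure_ball_lt_top (μ := volume) (x := (0 : EuclideanSpace ℝ (Fin d)))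
          (r := 1)).ne)
      rwa [zero_mul] at this
    refine tendsto_of_tendsto_of_tendsto_of_le_of_le' tendsto_const_nhds h1
      (Eventually.of_forall fun _ => zero_le) ?_
    filter_upwards [self_mem_nhdsWithin] with ρ hρ
    refine (Measure.restrict_apply_le _ _).trans (le_of_eq ?_)
    rw [Measure.addHaar_ball _ _ (le_of_lt hρ), finrank_euclideanSpace_fin]
  have h := Integrable.tendsto_setIntegral_nhds_zero hf hvol
  have h1 : ∀ᶠ ρ : ℝ in 𝓝[>] 0, 0 < ρ ∧ ρ ≤ 1 ∧
      ∫ y in Metric.ball 0 ρ, f y ∂(volume.restrict (Metric.ball 0 1)) < ε := by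
    filter_upwards [self_mem_nhdsWithin, h.eventually (gt_mem_nhds hε),
      mem_nhdsWithin_of_mem_nhds (Iic_mem_nhds zero_lt_one)] with ρ h1 h2 h3
    exact ⟨h1, h3, h2⟩
  obtain ⟨ρ, h2, h3, h4⟩ := h1.exists
  refine ⟨ρ, h2, h3, ?_⟩
  rwa [Measure.restrict_restrict measurableSet_ball,
    Set.inter_eq_left.2 (Metric.ball_subset_ball h3)] at h4

/-- The Riemann sums of the profile near the origin are small. -/
theorem exists_sum_near_origin_le (hφ : IsKacProfile φ ψ) (hd : 1 ≤ d) {ε : ℝ} (hε : 0 < ε) :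
    ∃ ρ, 0 < ρ ∧ ∀ᶠ n : ℕ in atTop, ∑ r : Torus d (n + 1), (1 / ((n + 1 : ℕ) : ℝ)) ^ d *
      (if ‖scaledPos r‖ < ρ then φ (scaledPos r) else 0) ≤ ε := by
  have hint : IntegrableOn (fun y : EuclideanSpace ℝ (Fin d) => |ψ ‖y‖| + |ψ 1|)
      (Metric.ball 0 1) := by
    have h1 : IntegrableOn (fun y : EuclideanSpace ℝ (Fin d) => ψ ‖y‖) (Metric.ball 0 1) :=
      (hφ.majorant_integrable.integrableOn_isCompact (isCompact_closedBall 0 1)).mono_set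
        Metric.ball_subset_closedBall
    exact h1.abs.add (integrableOn_const measure_ball_lt_top.ne)
  have hd' : (0 : ℝ) < d := by exact_mod_cast hd
  obtain ⟨ρ, hρ0, hρ1, hρ⟩ := exists_integral_ball_lt hd hint
    (ε := ε / 2 / (2 * d) ^ d) (by positivity)
  refine ⟨ρ, hρ0, ?_⟩
  -- The site at the origin is not covered by the majorant; its arbitrary value `φ 0` carries the
  -- weight `L⁻ᵈ`, which vanishes in the limit because `d ≥ 1`.
  have hlim : Tendsto (fun n : ℕ => (1 / ((n + 1 : ℕ) : ℝ)) ^ d * φ 0) atTop (𝓝 0) := by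
    have h1 : Tendsto (fun n : ℕ => 1 / ((n + 1 : ℕ) : ℝ)) atTop (𝓝 0) := by
      simpa using tendsto_one_div_add_atTop_nhds_zero_nat (𝕜 := ℝ)
    have h2 := (h1.pow d).mul_const (φ 0)
    rwa [zero_pow (by omega), zero_mul] at h2
  filter_upwards [hlim.eventually (gt_mem_nhds (half_pos hε))] with n hn
  have h1 := sum_majorant_le_integral (L := n + 1) hφ hd hρ1
  have h2 : ∑ r : Torus d (n + 1), (1 / ((n + 1 : ℕ) : ℝ)) ^ d *
      (if ‖scaledPos r‖ < ρ then φ (scaledPos r) else 0) ≤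
      ∑ r : Torus d (n + 1), ((if r = 0 then (1 / ((n + 1 : ℕ) : ℝ)) ^ d * φ 0 else 0) +
        if r ≠ 0 ∧ ‖scaledPos r‖ < ρ then
          (1 / ((n + 1 : ℕ) : ℝ)) ^ d * ψ ‖scaledPos r‖ else 0) := by
    refine Finset.sum_le_sum fun r _ => ?_
    by_cases hr : r = 0
    · have h0 : scaledPos (0 : Torus d (n + 1)) = 0 := by
        ext k; rw [scaledPos_apply]; simp
      subst hr
      simp only [h0, norm_zero, if_pos hρ0, if_true, ne_eq, not_true_eq_false, false_and, if_false,
        add_zero, le_refl]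
    · rw [if_neg hr, zero_add]
      by_cases hr' : ‖scaledPos r‖ < ρ
      · rw [if_pos hr', if_pos ⟨hr, hr'⟩]
        refine mul_le_mul_of_nonneg_left ?_ (by positivity)
        refine (le_abs_self _).trans (hφ.abs_le _ fun h => ?_)
        have := inv_le_norm_scaledPos hr
        rw [h, norm_zero] at this
        exact absurd this (not_le.2 (by positivity))
      · rw [if_neg hr', if_neg fun h => hr' h.2, mul_zero]
  refine h2.trans ?_
  rw [Finset.sum_add_distrib, Finset.sum_ite_eq', if_pos (Finset.mem_univ _),
    ← Finset.sum_filter]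
  have h3 : (2 * (d : ℝ)) ^ d * ∫ y in Metric.ball (0 : EuclideanSpace ℝ (Fin d)) ρ,
      (|ψ ‖y‖| + |ψ 1|) ≤ ε / 2 := by
    have := mul_le_mul_of_nonneg_left hρ.le (by positivity : (0 : ℝ) ≤ (2 * d) ^ d)
    rwa [mul_div_cancel₀ _ (by positivity)] at this
  linarith

end Origin

/-! ### Nondegeneracy of the normalization and continuity of translations -/

section Kernel

variable {d : ℕ} {φ : EuclideanSpace ℝ (Fin d) → ℝ} {ψ : ℝ → ℝ}

theorem IsKacProfile.continuousAt (hφ : IsKacProfile φ ψ) {x : EuclideanSpace ℝ (Fin d)}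
    (hx : x ≠ 0) : ContinuousAt φ x :=
  (hφ.differentiableAt x hx).continuousAt

theorem tendsto_one_div_natCast_succ :
    Tendsto (fun n : ℕ => 1 / ((n + 1 : ℕ) : ℝ)) atTop (𝓝 0) := by
  simpa using tendsto_one_div_add_atTop_nhds_zero_nat (𝕜 := ℝ)

/-- The Riemann sums of a profile which does not vanish on the unit cube are bounded below. -/
theorem exists_le_riemannSum (hφ : IsKacProfile φ ψ)
    (hφ0 : ∃ x : EuclideanSpace ℝ (Fin d), x ≠ 0 ∧ (∀ k, |x k| ≤ 1 / 2) ∧ φ x ≠ 0) :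
    ∃ c₀, 0 < c₀ ∧ ∀ᶠ n : ℕ in atTop,
      c₀ ≤ ∑ r : Torus d (n + 1), (1 / ((n + 1 : ℕ) : ℝ)) ^ d * φ (scaledPos r) := by
  obtain ⟨x, hx0, hxk, hφx⟩ := hφ0
  -- The point `x` may lie on the boundary of the cube; by continuity it can be pulled slightly
  -- inside, so that a whole cube around it is available.
  obtain ⟨t, ht0, ht1, htφ⟩ : ∃ t : ℝ, 0 < t ∧ t < 1 ∧ φ (t • x) ≠ 0 := by
    have h1 : Tendsto (fun t : ℝ => t • x) (𝓝[<] 1) (𝓝 x) := by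
      have h2 : Continuous fun t : ℝ => t • x := by fun_prop
      have h3 := (h2.tendsto 1).mono_left (nhdsWithin_le_nhds (s := Set.Iio 1))
      rwa [one_smul] at h3
    have h2 := (hφ.continuousAt hx0).tendsto.comp h1
    have h3 : ∀ᶠ t : ℝ in 𝓝[<] 1, 0 < t ∧ t < 1 ∧ φ (t • x) ≠ 0 := by
      filter_upwards [self_mem_nhdsWithin, h2.eventually_ne hφx,
        mem_nhdsWithin_of_mem_nhds (Ioi_mem_nhds zero_lt_one)] with t h4 h5 h6
      exact ⟨h6, h4, h5⟩
    exact h3.exists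
  have hy0 : t • x ≠ 0 := smul_ne_zero ht0.ne' hx0
  have hφy : 0 < φ (t • x) := lt_of_le_of_ne (hφ.nonneg _) htφ.symm
  obtain ⟨e, he, hball⟩ := Metric.mem_nhds_iff.1
    ((hφ.continuousAt hy0).eventually (lt_mem_nhds (half_lt_self hφy)))
  -- The first bound keeps the cube of half-side `η` inside the ball where `φ` exceeds half of its
  -- value at the centre, the second keeps it inside the unit cube.
  set η := min (e / (d + 1)) ((1 - t) / 2) with hη
  have hη0 : 0 < η := lt_min (by positivity) (by linarith)
  have hcube : ∀ k, |(t • x) k| + η ≤ 1 / 2 := by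
    intro k
    rw [PiLp.smul_apply, smul_eq_mul, abs_mul, abs_of_pos ht0]
    have := mul_le_mul_of_nonneg_left (hxk k) ht0.le
    linarith [min_le_right (e / (d + 1)) ((1 - t) / 2)]
  refine ⟨φ (t • x) / 2 * η ^ d, by positivity, ?_⟩
  filter_upwards [tendsto_one_div_natCast_succ.eventually (gt_mem_nhds hη0)] with n hn
  have hL : (0 : ℝ) < ((n + 1 : ℕ) : ℝ) := by positivity
  have hηL : 1 ≤ η * ((n + 1 : ℕ) : ℝ) := by
    rw [div_lt_iff₀ hL] at hn
    exact hn.le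
  have h1 : η ^ d ≤ ∑ r : Torus d (n + 1), (1 / ((n + 1 : ℕ) : ℝ)) ^ d * ∏ k,
      (if |((r k).valMinAbs : ℝ) / ((n + 1 : ℕ) : ℝ) - (t • x) k| < η then (1 : ℝ) else 0) := by
    rw [sum_torus_prod fun k a =>
      if |((a.valMinAbs : ℤ) : ℝ) / ((n + 1 : ℕ) : ℝ) - (t • x) k| < η then (1 : ℝ) else 0]
    have h2 : η ^ d = ∏ _k : Fin d, η := by simp
    rw [h2]
    exact Finset.prod_le_prod (fun _ _ => hη0.le) fun k _ => le_card_interval (hcube k) hηL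
  have h2 := mul_le_mul_of_nonneg_left h1 (half_pos hφy).le
  refine h2.trans ?_
  rw [Finset.mul_sum]
  refine Finset.sum_le_sum fun r _ => ?_
  rw [mul_left_comm]
  refine mul_le_mul_of_nonneg_left ?_ (by positivity)
  by_cases h : ∀ k, |((r k).valMinAbs : ℝ) / ((n + 1 : ℕ) : ℝ) - (t • x) k| < η
  · rw [Finset.prod_congr rfl fun k _ => if_pos (h k), Finset.prod_const_one, mul_one]
    refine (hball ?_).le
    rw [mem_ball_iff_norm]
    have h3 : ‖scaledPos r - t • x‖ ≤ d * η := norm_le_card_mul fun k => by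
      rw [PiLp.sub_apply, scaledPos_apply]
      exact (h k).le
    have h4 : (d + 1) * η ≤ e := by
      have := min_le_left (e / (d + 1)) ((1 - t) / 2)
      rw [← hη, le_div_iff₀ (by positivity)] at this
      linarith
    linarith
  · push Not at h
    obtain ⟨k, hk⟩ := h
    rw [Finset.prod_eq_zero (Finset.mem_univ k) (if_neg (not_lt.2 hk)), mul_zero]
    exact hφ.nonneg _

theorem norm_scaledPos_le {L : ℕ} [NeZero L] (r : Torus d L) : ‖scaledPos r‖ ≤ d := by
  have := norm_le_card_mul (abs_scaledPos_le r)
  have hd : (0 : ℝ) ≤ d := Nat.cast_nonneg d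
  linarith

theorem isCompact_annulus (a b : ℝ) :
    IsCompact {x : EuclideanSpace ℝ (Fin d) | a ≤ ‖x‖ ∧ ‖x‖ ≤ b} := by
  refine (isCompact_closedBall (0 : EuclideanSpace ℝ (Fin d)) b).of_isClosed_subset ?_ ?_
  · exact (isClosed_le continuous_const continuous_norm).inter
      (isClosed_le continuous_norm continuous_const)
  · exact fun x hx => mem_closedBall_zero_iff.2 hx.2

theorem IsKacProfile.continuousOn_annulus (hφ : IsKacProfile φ ψ) {a : ℝ} (ha : 0 < a) (b : ℝ) :
    ContinuousOn φ {x | a ≤ ‖x‖ ∧ ‖x‖ ≤ b} := fun x hx =>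
  (hφ.continuousAt fun h => by
    have h1 := hx.1
    rw [h, norm_zero] at h1
    exact absurd h1 (not_le.2 ha)).continuousWithinAt

/-- An upper bound of the profile at the sites close to the origin or to the boundary of the
fundamental cube. -/
def badPart (φ : EuclideanSpace ℝ (Fin d) → ℝ) (ρ B : ℝ) {L : ℕ} (r : Torus d L) : ℝ :=
  (if ‖scaledPos r‖ < ρ then φ (scaledPos r) else 0) +
    ∑ k, B * if 1 / 2 - ρ < |((r k).valMinAbs : ℝ) / L| then (1 : ℝ) else 0

theorem badPart_nonneg (hφ : IsKacProfile φ ψ) {ρ B : ℝ} (hB : 0 ≤ B) {L : ℕ} (r : Torus d L) :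
    0 ≤ badPart φ ρ B r := by
  refine add_nonneg ?_ (Finset.sum_nonneg fun k _ => mul_nonneg hB ?_)
  · split_ifs
    · exact hφ.nonneg _
    · exact le_rfl
  · split_ifs <;> norm_num

/-- A bad site outside the `ρ`-ball has a coordinate beyond `1/2 - ρ ≥ 1/4`, hence norm at least
`1/4`, where `φ` is bounded by `B`. -/
theorem le_badPart {ρ B : ℝ} (hρ : ρ ≤ 1 / 4) (hB : 0 ≤ B)
    (hφB : ∀ x, 1 / 4 ≤ ‖x‖ → ‖x‖ ≤ d → φ x ≤ B) {L : ℕ} [NeZero L] {r : Torus d L}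
    (hr : ¬(ρ ≤ ‖scaledPos r‖ ∧ ∀ k, |scaledPos r k| ≤ 1 / 2 - ρ)) :
    φ (scaledPos r) ≤ badPart φ ρ B r := by
  have h0 : ∀ k, 0 ≤ B * if 1 / 2 - ρ < |((r k).valMinAbs : ℝ) / L| then (1 : ℝ) else 0 :=
    fun k => mul_nonneg hB (by split_ifs <;> norm_num)
  rw [badPart]
  by_cases h : ‖scaledPos r‖ < ρ
  · rw [if_pos h]
    exact le_add_of_nonneg_right (Finset.sum_nonneg fun k _ => h0 k)
  · rw [if_neg h, zero_add]
    have h1 : ∃ k, 1 / 2 - ρ < |scaledPos r k| := by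
      by_contra! h2
      exact hr ⟨not_lt.1 h, h2⟩
    obtain ⟨k, hk⟩ := h1
    have h2 := abs_coord_le_norm (scaledPos r) k
    refine (hφB _ (by linarith) (norm_scaledPos_le r)).trans ?_
    refine le_trans ?_ (Finset.single_le_sum (fun k _ => h0 k) (Finset.mem_univ k))
    rw [scaledPos_apply] at hk
    rw [if_pos hk, mul_one]

theorem sum_badPart_le {ρ B : ℝ} (hρ : 0 ≤ ρ) (hB : 0 ≤ B) {L : ℕ} [NeZero L] :
    ∑ r : Torus d L, (1 / (L : ℝ)) ^ d * badPart φ ρ B r ≤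
      ∑ r : Torus d L, (1 / (L : ℝ)) ^ d * (if ‖scaledPos r‖ < ρ then φ (scaledPos r) else 0) +
        d * (B * (2 * ρ + 2 / L)) := by
  simp only [badPart, mul_add, Finset.sum_add_distrib, Finset.mul_sum]
  refine add_le_add le_rfl ?_
  rw [Finset.sum_comm]
  refine (Finset.sum_le_card_nsmul _ _ (B * (2 * ρ + 2 / L)) fun k _ => ?_).trans ?_
  · rw [sum_torus_coord k fun a : ZMod L =>
      B * if 1 / 2 - ρ < |((a.valMinAbs : ℤ) : ℝ) / L| then (1 : ℝ) else 0, ← Finset.mul_sum,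
      mul_left_comm]
    exact mul_le_mul_of_nonneg_left (card_boundary_le hρ) hB
  · simp [mul_add]

theorem scaledPos_neg_le {L : ℕ} {s : Torus d L} {δ : ℝ} (h : ∀ k, |scaledPos s k| ≤ δ)
    (k : Fin d) : |scaledPos (-s) k| ≤ δ := by
  have := h k
  rw [scaledPos_apply, abs_div] at this ⊢
  rwa [Pi.neg_apply, abs_valMinAbs_neg]

/-- The Riemann sums of the profile vary slowly under translations of the hypercube. -/
theorem exists_sum_abs_sub_translate_le (hφ : IsKacProfile φ ψ) (hd : 1 ≤ d) {ε : ℝ}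
    (hε : 0 < ε) : ∃ δ, 0 < δ ∧ ∀ᶠ n : ℕ in atTop, ∀ s : Torus d (n + 1),
      (∀ k, |scaledPos s k| ≤ δ) → ∑ r : Torus d (n + 1), (1 / ((n + 1 : ℕ) : ℝ)) ^ d *
        |φ (scaledPos r) - φ (scaledPos (r + s))| ≤ ε := by
  have hd' : (1 : ℝ) ≤ d := by exact_mod_cast hd
  obtain ⟨B, hB0, hφB⟩ : ∃ B, 0 ≤ B ∧
      ∀ x : EuclideanSpace ℝ (Fin d), 1 / 4 ≤ ‖x‖ → ‖x‖ ≤ d → φ x ≤ B := by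
    obtain ⟨B, hB⟩ := (isCompact_annulus (1 / 4) (d : ℝ)).bddAbove_image
      (hφ.continuousOn_annulus (by norm_num) (d : ℝ))
    exact ⟨max B 0, le_max_right _ _, fun x h1 h2 =>
      (hB ⟨x, ⟨h1, h2⟩, rfl⟩).trans (le_max_left _ _)⟩
  obtain ⟨ρ₀, hρ₀, hnear⟩ := exists_sum_near_origin_le hφ hd (ε := ε / 8) (by positivity)
  -- Budget: the bad sites cost `ε/8` near the origin and `ε/16 + ε/16` near the boundary, so at
  -- most `ε/4`. They are counted for `r` and for `r + s`, and the good sites add `ε/2`.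
  set ρ := min ρ₀ (min (1 / 4) (ε / (32 * (B * d + 1)))) with hρdef
  have hρ : 0 < ρ := lt_min hρ₀ (lt_min (by norm_num) (by positivity))
  have hρ1 : ρ ≤ ρ₀ := min_le_left _ _
  have hρ2 : ρ ≤ 1 / 4 := (min_le_right _ _).trans (min_le_left _ _)
  have hρ3 : B * d * ρ ≤ ε / 32 := by
    have h1 : ρ ≤ ε / (32 * (B * d + 1)) := (min_le_right _ _).trans (min_le_right _ _)
    rw [le_div_iff₀ (by positivity)] at h1
    nlinarith
  -- The inner radius is `ρ / 2` because a translation by at most `d δ ≤ ρ / 2` may bring a good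
  -- site closer to the origin.
  obtain ⟨δ₁, hδ₁, hunif⟩ := Metric.uniformContinuousOn_iff.1
    ((isCompact_annulus (ρ / 2) (d : ℝ)).uniformContinuousOn_of_continuous
      (hφ.continuousOn_annulus (half_pos hρ) (d : ℝ))) (ε / 2) (half_pos hε)
  set δ := min (δ₁ / 2) (ρ / 2) / d with hδdef
  have hδ : 0 < δ := div_pos (lt_min (half_pos hδ₁) (half_pos hρ)) (by linarith)
  have hdδ : d * δ = min (δ₁ / 2) (ρ / 2) := mul_div_cancel₀ _ (by linarith)
  have hdδ1 : d * δ < δ₁ := by linarith [min_le_left (δ₁ / 2) (ρ / 2)]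
  have hdδ2 : d * δ ≤ ρ / 2 := by linarith [min_le_right (δ₁ / 2) (ρ / 2)]
  have hδρ : δ < ρ := by nlinarith
  refine ⟨δ, hδ, ?_⟩
  filter_upwards [hnear, tendsto_one_div_natCast_succ.eventually
    (gt_mem_nhds (show 0 < ε / (32 * (B * d + 1)) by positivity))] with n hn hn2 s hs
  have hstep : ∀ {r s' : Torus d (n + 1)}, (ρ ≤ ‖scaledPos r‖ ∧ ∀ k, |scaledPos r k| ≤ 1 / 2 - ρ) →
      (∀ k, |scaledPos s' k| ≤ δ) → |φ (scaledPos r) - φ (scaledPos (r + s'))| ≤ ε / 2 := by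
    intro r s' hr hs'
    have h1 := norm_scaledPos_add_sub_le hδρ hr.2 hs'
    have h2 := norm_sub_norm_le (scaledPos r) (scaledPos (r + s'))
    rw [norm_sub_rev] at h2
    have h3 := hunif (scaledPos r) ⟨by linarith [hr.1], norm_scaledPos_le r⟩
      (scaledPos (r + s')) ⟨by linarith [hr.1], norm_scaledPos_le _⟩
      (by rw [dist_comm, dist_eq_norm]; linarith)
    rw [Real.dist_eq] at h3
    exact h3.le
  have hpt : ∀ r : Torus d (n + 1), |φ (scaledPos r) - φ (scaledPos (r + s))| ≤
      ε / 2 + (badPart φ ρ B r + badPart φ ρ B (r + s)) := by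
    intro r
    have hb1 := badPart_nonneg hφ hB0 (ρ := ρ) r
    have hb2 := badPart_nonneg hφ hB0 (ρ := ρ) (r + s)
    by_cases h1 : ρ ≤ ‖scaledPos r‖ ∧ ∀ k, |scaledPos r k| ≤ 1 / 2 - ρ
    · linarith [hstep h1 hs]
    -- If only the translated site is good, the same estimate applies to the translation by `-s`.
    by_cases h2 : ρ ≤ ‖scaledPos (r + s)‖ ∧ ∀ k, |scaledPos (r + s) k| ≤ 1 / 2 - ρ
    · have h3 := hstep h2 (scaledPos_neg_le hs)
      rw [add_neg_cancel_right, abs_sub_comm] at h3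
      linarith
    · have h3 := le_badPart hρ2 hB0 hφB h1
      have h4 := le_badPart hρ2 hB0 hφB h2
      have h5 := hφ.nonneg (scaledPos r)
      have h6 := hφ.nonneg (scaledPos (r + s))
      rw [abs_le]
      constructor <;> linarith
  have hbad : ∑ r : Torus d (n + 1), (1 / ((n + 1 : ℕ) : ℝ)) ^ d * badPart φ ρ B r ≤ ε / 4 := by
    refine (sum_badPart_le hρ.le hB0).trans ?_
    have h1 : ∑ r : Torus d (n + 1), (1 / ((n + 1 : ℕ) : ℝ)) ^ d *
        (if ‖scaledPos r‖ < ρ then φ (scaledPos r) else 0) ≤ ε / 8 := by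
      refine le_trans (Finset.sum_le_sum fun r _ => mul_le_mul_of_nonneg_left ?_ ?_) hn
      · by_cases h : ‖scaledPos r‖ < ρ
        · rw [if_pos h, if_pos (h.trans_le hρ1)]
        · rw [if_neg h]
          split_ifs
          · exact hφ.nonneg _
          · exact le_rfl
      · positivity
    have h2 : B * d * (1 / ((n + 1 : ℕ) : ℝ)) ≤ ε / 32 := by
      have h3 := hn2.le
      rw [le_div_iff₀ (by positivity)] at h3
      have h4 : 0 < 1 / ((n + 1 : ℕ) : ℝ) := by positivity
      nlinarith
    have h3 : d * (B * (2 * ρ + 2 / ((n + 1 : ℕ) : ℝ))) =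
        2 * (B * d * ρ) + 2 * (B * d * (1 / ((n + 1 : ℕ) : ℝ))) := by ring
    rw [h3]
    linarith
  refine (Finset.sum_le_sum fun r _ =>
    mul_le_mul_of_nonneg_left (hpt r) (by positivity)).trans ?_
  have hshift : ∑ r : Torus d (n + 1), (1 / ((n + 1 : ℕ) : ℝ)) ^ d * badPart φ ρ B (r + s) =
      ∑ r : Torus d (n + 1), (1 / ((n + 1 : ℕ) : ℝ)) ^ d * badPart φ ρ B r :=
    Equiv.sum_comp (Equiv.addRight s) fun r => (1 / ((n + 1 : ℕ) : ℝ)) ^ d * badPart φ ρ B r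
  simp only [mul_add, Finset.sum_add_distrib]
  rw [hshift, ← Finset.sum_mul, sum_torus_one]
  linarith

end Kernel

/-! ### The Kac entropy and its limit -/

section FreeEnergy

variable {d : ℕ} {φ : EuclideanSpace ℝ (Fin d) → ℝ} {ψ : ℝ → ℝ}

/-- The normalization of the Kac potential at `γ = 1 / L`. -/
def kacNorm (φ : EuclideanSpace ℝ (Fin d) → ℝ) (L : ℕ) [NeZero L] : ℝ :=
  ∑ r : Torus d L, (1 / (L : ℝ)) ^ d * φ (scaledPos r)

/-- The Kac potential at `γ = 1 / L`, as a function of the relative position. -/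
def kacWeight (φ : EuclideanSpace ℝ (Fin d) → ℝ) {L : ℕ} [NeZero L] (r : Torus d L) : ℝ :=
  (1 / (L : ℝ)) ^ d * φ (scaledPos r) / kacNorm φ L

theorem kacPotential_eq_kacWeight {L : ℕ} [NeZero L] (r : Torus d L) :
    kacPotential L φ (1 / (L : ℝ)) (position r) = kacWeight φ r := rfl

theorem kacWeight_nonneg (hφ : ∀ x, 0 ≤ φ x) {L : ℕ} [NeZero L] (r : Torus d L) :
    0 ≤ kacWeight φ r :=
  div_nonneg (mul_nonneg (by positivity) (hφ _))
    (Finset.sum_nonneg fun r _ => mul_nonneg (by positivity) (hφ _))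

theorem sum_kacWeight {L : ℕ} [NeZero L] (hD : 0 < kacNorm φ L) :
    ∑ r : Torus d L, kacWeight φ r = 1 := by
  simp only [kacWeight]
  rw [← Finset.sum_div]
  exact div_self hD.ne'

theorem sum_kacWeight_row {L : ℕ} [NeZero L] (hD : 0 < kacNorm φ L) (i : Torus d L) :
    ∑ j, kacWeight φ (i - j) = 1 := by
  rw [← sum_kacWeight hD]
  exact Equiv.sum_comp (Equiv.subLeft i) fun r => kacWeight φ r

theorem sum_kacWeight_col {L : ℕ} [NeZero L] (hD : 0 < kacNorm φ L) (j : Torus d L) :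
    ∑ i, kacWeight φ (i - j) = 1 := by
  rw [← sum_kacWeight hD]
  exact Equiv.sum_comp (Equiv.subRight j) fun r => kacWeight φ r

theorem sum_abs_kacWeight_sub_le {L : ℕ} [NeZero L] {c₀ ε : ℝ} (hc₀ : 0 < c₀) (hε : 0 ≤ ε)
    (hD : c₀ ≤ kacNorm φ L) {s : Torus d L}
    (h : ∑ r : Torus d L, (1 / (L : ℝ)) ^ d * |φ (scaledPos r) - φ (scaledPos (r + s))| ≤ ε * c₀) :
    ∑ r, |kacWeight φ r - kacWeight φ (r + s)| ≤ ε := by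
  have hD0 := hc₀.trans_le hD
  have h1 : ∀ r, |kacWeight φ r - kacWeight φ (r + s)| =
      (1 / (L : ℝ)) ^ d * |φ (scaledPos r) - φ (scaledPos (r + s))| / kacNorm φ L := by
    intro r
    rw [kacWeight, kacWeight, ← sub_div, ← mul_sub, abs_div, abs_mul, abs_of_pos hD0,
      abs_of_nonneg (by positivity : (0 : ℝ) ≤ (1 / (L : ℝ)) ^ d)]
  simp only [h1]
  rw [← Finset.sum_div, div_le_iff₀ hD0]
  exact h.trans (mul_le_mul_of_nonneg_left hD hε)

/-- The partition of the hypercube into `M ^ d` cubes. -/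
def cubeIndex (M : ℕ) [NeZero M] {L : ℕ} [NeZero L] (i : Torus d L) : Fin d → Fin M := fun k =>
  ⟨(i k).val * M / L, by
    rw [Nat.div_lt_iff_lt_mul (NeZero.pos L), mul_comm M L]
    exact Nat.mul_lt_mul_of_pos_right (ZMod.val_lt (i k)) (NeZero.pos M)⟩

/-- Equal integer quotients place the two representatives within `L / M` of each other, and the
representative of least absolute value of their difference can only be smaller. -/
theorem abs_scaledPos_sub_le_of_cubeIndex_eq {M : ℕ} [NeZero M] {L : ℕ} [NeZero L]
    {i j : Torus d L} (h : cubeIndex M i = cubeIndex M j) (k : Fin d) :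
    |scaledPos (i - j) k| ≤ 1 / M := by
  have hL := natCast_pos_of_neZero L
  have hM := natCast_pos_of_neZero M
  have h1 : (i k).val * M / L = (j k).val * M / L := congrArg Fin.val (congrFun h k)
  have h2 : ((i - j) k).valMinAbs.natAbs ≤ (((i k).val : ℤ) - (j k).val).natAbs :=
    ZMod.natAbs_min_of_le_div_two L _ _ (by simp) (ZMod.natAbs_valMinAbs_le _)
  have h3 : |(((i - j) k).valMinAbs : ℝ)| ≤ |((i k).val : ℝ) - (j k).val| := by
    have h4 : |((i - j) k).valMinAbs| ≤ |((i k).val : ℤ) - (j k).val| := by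
      rw [Int.abs_eq_natAbs, Int.abs_eq_natAbs]
      exact_mod_cast h2
    exact_mod_cast h4
  have h5 : ∀ a b : ℕ, a * M / L = b * M / L → ((a : ℝ) - b) * M ≤ L := by
    intro a b hab
    have h6 := Nat.div_mul_le_self (b * M) L
    have h7 := Nat.lt_div_mul_add (a := a * M) (NeZero.pos L)
    rw [hab] at h7
    have h8 : a * M ≤ b * M + L := by omega
    have h9 : (a : ℝ) * M ≤ b * M + L := by exact_mod_cast h8
    linarith
  rw [scaledPos_apply, abs_div, abs_of_pos hL, div_le_div_iff₀ hL hM, one_mul]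
  refine (mul_le_mul_of_nonneg_right h3 hM.le).trans ?_
  rcases abs_cases (((i k).val : ℝ) - (j k).val) with h6 | h6
  · rw [h6.1]
    exact h5 _ _ h1
  · rw [h6.1, neg_sub]
    exact h5 _ _ h1.symm

/-- The entropy of the model with Kac potential at `γ = 1 / L`. -/
def kacEntropy (φ : EuclideanSpace ℝ (Fin d) → ℝ) (c : ℝ) (L : ℕ) [NeZero L] : ℝ :=
  pairEntropy fun e : Torus d L × Torus d L => c * kacWeight φ (e.1 - e.2)

theorem sum_kacWeight_pairs {L : ℕ} [NeZero L] (hD : 0 < kacNorm φ L) (c : ℝ) :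
    ∑ e : Torus d L × Torus d L, c * kacWeight φ (e.1 - e.2) =
      c * Fintype.card (Torus d L) := by
  rw [← Finset.mul_sum, Fintype.sum_prod_type]
  simp only [sum_kacWeight_row hD, Finset.sum_const, Finset.card_univ, nsmul_eq_mul, mul_one]

theorem sq_mul_kacCoeff (hφ : ∀ x, 0 ≤ φ x) {L : ℕ} [NeZero L] (β : ℝ) (i j : Torus d L) :
    (β * kacCoeff L φ (1 / (L : ℝ)) i j) ^ 2 = β ^ 2 / 2 * kacWeight φ (i - j) := by
  rw [kacCoeff, kacPotential_eq_kacWeight, mul_pow,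
    Real.sq_sqrt (div_nonneg (kacWeight_nonneg hφ _) two_pos.le)]
  ring

/-- The rows of the normalized potential sum to one, so the explicit term `(∑ l) / 2` is exactly `β²
/ 4` per site. -/
theorem kacFreeEnergy_eq (hφ : ∀ x, 0 ≤ φ x) {L : ℕ} [NeZero L] {β : ℝ} (hβ : 0 < β)
    (hD : 0 < kacNorm φ L) : kacFreeEnergy L φ (1 / (L : ℝ)) β =
      -(1 / β) * (β ^ 2 / 4 + kacEntropy φ (β ^ 2 / 2) L / Fintype.card (Torus d L)) := by
  have hN : (0 : ℝ) < Fintype.card (Torus d L) := by exact_mod_cast Fintype.card_pos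
  rw [kacFreeEnergy, quenchedFreeEnergy, integral_log_partitionFunction_nishimori hβ.le
    (a := kacCoeff L φ (1 / (L : ℝ))) fun i j => Real.sqrt_nonneg _]
  simp only [sq_mul_kacCoeff hφ, sum_kacWeight_pairs hD]
  rw [← kacEntropy]
  field_simp
  ring

/-- The constant absorbs the finitely many small sizes, so the bound also serves small or empty
blocks. -/
theorem meanFieldEntropy_le_linear {c p ε : ℝ} (hc : 0 ≤ c)
    (hp : Tendsto (fun n : ℕ => meanFieldEntropy c n / n) atTop (𝓝 p)) (hε : 0 < ε) :
    ∃ C, ∀ n : ℕ, meanFieldEntropy c n ≤ n * (p + ε) + C := by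
  have hp0 : 0 ≤ p := ge_of_tendsto' hp fun n =>
    div_nonneg (meanFieldEntropy_nonneg hc n) (Nat.cast_nonneg n)
  obtain ⟨n₀, hn₀⟩ := eventually_atTop.1 (hp.eventually (gt_mem_nhds (lt_add_of_pos_right p hε)))
  refine ⟨∑ m ∈ Finset.range (n₀ + 1), meanFieldEntropy c m, fun n => ?_⟩
  rcases lt_or_ge n (n₀ + 1) with h | h
  · have h1 := Finset.single_le_sum (fun m _ => meanFieldEntropy_nonneg hc m) (Finset.mem_range.2 h)
    have h2 : 0 ≤ (n : ℝ) * (p + ε) := by positivity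
    linarith
  · have h1 := hn₀ n (by omega)
    have h2 : (0 : ℝ) < n := by exact_mod_cast (by omega : 0 < n)
    rw [div_lt_iff₀ h2] at h1
    have h3 := Finset.sum_nonneg fun m (_ : m ∈ Finset.range (n₀ + 1)) =>
      meanFieldEntropy_nonneg hc m
    linarith

theorem sum_blockCard {ι κ : Type*} [Fintype ι] [DecidableEq κ] [Fintype κ] (f : ι → κ) :
    ∑ a, (blockCard f a : ℝ) = Fintype.card ι := by
  have h := sum_fibers f fun _ => (1 : ℝ)
  simp only [Finset.sum_const, Finset.card_univ, nsmul_eq_mul, mul_one] at h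
  exact h.symm

theorem tendsto_card_torus (hd : 1 ≤ d) :
    Tendsto (fun n : ℕ => Fintype.card (Torus d (n + 1))) atTop atTop := by
  refine tendsto_atTop_mono (fun n => ?_) tendsto_id
  have h : Fintype.card (Torus d (n + 1)) = (n + 1) ^ d := by simp [ZMod.card]
  rw [h]
  exact (Nat.le_succ n).trans (Nat.le_self_pow (by omega) _)

/-- A slowly varying Kac potential gives at most the entropy of the mean-field model. -/
theorem eventually_kacEntropy_le (hφ : IsKacProfile φ ψ) (hd : 1 ≤ d)
    (hφ0 : ∃ x : EuclideanSpace ℝ (Fin d), x ≠ 0 ∧ (∀ k, |x k| ≤ 1 / 2) ∧ φ x ≠ 0)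
    {c p ε : ℝ} (hc : 0 ≤ c)
    (hp : Tendsto (fun n : ℕ => meanFieldEntropy c n / n) atTop (𝓝 p)) (hε : 0 < ε) :
    ∀ᶠ n : ℕ in atTop,
      kacEntropy φ c (n + 1) / Fintype.card (Torus d (n + 1)) ≤ p + ε := by
  obtain ⟨c₀, hc₀, hnorm⟩ := exists_le_riemannSum hφ hφ0
  -- One third of `ε` pays for the variation of the couplings inside a cube, one for the linear
  -- bound on the mean-field entropy, one for the additive constants of the cubes.
  set ε' := ε / (3 * (c + 1)) with hε'
  have hε'0 : 0 < ε' := by positivity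
  have hcε : c * ε' ≤ ε / 3 := by
    have : (c + 1) * ε' = ε / 3 := by rw [hε']; field_simp
    linarith
  obtain ⟨δ, hδ, htrans⟩ := exists_sum_abs_sub_translate_le hφ hd (mul_pos hε'0 hc₀)
  -- The mesh of the partition is fixed before `L` grows, so the total constant `(m + 1)^d * C` is
  -- negligible per site.
  obtain ⟨m, hm⟩ := exists_nat_one_div_lt hδ
  have hm' : 1 / ((m + 1 : ℕ) : ℝ) ≤ δ := by push_cast; exact hm.le
  obtain ⟨C, hC⟩ := meanFieldEntropy_le_linear hc hp (ε := ε / 3) (by positivity)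
  have hlim : Tendsto (fun n : ℕ => ((m + 1) ^ d : ℝ) * C / Fintype.card (Torus d (n + 1)))
      atTop (𝓝 0) :=
    (tendsto_const_div_atTop_nhds_zero_nat (((m + 1) ^ d : ℝ) * C)).comp (tendsto_card_torus hd)
  filter_upwards [hnorm, htrans, hlim.eventually (gt_mem_nhds (show 0 < ε / 3 by positivity))]
    with n h1 h2 h3
  have hN : (0 : ℝ) < Fintype.card (Torus d (n + 1)) := by exact_mod_cast Fintype.card_pos
  have hD : 0 < kacNorm φ (n + 1) := hc₀.trans_le h1
  have hvar : ∀ {i j : Torus d (n + 1)}, cubeIndex (m + 1) i = cubeIndex (m + 1) j →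
      ∑ r, |kacWeight φ r - kacWeight φ (r + (i - j))| ≤ ε' := fun h =>
    sum_abs_kacWeight_sub_le hc₀ hε'0.le h1
      (h2 _ fun k => (abs_scaledPos_sub_le_of_cubeIndex_eq h k).trans hm')
  have h4 := pairEntropy_le_sum_blocks_of_slowly_varying
    (cubeIndex (m + 1) : Torus d (n + 1) → Fin d → Fin (m + 1)) hc
    (K := fun i j => kacWeight φ (i - j)) (fun i j => kacWeight_nonneg hφ.nonneg _)
    (sum_kacWeight_row hD) (sum_kacWeight_col hD) (ε := ε')
    (fun j j' h => by
      refine le_trans (le_of_eq ?_) (hvar h)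
      refine Fintype.sum_equiv (Equiv.subRight j) _ _ fun i => ?_
      simp only [Equiv.subRight_apply, sub_add_sub_cancel])
    (fun i i' h => by
      refine le_trans (le_of_eq ?_) (hvar h.symm)
      refine Fintype.sum_equiv (Equiv.subLeft i) _ _ fun j => ?_
      simp only [Equiv.subLeft_apply]
      congr 3
      abel)
  have h5 : ∑ a, meanFieldEntropy c
      (blockCard (cubeIndex (m + 1) : Torus d (n + 1) → Fin d → Fin (m + 1)) a) ≤
      Fintype.card (Torus d (n + 1)) * (p + ε / 3) + ((m + 1) ^ d : ℝ) * C := by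
    refine (Finset.sum_le_sum fun a _ => hC _).trans (le_of_eq ?_)
    rw [Finset.sum_add_distrib, ← Finset.sum_mul, sum_blockCard]
    simp
  rw [div_lt_iff₀ hN] at h3
  have h6 := mul_le_mul_of_nonneg_left hcε hN.le
  rw [div_le_iff₀ hN]
  change kacEntropy φ c (n + 1) ≤ _ at h4
  linarith

theorem tendsto_kacEntropy (hφ : IsKacProfile φ ψ) (hd : 1 ≤ d)
    (hφ0 : ∃ x : EuclideanSpace ℝ (Fin d), x ≠ 0 ∧ (∀ k, |x k| ≤ 1 / 2) ∧ φ x ≠ 0)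
    {c p : ℝ} (hc : 0 ≤ c)
    (hp : Tendsto (fun n : ℕ => meanFieldEntropy c n / n) atTop (𝓝 p)) :
    Tendsto (fun n : ℕ => kacEntropy φ c (n + 1) / Fintype.card (Torus d (n + 1))) atTop
      (𝓝 p) := by
  have hcard := tendsto_card_torus hd
  obtain ⟨c₀, hc₀, hnorm⟩ := exists_le_riemannSum hφ hφ0
  refine tendsto_order.2 ⟨fun a ha => ?_, fun b hb => ?_⟩
  -- The lower bound uses only the sum of the couplings and not their spatial structure.
  · have h1 : Tendsto (fun n : ℕ => meanFieldEntropy c (Fintype.card (Torus d (n + 1))) /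
        Fintype.card (Torus d (n + 1)) - c / Fintype.card (Torus d (n + 1))) atTop (𝓝 (p - 0)) :=
      (hp.comp hcard).sub ((tendsto_const_div_atTop_nhds_zero_nat c).comp hcard)
    rw [sub_zero] at h1
    filter_upwards [h1.eventually (lt_mem_nhds ha), hnorm, hcard.eventually_ge_atTop 2]
      with n h2 h3 h4
    have hD : 0 < kacNorm φ (n + 1) := hc₀.trans_le h3
    have h5 := meanFieldEntropy_le_pairEntropy_add hc h4
      (fun e => mul_nonneg hc (kacWeight_nonneg hφ.nonneg (e.1 - e.2))) (sum_kacWeight_pairs hD c)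
    refine h2.trans_le ?_
    rw [← sub_div]
    refine div_le_div_of_nonneg_right ?_ (Nat.cast_nonneg _)
    rw [kacEntropy]
    linarith
  · filter_upwards [eventually_kacEntropy_le hφ hd hφ0 hc hp (half_pos (sub_pos.2 hb))] with n h1
    linarith

end FreeEnergy

end KacGlass

end

theorem theorem3 (d : ℕ) (hd : 1 ≤ d) (β : ℝ) (hβ : 0 < β)
    (φ : EuclideanSpace ℝ (Fin d) → ℝ) (ψ : ℝ → ℝ) (hφ : KacGlass.IsKacProfile φ ψ)
    (hφ0 : ∃ x : EuclideanSpace ℝ (Fin d), x ≠ 0 ∧ (∀ k, |x k| ≤ 1 / 2) ∧ φ x ≠ 0) :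
    ∃ f : ℝ,
      Tendsto (fun N : ℕ => KacGlass.skFreeEnergy N β) atTop (𝓝 f) ∧
      Tendsto (fun n : ℕ => KacGlass.kacFreeEnergy (n + 1) φ (1 / ((n + 1 : ℕ) : ℝ)) β)
        atTop (𝓝 f) := by
  have hc : 0 ≤ β ^ 2 / 2 := by positivity
  obtain ⟨p, hp⟩ := KacGlass.exists_tendsto_meanFieldEntropy hc
  -- The common limit: `β² / 4` is half of the total signal-to-noise ratio per site, and `p` is the
  -- limiting mean-field entropy per site at `c = β² / 2`.
  refine ⟨-(1 / β) * (β ^ 2 / 4 + p), KacGlass.tendsto_skFreeEnergy hβ hp, ?_⟩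
  have h1 := ((KacGlass.tendsto_kacEntropy hφ hd hφ0 hc hp).const_add (β ^ 2 / 4)).const_mul
    (-(1 / β))
  obtain ⟨c₀, hc₀, hnorm⟩ := KacGlass.exists_le_riemannSum hφ hφ0
  refine h1.congr' ?_
  filter_upwards [hnorm] with n hn
  exact (KacGlass.kacFreeEnergy_eq hφ.nonneg hβ (hc₀.trans_le hn)).symm
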